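/- **Setting.** For $T=1,2,\dots$ let $N=N(T)\ge 1$ and, under $H_0$ (no change in the parameters during the observation period), $$X_{i,t}=\mu_i+\gamma_i\eta_t+e_{i,t},\qquad 1\le i\le N,\ t\in\mathbb Z ,$$ where the real numbers $\mu_i=\mu_i(T)$ and $\gamma_i=\gamma_i(T)$ may depend on $T$, $\{\eta_t\}$ is a real common factor and $\{e_{i,t}\}_{t\in\mathbb Z}$, $i=1,2,\dots$, are idiosyncratic errors; the data are $\mathbf X_t=(X_{1,t},\dots,X_{N,t})^\top$, $1\le t\le T$. Write $\boldsymbol\gamma=(\gamma_1,\dots,\gamma_N)^\top$ and $\mathbf C=\mathrm{cov}(\mathbf X_0)$, with eigenvalues $\lambda_1\ge\dots\ge\lambda_N$ and orthonormal eigenvectors $\mathfrak e_1,\dots,\mathfrak e_N$. A sequence $\{\varepsilon_t\}_{t\in\mathbb Z}$ is an $L^p$-$m$-approximable Bernoulli shift with rate function $\chi$ if $E\varepsilon_t=0$, $E|\varepsilon_t|^p<\infty$, $\varepsilon_t=g(\nu_t,\nu_{t-1},\dots)$ for a measurable $g:\mathbb R^{\infty}\to\mathbb R$ and i.i.d. real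 $\nu_s$, and $(E|\varepsilon_t-\varepsilon_t^{(m)}|^p)^{1/p}=\chi(m)$ for $m\ge1$, where $\varepsilon^{(m)}_t=g(\nu_t,\dots,\nu_{t-m},\nu^*_{t-m-1},\nu^*_{t-m-2},\dots)$ with the $\nu^*$ independent copies of the $\nu$. **Assumptions.** There are an integer $K\ge1$ and constants $c_0,c_4>0$, $c_1,c_2,c_3,c_5,c_6$, $\alpha_\eta,\alpha_e>1$, not depending on $T$, such that 1. $\lambda_i-\lambda_{i+1}\ge c_0$ for all $1\le i\le K$ with $i+1\le N$; 2. $|\gamma_i|\le c_1$ for $1\le i\le N$; 3. $\{\eta_t\}$ is an $L^{12}$-$m$-approximable Bernoulli shift with rate function $\chi_\eta(m)\le c_2m^{-\alpha_\eta}$, and $E\eta_0^2=1$; 4. for every $i\ge1$, $\{e_{i,t}\}_t$ is an $L^{12}$-$m$-approximable Bernoulli shift with rate function $\chi_{e,i}(m)\le c_3m^{-\alpha_e}$, $c_4\le Ee_{i,0}^2\le c_5$ and $Ee_{i,0}^{12}\le c_6$; 5. the sequences $\{\eta_t\},\{e_{1,t}\},\{e_{2,t}\},\dots$ are independent; 6.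 $N(\log T)^{1/3}/T^{1/2}\to0$ as $T\to\infty$. Let $\xi_{1,t}=(\mathfrak e_1^\top(\mathbf X_t-E\mathbf X_0))^2$ and $\sigma_1^2=\sigma_1^2(T)=\sum_{t\in\mathbb Z}\mathrm{cov}(\xi_{1,0},\xi_{1,t})$. The norming is nondegenerate: $\liminf_{T\to\infty}\sigma_1^2(T)>0$ and, unless $\|\boldsymbol\gamma\|$ is bounded in $T$, $\sum_{\ell\in\mathbb Z}\mathrm{cov}(\eta_0^2,\eta_\ell^2)>0$. **Estimator.** Let $\hat{\mathfrak e}_1$ be a unit eigenvector for the largest eigenvalue of $\hat{\mathbf C}=\frac1T\sum_{t=1}^T(\mathbf X_t-\bar{\mathbf X}_T)(\mathbf X_t-\bar{\mathbf X}_T)^\top$, $\bar{\mathbf X}_T=\frac1T\sum_{t=1}^T\mathbf X_t$. For $T\ge2$ let $\hat t^*$ be the least squares estimator of a common break in the means, that is, any minimiser over $k\in\{1,\dots,T-1\}$ of $$\sum_{t=1}^k\Big\|\mathbf X_t-\tfrac1k\sum_{u=1}^k\mathbf X_u\Big\|^2+\sum_{t=k+1}^T\Big\|\mathbf X_t-\tfrac1{T-k}\sum_{u=k+1}^T\mathbf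 X_u\Big\|^2 .$$ Let $\bar{\mathbf X}^*_{T,t}$ be the mean of $\mathbf X_1,\dots,\mathbf X_{\hat t^*}$ if $t\le\hat t^*$, and of $\mathbf X_{\hat t^*+1},\dots,\mathbf X_T$ if $t>\hat t^*$; put $\hat\xi_{1,t}=(\hat{\mathfrak e}_1^\top(\mathbf X_t-\bar{\mathbf X}^*_{T,t}))^2$, $\bar\xi_{1,T}=\frac1T\sum_{t=1}^T\hat\xi_{1,t}$, and for $|s|<T$ $$\hat r_{1,s}=\frac1{T-|s|}\sum_{\substack{1\le t\le T\\ 1\le t+s\le T}}(\hat\xi_{1,t}-\bar\xi_{1,T})(\hat\xi_{1,t+s}-\bar\xi_{1,T}),$$ with $\hat r_{1,s}=0$ for $|s|\ge T$. Let $J:\mathbb R\to\mathbb R$ be continuous and even, with bounded support and $J(0)=1$, and for $M\ge1$ put $$\hat v^2_{1,T}(M)=\sum_{s=-M+1}^{M-1}J\!\left(\frac sh\right)\hat r_{1,s}.$$ **Theorem.** If $h=h(T)\to\infty$ and $hN^3/T^{1/2}\to0$ as $T\to\infty$, then $$\frac{\hat v^2_{1,T}(T)}{\sigma_1^2}\ \xrightarrow{\;P\;}\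 1,\qquad T\to\infty .$$ If moreover $N\to\infty$, then also $\hat v^2_{1,T}(N)/\sigma_1^2\xrightarrow{P}1$. -/

import Mathlib

open MeasureTheory ProbabilityTheory Filter Topology

namespace PanelEigen

noncomputable section

/-! ### Bernoulli shifts -/

/-- The argument sequence `(x 0, …, x m, y (m+1), y (m+2), …)`: the `m + 1` most recent
innovations are kept, all earlier ones are replaced by the independent copies `y`. -/
def splice (m : ℕ) (x y : ℕ → ℝ) : ℕ → ℝ := fun j => if j ≤ m then x j else y j

/-- `(E |ε_t - ε_t^{(m)}|^p)^{1/p}` for `ε_t = g(ν_t, ν_{t-1}, …)` with i.i.d. innovations of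
law `ρ`, where `ε_t^{(m)} = g(ν_t, …, ν_{t-m}, ν*_{t-m-1}, ν*_{t-m-2}, …)` and the `ν*` are
independent copies. It depends only on the joint law of `(ν, ν*)`, which is `ρ^ℕ ⊗ ρ^ℕ`. -/
def couplingError (p : ℕ) (g : (ℕ → ℝ) → ℝ) (ρ : ProbabilityMeasure ℝ) (m : ℕ) : ENNReal :=
  eLpNorm (fun z : (ℕ → ℝ) × (ℕ → ℝ) => g z.1 - g (splice m z.1 z.2)) (p : ENNReal)
    ((Measure.infinitePi fun _ : ℕ => (ρ : Measure ℝ)).prod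
      (Measure.infinitePi fun _ : ℕ => (ρ : Measure ℝ)))

/-- `ε` is an `L^p`-`m`-approximable (centred, stationary) Bernoulli shift with rate
function `χ` (on lags `m ≥ 1`). -/
def IsApproximableShift {Ω : Type*} [MeasurableSpace Ω] (P : Measure Ω) (p : ℕ)
    (ε : ℤ → Ω → ℝ) (χ : ℕ → ENNReal) : Prop :=
  ∃ (ρ : ProbabilityMeasure ℝ) (ν : ℤ → Ω → ℝ) (g : (ℕ → ℝ) → ℝ),
    Measurable g ∧ (∀ s, Measurable (ν s)) ∧ iIndepFun ν P ∧
    (∀ s, P.map (ν s) = (ρ : Measure ℝ)) ∧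
    (∀ t ω, ε t ω = g (fun j : ℕ => ν (t - (j : ℤ)) ω)) ∧
    (∀ t, ∫ ω, ε t ω ∂P = 0) ∧ (∀ t, MemLp (ε t) (p : ENNReal) P) ∧
    ∀ m : ℕ, 1 ≤ m → couplingError p g ρ m = χ m

/-! ### The panel model under the null hypothesis and its population quantities -/

/-- The cross-section vector `X_t ∈ ℝⁿ` with coordinates `X_{i,t} = μ_i + γ_i η_t + e_{i,t}`.
Coordinates are numbered `0, …, n - 1`. -/
def panel {Ω : Type*} (n : ℕ) (μ γ : ℕ → ℝ) (η : ℤ → Ω → ℝ) (e : ℕ → ℤ → Ω → ℝ)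
    (t : ℤ) (ω : Ω) : EuclideanSpace ℝ (Fin n) :=
  WithLp.toLp 2 fun i : Fin n => μ i + γ i * η t ω + e i t ω

/-- `C = cov(X_0)` (which is `cov(X_t)` for every `t` under stationarity). -/
def popCov {Ω : Type*} [MeasurableSpace Ω] (P : Measure Ω) {n : ℕ}
    (X : ℤ → Ω → EuclideanSpace ℝ (Fin n)) : Matrix (Fin n) (Fin n) ℝ :=
  Matrix.of fun i j => cov[fun ω => X 0 ω i, fun ω => X 0 ω j; P]

/-- `lam` lists the eigenvalues of `A` in decreasing order with multiplicity, and `v` is an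
orthonormal basis of corresponding eigenvectors. -/
def IsEigenSystem {n : ℕ} (A : Matrix (Fin n) (Fin n) ℝ) (lam : Fin n → ℝ)
    (v : OrthonormalBasis (Fin n) ℝ (EuclideanSpace ℝ (Fin n))) : Prop :=
  Antitone lam ∧ ∀ i, Matrix.toEuclideanLin A (v i) = lam i • v i

/-- `ξ_t = vᵀ (X_t - E X_0) (X_t - E X_0)ᵀ v`. -/
def xi {Ω : Type*} [MeasurableSpace Ω] (P : Measure Ω) {n : ℕ}
    (X : ℤ → Ω → EuclideanSpace ℝ (Fin n)) (v : EuclideanSpace ℝ (Fin n)) (t : ℤ) (ω : Ω) : ℝ :=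
  (inner ℝ v (X t ω - ∫ ω', X 0 ω' ∂P)) ^ 2

/-- Long-run variance `∑_{t ∈ ℤ} cov(y_0, y_t)`. -/
def longRunVar {Ω : Type*} [MeasurableSpace Ω] (P : Measure Ω) (y : ℤ → Ω → ℝ) : ℝ :=
  ∑' t : ℤ, cov[y 0, y t; P]

/-! ### Sample quantities

A sample of size `T` is the restriction of `x : ℤ → ℝⁿ` to the times `1, …, T`. -/

/-- The mean of `x_{a+1}, …, x_b`. -/
def segMean {n : ℕ} (x : ℤ → EuclideanSpace ℝ (Fin n)) (a b : ℤ) : EuclideanSpace ℝ (Fin n) :=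
  ((b : ℝ) - (a : ℝ))⁻¹ • ∑ t ∈ Finset.Ioc a b, x t

/-- The sample covariance matrix `T⁻¹ ∑_{t=1}^T (x_t - x̄_T)(x_t - x̄_T)ᵀ`. -/
def sampleCov {n : ℕ} (x : ℤ → EuclideanSpace ℝ (Fin n)) (T : ℕ) : Matrix (Fin n) (Fin n) ℝ :=
  Matrix.of fun i j => (T : ℝ)⁻¹ * ∑ t ∈ Finset.Ioc (0 : ℤ) T,
    (x t - segMean x 0 T) i * (x t - segMean x 0 T) j

/-- Total sum of squared residuals when a common mean break is fitted after time `k`. -/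
def ssr {n : ℕ} (x : ℤ → EuclideanSpace ℝ (Fin n)) (T k : ℕ) : ℝ :=
  ∑ t ∈ Finset.Ioc (0 : ℤ) k, ‖x t - segMean x 0 k‖ ^ 2 +
    ∑ t ∈ Finset.Ioc (k : ℤ) T, ‖x t - segMean x k T‖ ^ 2

/-- `k` is a least squares estimate of a common break in the means: it minimises the sum of
squared residuals over `{1, …, T - 1}`. -/
def IsLeastSquaresBreak {n : ℕ} (x : ℤ → EuclideanSpace ℝ (Fin n)) (T k : ℕ) : Prop :=
  (1 ≤ k ∧ k < T) ∧ ∀ j : ℕ, 1 ≤ j → j < T → ssr x T k ≤ ssr x T j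

/-- The segment mean that contains time `t`, for a break after time `k`. -/
def breakMean {n : ℕ} (x : ℤ → EuclideanSpace ℝ (Fin n)) (T k : ℕ) (t : ℤ) :
    EuclideanSpace ℝ (Fin n) :=
  if t ≤ (k : ℤ) then segMean x 0 k else segMean x k T

/-- `ξ̂_t = (vᵀ (x_t - x̄*_t))²`. -/
def xiHat {n : ℕ} (x : ℤ → EuclideanSpace ℝ (Fin n)) (T k : ℕ) (v : EuclideanSpace ℝ (Fin n))
    (t : ℤ) : ℝ :=
  (inner ℝ v (x t - breakMean x T k t)) ^ 2

/-- `T⁻¹ ∑_{t=1}^T y_t`. -/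
def timeMean (y : ℤ → ℝ) (T : ℕ) : ℝ := (T : ℝ)⁻¹ * ∑ t ∈ Finset.Icc (1 : ℤ) T, y t

/-- The lag-`s` sample autocovariance of `y_1, …, y_T`, normalised by `T - |s|`. -/
def autoCov (y : ℤ → ℝ) (T : ℕ) (s : ℤ) : ℝ :=
  if 0 ≤ s then
    ((T : ℝ) - (s : ℝ))⁻¹ * ∑ t ∈ Finset.Icc (1 : ℤ) (T - s),
      (y t - timeMean y T) * (y (t + s) - timeMean y T)
  else
    ((T : ℝ) - |(s : ℝ)|)⁻¹ * ∑ t ∈ Finset.Icc (1 - s) (T : ℤ),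
      (y t - timeMean y T) * (y (t + s) - timeMean y T)

/-- The kernel estimator `∑_{s=-M+1}^{M-1} J(s/h) r̂_s` of the long-run variance, with kernel `J`,
bandwidth `h` and lags `|s| < M`. -/
def kernelLRV (J : ℝ → ℝ) (h : ℝ) (M : ℕ) (y : ℤ → ℝ) (T : ℕ) : ℝ :=
  ∑ s ∈ Finset.Ioo (-(M : ℤ)) (M : ℤ), J ((s : ℝ) / h) * autoCov y T s

end

end PanelEigen

/-! Let `ξ_t` be the squared projection of the centred data on the true leading eigenvector `v`,
`c_s` its autocovariances and `a = v·γ`. The estimator minus `σ₁²` has three parts: the effect of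
estimating the direction and the means, the sampling error of the autocovariances of `ξ`, and the
deterministic error `∑ J(s/h) c_s - σ₁²`.

Dependence. Only the law of the paths matters, so factor and errors are realised from jointly
independent innovations (`map_path_eq`). Exchanging all innovations up to time `c` between two
copies (`swapPast`) preserves the law and decouples the future from the past. The class `Stable`
records the cost of this exchange. It is closed under sums and products, and gives covariance
bounds, fourth moments of order `n²` for sums over dyadic blocks of length `n`, and variance bounds
for lagged products uniform in the lag.

Estimation effect. By the spectral gap the direction is found up to sign with error `O_P(N/√T)`
(`exists_sign_norm_sub_le_of_sampleCov`), and the sign disappears in squares. The break date may lie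
near an end of the sample, where the segment mean is not small. But `exists_dominating_sums` bounds
`|S_k|⁴` by `k T V` for all `k` at once, so `|mean|⁴ k³ = O_P(T)` for each coordinate, and by Hölder
such means contribute only `O_P(√T)` to the sums over a segment. Each autocovariance therefore moves
by `O_P(N³/√T)` (`abs_autoCov_xiHat_sub_le`), and only `O(h)` lags carry weight.

Sampling error. Each lag has mean square error `O(N⁴/T)` on average (`hasMeanBound_lagged`).
Cauchy–Schwarz over the lags gives `O_P(h N²/√T)`.

Deterministic error. Since `σ₁²` may diverge, domination must be relative to it. Independence bounds
`u = ∑ vᵢ eᵢ` in `L⁴` uniformly in the dimension, so `|c_s|` is at most a constant times `(1 + a²)²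
b(|s|)` with `b` summable. In `ξ = a²η² + (2aηu + u²)` the two parts are uncorrelated at all lags
and the second has nonnegative long-run variance, so `σ₁²` is at least `a⁴` times the long-run
variance of `η²`. Nondegeneracy then gives `(1 + a²)² ≤ D σ₁²`, and dominated convergence applies
(`tendsto_kernel_sum_div`).

All randomness is routed through one variable of bounded mean (`HasMeanBound`) that serves every
direction and break date at once. Markov's inequality concludes, and no measurability of the
estimators is involved. -/

open scoped NNReal ENNReal

set_option linter.unusedSectionVars false

namespace PanelEigen

/-! ### Infinite product measures on pairs of sequences -/

section Unzip
variable {ι : Type*} {α β : ι → Type*} [∀ i, MeasurableSpace (α i)] [∀ i, MeasurableSpace (β i)]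

/-- A probability measure, as a measure spanned by the whole space in a generating class. -/
def univSpanning {X : Type*} [MeasurableSpace X] (m : Measure X) [IsProbabilityMeasure m]
    (C : Set (Set X)) (h : Set.univ ∈ C) : m.FiniteSpanningSetsIn C where
  set := fun _ => Set.univ
  set_mem := fun _ => h
  finite := fun _ => by simp
  spanning := by simp [Set.iUnion_const]

/-- Products of square cylinders generate the σ-algebra and are stable under intersection, so it
suffices that both measures agree on them. -/
lemma infinitePi_prod_map_unzip (μ : ∀ i, Measure (α i)) (ν : ∀ i, Measure (β i))
    [∀ i, IsProbabilityMeasure (μ i)] [∀ i, IsProbabilityMeasure (ν i)] :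
    (Measure.infinitePi fun i => (μ i).prod (ν i)).map
      (fun z => ((fun i => (z i).1), fun i => (z i).2)) =
      (Measure.infinitePi μ).prod (Measure.infinitePi ν) := by
  classical
  symm
  refine Measure.prod_eq_generateFrom (C := squareCylinders fun i => {s : Set (α i) | MeasurableSet s})
    (D := squareCylinders fun i => {s : Set (β i) | MeasurableSet s}) generateFrom_squareCylinders
    generateFrom_squareCylinders
    (isPiSystem_squareCylinders (fun _ => MeasurableSpace.isPiSystem_measurableSet) fun _ => .univ)
    (isPiSystem_squareCylinders (fun _ => MeasurableSpace.isPiSystem_measurableSet) fun _ => .univ)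
    (univSpanning _ _ ⟨∅, fun _ => Set.univ, by simp, by simp⟩)
    (univSpanning _ _ ⟨∅, fun _ => Set.univ, by simp, by simp⟩) ?_
  rintro _ ⟨s, A, hA, rfl⟩ _ ⟨t, B, hB, rfl⟩
  have hA' : ∀ i, MeasurableSet (A i) := fun i => hA i trivial
  have hB' : ∀ i, MeasurableSet (B i) := fun i => hB i trivial
  rw [Measure.map_apply (by fun_prop)
    ((MeasurableSet.pi s.countable_toSet fun i _ => hA' i).prod
      (MeasurableSet.pi t.countable_toSet fun i _ => hB' i))]
  -- The two cylinders restrict different finite sets of coordinates; both are padded with `univ` to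
  -- the union.
  have : (fun z : ∀ i, α i × β i => ((fun i => (z i).1), fun i => (z i).2)) ⁻¹'
      ((s : Set ι).pi A ×ˢ (t : Set ι).pi B) =
      ((s ∪ t : Finset ι) : Set ι).pi fun i =>
        (if i ∈ s then A i else Set.univ) ×ˢ (if i ∈ t then B i else Set.univ) := by
    ext z
    simp only [Set.mem_preimage, Set.mem_prod, Set.mem_pi, Finset.mem_coe, Finset.mem_union]
    constructor
    · rintro ⟨h1, h2⟩ i -
      constructor
      · split_ifs with h
        · exact h1 i h
        · trivial
      · split_ifs with h
        · exact h2 i h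
        · trivial
    · intro h
      exact ⟨fun i hi => by simpa [hi] using (h i (Or.inl hi)).1,
        fun i hi => by simpa [hi] using (h i (Or.inr hi)).2⟩
  rw [this, Measure.infinitePi_pi, Measure.infinitePi_pi _ fun i _ => hA' i,
    Measure.infinitePi_pi _ fun i _ => hB' i]
  · simp only [Measure.prod_prod, Finset.prod_mul_distrib]
    congr 1
    · rw [← Finset.prod_subset (Finset.subset_union_left : s ⊆ s ∪ t)]
      · exact Finset.prod_congr rfl fun i hi => by simp [hi]
      · intro i _ hi; simp [hi]
    · rw [← Finset.prod_subset (Finset.subset_union_right : t ⊆ s ∪ t)]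
      · exact Finset.prod_congr rfl fun i hi => by simp [hi]
      · intro i _ hi; simp [hi]
  · intro i _
    refine MeasurableSet.prod ?_ ?_
    · split_ifs
      exacts [hA' i, .univ]
    · split_ifs
      exacts [hB' i, .univ]

lemma measurePreserving_zip (μ : ∀ i, Measure (α i)) (ν : ∀ i, Measure (β i))
    [∀ i, IsProbabilityMeasure (μ i)] [∀ i, IsProbabilityMeasure (ν i)] :
    MeasurePreserving (fun (p : (∀ i, α i) × (∀ i, β i)) i => (p.1 i, p.2 i))
      ((Measure.infinitePi μ).prod (Measure.infinitePi ν))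
      (Measure.infinitePi fun i => (μ i).prod (ν i)) := by
  refine ⟨by fun_prop, ?_⟩
  rw [← infinitePi_prod_map_unzip, Measure.map_map (by fun_prop) (by fun_prop)]
  exact Measure.map_id

/-- Applying measure preserving maps to the pairs of coordinates of two independent sequences. -/
lemma measurePreserving_pairwise (μ : ∀ i, Measure (α i)) [∀ i, IsProbabilityMeasure (μ i)]
    (τ : ∀ i, α i × α i → α i × α i)
    (hτ : ∀ i, MeasurePreserving (τ i) ((μ i).prod (μ i)) ((μ i).prod (μ i))) :
    MeasurePreserving (fun p : (∀ i, α i) × (∀ i, α i) =>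
        ((fun i => (τ i (p.1 i, p.2 i)).1), fun i => (τ i (p.1 i, p.2 i)).2))
      ((Measure.infinitePi μ).prod (Measure.infinitePi μ))
      ((Measure.infinitePi μ).prod (Measure.infinitePi μ)) := by
  -- Zip the two sequences, act on each coordinate, unzip.
  have h1 := measurePreserving_zip μ μ
  have h2 : MeasurePreserving (fun z i => τ i (z i))
      (Measure.infinitePi fun i => (μ i).prod (μ i))
      (Measure.infinitePi fun i => (μ i).prod (μ i)) := by
    refine ⟨measurable_pi_lambda _ fun i => (hτ i).measurable.comp (measurable_pi_apply i), ?_⟩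
    rw [Measure.infinitePi_map_pi _ fun i => (hτ i).measurable]
    congr 1
    funext i
    exact (hτ i).map_eq
  have h3 : MeasurePreserving (fun z : ∀ i, α i × α i => ((fun i => (z i).1), fun i => (z i).2))
      (Measure.infinitePi fun i => (μ i).prod (μ i))
      ((Measure.infinitePi μ).prod (Measure.infinitePi μ)) :=
    ⟨by fun_prop, infinitePi_prod_map_unzip μ μ⟩
  exact h3.comp (h2.comp h1)

end Unzip

/-! ### Innovation arrays and the exchange of their pasts -/

/-- The array of innovations, `ω o s` being the innovation of series `o` at time `s`. -/
abbrev Innov := Option ℕ → ℤ → ℝ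

/-- Exchange the innovations up to time `c` between two arrays. -/
def swapPast (c : ℤ) (p : Innov × Innov) : Innov × Innov :=
  (fun o s => if s ≤ c then p.2 o s else p.1 o s, fun o s => if s ≤ c then p.1 o s else p.2 o s)

/-- The law of independent arrays of i.i.d. innovations. -/
noncomputable def innovLaw (ρ : Option ℕ → ProbabilityMeasure ℝ) : Measure Innov :=
  Measure.infinitePi fun o => Measure.infinitePi fun _ : ℤ => (ρ o : Measure ℝ)

instance (ρ : Option ℕ → ProbabilityMeasure ℝ) : IsProbabilityMeasure (innovLaw ρ) := by
  unfold innovLaw; infer_instance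

lemma measurePreserving_swapPast (ρ : Option ℕ → ProbabilityMeasure ℝ) (c : ℤ) :
    MeasurePreserving (swapPast c) ((innovLaw ρ).prod (innovLaw ρ))
      ((innovLaw ρ).prod (innovLaw ρ)) := by
  -- The pairwise lemma is used twice: over times within one series, then over the series.
  have inner : ∀ o, MeasurePreserving (fun p : (ℤ → ℝ) × (ℤ → ℝ) =>
      ((fun s => ((if s ≤ c then Prod.swap else id) (p.1 s, p.2 s)).1 : ℤ → ℝ),
        (fun s => ((if s ≤ c then Prod.swap else id) (p.1 s, p.2 s)).2 : ℤ → ℝ)))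
      ((Measure.infinitePi fun _ : ℤ => (ρ o : Measure ℝ)).prod
        (Measure.infinitePi fun _ : ℤ => (ρ o : Measure ℝ)))
      ((Measure.infinitePi fun _ : ℤ => (ρ o : Measure ℝ)).prod
        (Measure.infinitePi fun _ : ℤ => (ρ o : Measure ℝ))) := fun o =>
    measurePreserving_pairwise (fun _ : ℤ => (ρ o : Measure ℝ))
      (fun s => if s ≤ c then Prod.swap else id) fun s => by
        split_ifs
        · exact Measure.measurePreserving_swap
        · exact MeasurePreserving.id _
  have := measurePreserving_pairwise (fun o => Measure.infinitePi fun _ : ℤ => (ρ o : Measure ℝ))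
    _ inner
  unfold innovLaw
  convert this using 1
  funext p
  ext o s <;> simp only [swapPast] <;> split_ifs <;> rfl

/-- Shift an array of innovations in time. -/
def timeShift (k : ℤ) (ω : Innov) : Innov := fun o s => ω o (s + k)

lemma measurePreserving_timeShift (ρ : Option ℕ → ProbabilityMeasure ℝ) (k : ℤ) :
    MeasurePreserving (timeShift k) (innovLaw ρ) (innovLaw ρ) := by
  refine ⟨by unfold timeShift; fun_prop, ?_⟩
  unfold innovLaw timeShift
  have := Measure.infinitePi_map_pi (fun o => Measure.infinitePi fun _ : ℤ => (ρ o : Measure ℝ))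
    (f := fun _ (x : ℤ → ℝ) s => x (s + k)) (fun o => by fun_prop)
  rw [this]
  congr 1
  funext o
  exact Measure.map_infinitePi_infinitePi_of_inj (P := fun _ : ℤ => (ρ o : Measure ℝ))
    (f := fun s => s + k) (add_left_injective k)

/-- The innovations of one series in reversed time, starting at time `t`. -/
lemma measurePreserving_reverse (ρ : Option ℕ → ProbabilityMeasure ℝ) (o : Option ℕ) (t : ℤ) :
    MeasurePreserving (fun (ω : Innov) (j : ℕ) => ω o (t - j)) (innovLaw ρ)
      (Measure.infinitePi fun _ : ℕ => (ρ o : Measure ℝ)) := by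
  have h1 : MeasurePreserving (fun (ω : Innov) => ω o) (innovLaw ρ)
      (Measure.infinitePi fun _ : ℤ => (ρ o : Measure ℝ)) :=
    measurePreserving_eval_infinitePi _ o
  have h2 : MeasurePreserving (fun (x : ℤ → ℝ) (j : ℕ) => x (t - j))
      (Measure.infinitePi fun _ : ℤ => (ρ o : Measure ℝ))
      (Measure.infinitePi fun _ : ℕ => (ρ o : Measure ℝ)) :=
    ⟨by fun_prop, Measure.map_infinitePi_infinitePi_of_inj (P := fun _ : ℤ => (ρ o : Measure ℝ))
      (f := fun j : ℕ => t - (j : ℤ)) (fun a b hab => by simpa using hab)⟩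
  exact h2.comp h1

/-- The pairs of innovation sequences of two independent arrays are independent across series. -/
lemma iIndepFun_pair (ρ : Option ℕ → ProbabilityMeasure ℝ) :
    iIndepFun (fun (o : Option ℕ) (p : Innov × Innov) => (p.1 o, p.2 o))
      ((innovLaw ρ).prod (innovLaw ρ)) := by
  have h := measurePreserving_zip (fun o => Measure.infinitePi fun _ : ℤ => (ρ o : Measure ℝ))
    (fun o => Measure.infinitePi fun _ : ℤ => (ρ o : Measure ℝ))
  rw [iIndepFun_iff_map_fun_eq_infinitePi_map (by fun_prop)]
  refine h.map_eq.trans ?_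
  congr 1
  funext o
  have h1 : MeasurePreserving (fun (ω : Innov) => ω o) (innovLaw ρ)
      (Measure.infinitePi fun _ : ℤ => (ρ o : Measure ℝ)) :=
    measurePreserving_eval_infinitePi _ o
  exact (h1.prod h1).map_eq.symm

/-! ### Moment inequalities -/

section LpTools
variable {X : Type*} [MeasurableSpace X] {m : Measure X}

lemma memLp_of_eLpNorm_le {p : ℝ≥0∞} {f : X → ℝ} (hf : Measurable f) {A : ℝ≥0}
    (h : eLpNorm f p m ≤ A) : MemLp f p m :=
  ⟨hf.aestronglyMeasurable, h.trans_lt ENNReal.coe_lt_top⟩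

lemma eLpNorm_pow_eq {n : ℕ} (hn : n ≠ 0) {f : X → ℝ} (hf : MemLp f n m) :
    eLpNorm f n m ^ n = ENNReal.ofReal (∫ x, |f x| ^ n ∂m) := by
  have hn' : (n : ℝ≥0∞) ≠ 0 := by exact_mod_cast hn
  have h0 : 0 ≤ ∫ x, |f x| ^ n ∂m := integral_nonneg fun x => by positivity
  rw [hf.eLpNorm_eq_integral_rpow_norm hn' (ENNReal.natCast_ne_top n)]
  simp only [ENNReal.toReal_natCast, Real.norm_eq_abs, Real.rpow_natCast]
  rw [← ENNReal.ofReal_pow (by positivity), ← Real.rpow_natCast, ← Real.rpow_mul h0,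
    inv_mul_cancel₀ (by exact_mod_cast hn), Real.rpow_one]

lemma integral_pow_le_of_eLpNorm_le {n : ℕ} (hn : n ≠ 0) {f : X → ℝ} (hf : Measurable f) {A : ℝ≥0}
    (h : eLpNorm f n m ≤ A) : ∫ x, |f x| ^ n ∂m ≤ (A : ℝ) ^ n := by
  have h1 := eLpNorm_pow_eq hn (memLp_of_eLpNorm_le hf h)
  have h2 : ENNReal.ofReal (∫ x, |f x| ^ n ∂m) ≤ ENNReal.ofReal ((A : ℝ) ^ n) := by
    rw [← h1, ENNReal.ofReal_pow A.coe_nonneg, ENNReal.ofReal_coe_nnreal]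
    gcongr
  exact (ENNReal.ofReal_le_ofReal_iff (by positivity)).1 h2

lemma eLpNorm_le_of_integral_pow_le {n : ℕ} (hn : n ≠ 0) {f : X → ℝ} (hf : MemLp f n m) {A : ℝ≥0}
    (h : ∫ x, |f x| ^ n ∂m ≤ (A : ℝ) ^ n) : eLpNorm f n m ≤ A := by
  have h1 := eLpNorm_pow_eq hn hf
  refine (ENNReal.pow_le_pow_left_iff hn).1 ?_
  rw [h1, ← ENNReal.ofReal_coe_nnreal, ← ENNReal.ofReal_pow A.coe_nonneg]
  exact ENNReal.ofReal_le_ofReal h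

lemma eLpNorm_mul_le {p q r : ℝ≥0∞} [ENNReal.HolderTriple p q r] {f g : X → ℝ} (hf : Measurable f)
    (hg : Measurable g) {A B : ℝ≥0} (h1 : eLpNorm f p m ≤ A) (h2 : eLpNorm g q m ≤ B) :
    eLpNorm (fun x => f x * g x) r m ≤ (A * B : ℝ≥0) := by
  have := eLpNorm_smul_le_mul_eLpNorm (μ := m) (p := p) (q := q) (r := r) (φ := f) (f := g)
    hg.aestronglyMeasurable hf.aestronglyMeasurable
  calc eLpNorm (fun x => f x * g x) r m ≤ eLpNorm f p m * eLpNorm g q m := this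
    _ ≤ A * B := by gcongr
    _ = _ := by simp

lemma abs_integral_mul_le {f g : X → ℝ} (hf : Measurable f)
    (hg : Measurable g) {A B : ℝ≥0} (h1 : eLpNorm f 2 m ≤ A) (h2 : eLpNorm g 2 m ≤ B) :
    |∫ x, f x * g x ∂m| ≤ A * B := by
  have h := eLpNorm_mul_le (r := 1) hf hg h1 h2
  have := integral_pow_le_of_eLpNorm_le (n := 1) one_ne_zero (f := fun x => f x * g x) (hf.mul hg)
    (by exact_mod_cast h)
  calc |∫ x, f x * g x ∂m| ≤ ∫ x, |f x * g x| ∂m := abs_integral_le_integral_abs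
    _ ≤ _ := by simpa using this

lemma eLpNorm_comp_measurePreserving' {Y : Type*} [MeasurableSpace Y] {m' : Measure Y} {T : X → Y}
    (hT : MeasurePreserving T m m') {f : Y → ℝ} (hf : Measurable f) (p : ℝ≥0∞) :
    eLpNorm (fun x => f (T x)) p m = eLpNorm f p m' :=
  eLpNorm_comp_measurePreserving hf.aestronglyMeasurable hT

lemma integral_comp_measurePreserving {Y : Type*} [MeasurableSpace Y] {m' : Measure Y} {T : X → Y}
    (hT : MeasurePreserving T m m') {f : Y → ℝ} (hf : Measurable f) :
    ∫ x, f (T x) ∂m = ∫ y, f y ∂m' := by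
  rw [← hT.map_eq, integral_map hT.measurable.aemeasurable hf.aestronglyMeasurable]

/-- Square-summed covariances control the second moment of a sum. -/
lemma integral_sum_sq_le {ι : Type*} (I : Finset ι) {U : ι → X → ℝ} (hU : ∀ i, MemLp (U i) 2 m)
    {D : ℝ} (hD : ∀ s ∈ I, ∑ t ∈ I, |∫ x, U s x * U t x ∂m| ≤ D) :
    ∫ x, (∑ t ∈ I, U t x) ^ 2 ∂m ≤ I.card * D := by
  have hint : ∀ s t, Integrable (fun x => U s x * U t x) m := fun s t => (hU s).integrable_mul (hU t)
  calc ∫ x, (∑ t ∈ I, U t x) ^ 2 ∂m = ∑ s ∈ I, ∑ t ∈ I, ∫ x, U s x * U t x ∂m := by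
        simp only [pow_two, Finset.sum_mul_sum]
        rw [integral_finsetSum _ fun s _ => integrable_finsetSum _ fun t _ => hint s t]
        exact Finset.sum_congr rfl fun s _ => integral_finsetSum _ fun t _ => hint s t
    _ ≤ ∑ s ∈ I, ∑ t ∈ I, |∫ x, U s x * U t x ∂m| := by
        gcongr
        exact le_abs_self _
    _ ≤ ∑ s ∈ I, D := Finset.sum_le_sum hD
    _ = _ := by simp

end LpTools

/-- The distance to `s` is injective on either side of `s`, hence the factor 2. -/
lemma sum_natAbs_le {β : ℕ → ℝ} (h0 : ∀ n, 0 ≤ β n) (hβ : Summable β) (I : Finset ℤ) (s : ℤ) :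
    ∑ t ∈ I, β (t - s).natAbs ≤ 2 * ∑' n, β n := by
  classical
  have key : ∀ J : Finset ℤ, Set.InjOn (fun t : ℤ => (t - s).natAbs) J →
      ∑ t ∈ J, β (t - s).natAbs ≤ ∑' n, β n := by
    intro J hJ
    rw [← Finset.sum_image (f := β) hJ]
    exact hβ.sum_le_tsum _ fun n _ => h0 n
  rw [← Finset.sum_filter_add_sum_filter_not I (fun t => s ≤ t), two_mul]
  refine add_le_add (key _ ?_) (key _ ?_)
  · intro a ha b hb hab
    simp only [Finset.coe_filter, Set.mem_ofPred_eq] at ha hb hab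
    omega
  · intro a ha b hb hab
    simp only [Finset.coe_filter, Set.mem_ofPred_eq] at ha hb hab
    omega

/-! ### Stable processes: closure properties and decoupling -/

section Coupling
variable {S : Type*} [MeasurableSpace S]

/-- `U` is a causal process, bounded in `L^p` by `K`, whose value at time `t` changes by at most
`K b (t - c)` in `L^p` when the innovations up to time `c` are replaced by independent copies.
The map `σ c` exchanges these innovations between two copies. -/
structure Stable (Q : Measure S) (σ : ℤ → S × S → S × S) (b : ℕ → ℝ≥0) (p : ℝ≥0∞) (K : ℝ≥0)
    (U : ℤ → S → ℝ) : Prop where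
  meas : ∀ t, Measurable (U t)
  causal : ∀ c t, t ≤ c → ∀ x, U t (σ c x).2 = U t x.1
  bound : ∀ t, eLpNorm (U t) p Q ≤ K
  couple : ∀ c t, c < t →
    eLpNorm (fun x : S × S => U t x.1 - U t (σ c x).1) p (Q.prod Q) ≤ (K * b (t - c).toNat : ℝ≥0)

variable {Q : Measure S} [IsProbabilityMeasure Q] {σ : ℤ → S × S → S × S} {b : ℕ → ℝ≥0}
  {p q r : ℝ≥0∞} {K K' : ℝ≥0} {U V : ℤ → S → ℝ}

namespace Stable

lemma memLp (h : Stable Q σ b p K U) (t : ℤ) : MemLp (U t) p Q :=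
  memLp_of_eLpNorm_le (h.meas t) (h.bound t)

lemma mono_const (h : Stable Q σ b p K U) (hK : K ≤ K') : Stable Q σ b p K' U where
  meas := h.meas
  causal := h.causal
  bound t := (h.bound t).trans (by exact_mod_cast hK)
  couple c t hct := (h.couple c t hct).trans (by gcongr)

lemma mono_exponent (hσ : ∀ c, Measurable (σ c)) (h : Stable Q σ b p K U) (hqp : q ≤ p) :
    Stable Q σ b q K U where
  meas := h.meas
  causal := h.causal
  bound t := (eLpNorm_le_eLpNorm_of_exponent_le hqp (h.meas t).aestronglyMeasurable).trans
    (h.bound t)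
  couple c t hct := by
    have := h.meas t
    have := hσ c
    exact (eLpNorm_le_eLpNorm_of_exponent_le hqp
      (Measurable.aestronglyMeasurable (by fun_prop))).trans (h.couple c t hct)

lemma const_mul (a : ℝ) (h : Stable Q σ b p K U) :
    Stable Q σ b p (‖a‖₊ * K) (fun t x => a * U t x) where
  meas t := (h.meas t).const_mul a
  causal c t htc x := by simp only [h.causal c t htc x]
  bound t := by
    have := eLpNorm_const_smul a (U t) p Q
    simp only [Pi.smul_def, smul_eq_mul] at this
    rw [this, ENNReal.coe_mul]
    exact mul_le_mul_right (h.bound t) _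
  couple c t hct := by
    have := eLpNorm_const_smul a (fun x : S × S => U t x.1 - U t (σ c x).1) p (Q.prod Q)
    simp only [Pi.smul_def, smul_eq_mul, mul_sub] at this
    rw [this, mul_assoc, ENNReal.coe_mul]
    exact mul_le_mul_right (h.couple c t hct) _

lemma add (hσ : ∀ c, Measurable (σ c)) (hp : 1 ≤ p) (h : Stable Q σ b p K U)
    (h' : Stable Q σ b p K' V) : Stable Q σ b p (K + K') (fun t x => U t x + V t x) where
  meas t := (h.meas t).add (h'.meas t)
  causal c t htc x := by simp only [h.causal c t htc x, h'.causal c t htc x]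
  bound t := by
    refine (eLpNorm_add_le (h.meas t).aestronglyMeasurable (h'.meas t).aestronglyMeasurable hp).trans
      ?_
    rw [ENNReal.coe_add]
    exact add_le_add (h.bound t) (h'.bound t)
  couple c t hct := by
    have h1 := h.meas t
    have h2 := h'.meas t
    have h3 := hσ c
    have := eLpNorm_add_le (μ := Q.prod Q) (p := p)
      (f := fun x : S × S => U t x.1 - U t (σ c x).1) (g := fun x => V t x.1 - V t (σ c x).1)
      (Measurable.aestronglyMeasurable (by fun_prop))
      (Measurable.aestronglyMeasurable (by fun_prop)) hp
    rw [add_mul, ENNReal.coe_add]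
    refine le_trans (le_of_eq ?_) (this.trans (add_le_add (h.couple c t hct) (h'.couple c t hct)))
    congr 1
    funext x
    simp only [Pi.add_apply]
    ring

lemma zero : Stable Q σ b p 0 (fun _ _ => 0) where
  meas _ := measurable_const
  causal _ _ _ _ := rfl
  bound _ := by simp
  couple _ _ _ := by simp

lemma sum {ι : Type*} (hσ : ∀ c, Measurable (σ c)) (hp : 1 ≤ p) (I : Finset ι) {κ : ι → ℝ≥0}
    {W : ι → ℤ → S → ℝ} (h : ∀ i ∈ I, Stable Q σ b p (κ i) (W i)) :
    Stable Q σ b p (∑ i ∈ I, κ i) (fun t x => ∑ i ∈ I, W i t x) := by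
  classical
  induction I using Finset.induction_on with
  | empty => simpa using zero
  | insert i I hi ih =>
    simp only [Finset.sum_insert hi]
    exact (h i (Finset.mem_insert_self _ _)).add hσ hp
      (ih fun j hj => h j (Finset.mem_insert_of_mem hj))

lemma sub_const (hp : 1 ≤ p) (h : Stable Q σ b p K U) {a : ℤ → ℝ}
    (ha : ∀ t, |a t| ≤ K') : Stable Q σ b p (K + K') (fun t x => U t x - a t) where
  meas t := (h.meas t).sub_const _
  causal c t htc x := by simp only [h.causal c t htc x]
  bound t := by
    refine (eLpNorm_sub_le (h.meas t).aestronglyMeasurable aestronglyMeasurable_const hp).trans ?_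
    rw [ENNReal.coe_add]
    refine add_le_add (h.bound t) ?_
    rw [eLpNorm_const _ (by positivity) (NeZero.ne Q)]
    simp only [measure_univ, ENNReal.one_rpow, mul_one, enorm_le_coe]
    rw [← NNReal.coe_le_coe]
    simpa using ha t
  couple c t hct := by
    simp only [sub_sub_sub_cancel_right]
    exact (h.couple c t hct).trans (by gcongr; exact le_self_add)

/-- Telescoping of a product plus Hölder. The two times may differ, as products at a fixed lag
require. -/
lemma couple_mul [ENNReal.HolderTriple p q r] (hr : 1 ≤ r)
    (hσ : ∀ c, MeasurePreserving (σ c) (Q.prod Q) (Q.prod Q)) (h : Stable Q σ b p K U)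
    (h' : Stable Q σ b q K' V) {c s t : ℤ} (hs : c < s) (ht : c < t) :
    eLpNorm (fun x : S × S => U s x.1 * V t x.1 - U s (σ c x).1 * V t (σ c x).1) r (Q.prod Q) ≤
      (K * K' * (b (t - c).toNat + b (s - c).toNat) : ℝ≥0) := by
  have h1 := h.meas s
  have h2 := h'.meas t
  have h3 := (hσ c).measurable
  have hU : eLpNorm (fun x : S × S => U s x.1) p (Q.prod Q) ≤ K := by
    rw [eLpNorm_comp_measurePreserving' measurePreserving_fst h1]
    exact h.bound s
  have hV : eLpNorm (fun x : S × S => V t (σ c x).1) q (Q.prod Q) ≤ K' :=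
    (eLpNorm_comp_measurePreserving' (measurePreserving_fst.comp (hσ c)) h2 q).trans_le (h'.bound t)
  have e1 := eLpNorm_mul_le (r := r) (by fun_prop) (by fun_prop) hU (h'.couple c t ht)
  have e2 := eLpNorm_mul_le (r := r) (by fun_prop) (by fun_prop) (h.couple c s hs) hV
  have := eLpNorm_add_le (μ := Q.prod Q) (p := r)
    (f := fun x : S × S => U s x.1 * (V t x.1 - V t (σ c x).1))
    (g := fun x : S × S => (U s x.1 - U s (σ c x).1) * V t (σ c x).1)
    (Measurable.aestronglyMeasurable (by fun_prop))
    (Measurable.aestronglyMeasurable (by fun_prop)) hr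
  refine le_trans (le_of_eq ?_) (this.trans ((add_le_add e1 e2).trans (le_of_eq ?_)))
  · congr 1
    funext x
    simp only [Pi.add_apply]
    ring
  · rw [← ENNReal.coe_add]
    congr 1
    ring

lemma mul [ENNReal.HolderTriple p q r] (hr : 1 ≤ r)
    (hσ : ∀ c, MeasurePreserving (σ c) (Q.prod Q) (Q.prod Q)) (h : Stable Q σ b p K U)
    (h' : Stable Q σ b q K' V) : Stable Q σ b r (2 * (K * K')) (fun t x => U t x * V t x) where
  meas t := (h.meas t).mul (h'.meas t)
  causal c t htc x := by simp only [h.causal c t htc x, h'.causal c t htc x]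
  bound t := by
    refine (eLpNorm_mul_le (h.meas t) (h'.meas t) (h.bound t) (h'.bound t)).trans ?_
    rw [two_mul]
    exact_mod_cast le_self_add
  couple c t hct := (couple_mul hr hσ h h' hct hct).trans (le_of_eq (by congr 1; ring))

end Stable

/-- Replacing the innovations up to time `c` by independent copies decouples from the past. -/
lemma integral_mul_swap (hσ : ∀ c, MeasurePreserving (σ c) (Q.prod Q) (Q.prod Q)) {c : ℤ}
    {F G : S → ℝ} (hF : Measurable F) (hG : Measurable G) (hpast : ∀ x, F (σ c x).2 = F x.1) :
    ∫ x : S × S, F x.1 * G (σ c x).1 ∂(Q.prod Q) = (∫ x, F x ∂Q) * ∫ x, G x ∂Q := by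
  -- `F` depends on the past only, so it can be read off the second copy after the exchange. A
  -- change of variables then puts `F` and `G` on different, independent copies.
  calc ∫ x : S × S, F x.1 * G (σ c x).1 ∂(Q.prod Q)
      = ∫ x : S × S, (fun y : S × S => G y.1 * F y.2) (σ c x) ∂(Q.prod Q) := by
        congr 1; funext x; simp only [hpast]; ring
    _ = ∫ y : S × S, G y.1 * F y.2 ∂(Q.prod Q) :=
        integral_comp_measurePreserving (hσ c) (f := fun y : S × S => G y.1 * F y.2) (by fun_prop)
    _ = _ := by rw [integral_prod_mul, mul_comm]

/-- By `integral_mul_swap` the covariance is the expectation of `F` times the coupling error of `G`;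
apply Cauchy–Schwarz. -/
lemma abs_cov_le_of_couple (hσ : ∀ c, MeasurePreserving (σ c) (Q.prod Q) (Q.prod Q)) {c : ℤ}
    {F G : S → ℝ} (hF : Measurable F) (hG : Measurable G) (hpast : ∀ x, F (σ c x).2 = F x.1)
    {A B : ℝ≥0} (hFA : eLpNorm F 2 Q ≤ A) (hG2 : MemLp G 2 Q)
    (hGB : eLpNorm (fun x : S × S => G x.1 - G (σ c x).1) 2 (Q.prod Q) ≤ B) :
    |∫ x, F x * G x ∂Q - (∫ x, F x ∂Q) * ∫ x, G x ∂Q| ≤ A * B := by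
  have hs := (hσ c).measurable
  have hF1 : eLpNorm (fun x : S × S => F x.1) 2 (Q.prod Q) ≤ A := by
    rw [eLpNorm_comp_measurePreserving' measurePreserving_fst hF]; exact hFA
  have hFL := memLp_of_eLpNorm_le (by fun_prop) hF1
  have hG1 : MemLp (fun x : S × S => G x.1) 2 (Q.prod Q) :=
    hG2.comp_measurePreserving measurePreserving_fst
  have hG3 : MemLp (fun x : S × S => G (σ c x).1) 2 (Q.prod Q) :=
    hG2.comp_measurePreserving (measurePreserving_fst.comp (hσ c))
  have e1 : ∫ x, F x * G x ∂Q = ∫ x : S × S, F x.1 * G x.1 ∂(Q.prod Q) :=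
    (integral_comp_measurePreserving (m := Q.prod Q) (T := Prod.fst) (f := fun x => F x * G x)
      measurePreserving_fst (hF.mul hG)).symm
  have e2 := integral_sub (hFL.integrable_mul hG1) (hFL.integrable_mul hG3)
  simp only [Pi.mul_apply, ← mul_sub] at e2
  rw [← integral_mul_swap hσ hF hG hpast, e1, ← e2]
  exact abs_integral_mul_le (by fun_prop) (by fun_prop) hF1 hGB

end Coupling

/-! ### Covariances and fourth moments of sums over time -/

section Temporal
variable {S : Type*} [MeasurableSpace S]
variable {Q : Measure S} [IsProbabilityMeasure Q] {σ : ℤ → S × S → S × S} {b : ℕ → ℝ≥0}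
  {p q r : ℝ≥0∞} {K K' : ℝ≥0} {U V : ℤ → S → ℝ}

instance holderTriple_four : ENNReal.HolderTriple 4 4 2 :=
  ⟨by
    have h4 : (4 : ℝ≥0∞)⁻¹ = 2⁻¹ * 2⁻¹ := by
      rw [← ENNReal.mul_inv (by norm_num) (by norm_num)]; norm_num
    rw [h4, ← mul_add, ENNReal.inv_two_add_inv_two, mul_one]⟩

namespace Stable

lemma abs_integral_le_two (h : Stable Q σ b 2 K U) (t : ℤ) : |∫ x, U t x ∂Q| ≤ K := by
  have := abs_integral_mul_le (m := Q) (h.meas t) (g := fun _ => 1) measurable_const (B := 1)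
    (h.bound t) (by rw [eLpNorm_const _ (by norm_num) (NeZero.ne Q)]; simp)
  simpa using this

/-- For `s < t` the innovations up to `s` are exchanged. For `s = t` there is nothing to decouple:
plain moment bounds suffice because `1 ≤ b 0`, and they cause the factor 2. -/
lemma abs_cov_le (hσ : ∀ c, MeasurePreserving (σ c) (Q.prod Q) (Q.prod Q)) (hb : 1 ≤ b 0)
    (h : Stable Q σ b 2 K U) (h' : Stable Q σ b 2 K' V) {s t : ℤ} (hst : s ≤ t) :
    |∫ x, U s x * V t x ∂Q - (∫ x, U s x ∂Q) * ∫ x, V t x ∂Q| ≤ 2 * (K * K') * b (t - s).natAbs := by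
  rcases hst.eq_or_lt with rfl | hlt
  · have e1 := abs_integral_mul_le (h.meas s) (h'.meas s) (h.bound s) (h'.bound s)
    have e2 : |(∫ x, U s x ∂Q) * ∫ x, V s x ∂Q| ≤ K * K' := by
      rw [abs_mul]
      exact mul_le_mul (h.abs_integral_le_two s) (h'.abs_integral_le_two s) (abs_nonneg _) K.2
    have e3 : (1 : ℝ) ≤ b 0 := by exact_mod_cast hb
    have e4 : (0 : ℝ) ≤ K * K' := by positivity
    simp only [sub_self, Int.natAbs_zero]
    refine (abs_sub _ _).trans ?_
    nlinarith
  · have hb' : (t - s).toNat = (t - s).natAbs := by omega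
    have := abs_cov_le_of_couple hσ (h.meas s) (h'.meas t) (h.causal s s le_rfl) (h.bound s)
      (h'.memLp t) (h'.couple s t hlt)
    rw [hb', NNReal.coe_mul] at this
    refine this.trans ?_
    have e4 : (0 : ℝ) ≤ K * K' * b (t - s).natAbs := by positivity
    nlinarith

lemma abs_cov_self_le (hσ : ∀ c, MeasurePreserving (σ c) (Q.prod Q) (Q.prod Q)) (hb : 1 ≤ b 0)
    (h : Stable Q σ b 2 K U) (s t : ℤ) :
    |cov[U s, U t; Q]| ≤ 2 * (K * K) * b (t - s).natAbs := by
  rcases le_total s t with hst | hst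
  · rw [covariance_eq_sub (h.memLp s) (h.memLp t)]
    exact h.abs_cov_le hσ hb h hst
  · rw [covariance_comm, covariance_eq_sub (h.memLp t) (h.memLp s), ← Int.natAbs_neg, neg_sub]
    exact h.abs_cov_le hσ hb h hst

/-- The variance of a sum over `n` time points is `O(n)`. -/
lemma integral_sum_sq_le (hσ : ∀ c, MeasurePreserving (σ c) (Q.prod Q) (Q.prod Q)) (hb : 1 ≤ b 0)
    (hbs : Summable fun n => (b n : ℝ)) (h : Stable Q σ b 2 K U) (I : Finset ℤ) :
    ∫ x, (∑ t ∈ I, (U t x - ∫ y, U t y ∂Q)) ^ 2 ∂Q ≤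
      I.card * (4 * K ^ 2 * ∑' n, (b n : ℝ)) := by
  refine PanelEigen.integral_sum_sq_le I (U := fun t x => U t x - ∫ y, U t y ∂Q)
    (fun t => (h.memLp t).sub (memLp_const _)) fun s _ => ?_
  calc ∑ t ∈ I, |∫ x, (U s x - ∫ y, U s y ∂Q) * (U t x - ∫ y, U t y ∂Q) ∂Q|
      ≤ ∑ t ∈ I, 2 * (K * K) * (b (t - s).natAbs : ℝ) :=
        Finset.sum_le_sum fun t _ => h.abs_cov_self_le hσ hb s t
    _ = 2 * (K * K) * ∑ t ∈ I, (b (t - s).natAbs : ℝ) := by rw [Finset.mul_sum]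
    _ ≤ 2 * (K * K) * (2 * ∑' n, (b n : ℝ)) := by
        gcongr
        exact sum_natAbs_le (β := fun n => (b n : ℝ)) (fun n => (b n).2) hbs I s
    _ = _ := by ring

end Stable

/-- Convexity with weights 7/8 and 1/8 gives `(8/7)³ < 3/2` and `8³ = 512`. A first constant below 2
is essential: doubling a block multiplies the bound by `2 · 3/2 = 3`, which stays below the factor 4
required for order `n²`. -/
lemma add_pow_four_le (x y : ℝ) : (x + y) ^ 4 ≤ 3 / 2 * x ^ 4 + 512 * y ^ 4 := by
  have h := (Even.convexOn_pow (𝕜 := ℝ) (n := 4) (by decide)).2 (Set.mem_univ (8 / 7 * x))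
    (Set.mem_univ (8 * y)) (show (0 : ℝ) ≤ 7 / 8 by norm_num) (show (0 : ℝ) ≤ 1 / 8 by norm_num)
    (by norm_num)
  simp only [smul_eq_mul] at h
  have e : 7 / 8 * (8 / 7 * x) + 1 / 8 * (8 * y) = x + y := by ring
  rw [e] at h
  nlinarith [sq_nonneg (x ^ 2), sq_nonneg (y ^ 2)]

lemma sum_Ioc_split {M : Type*} [AddCommMonoid M] (f : ℤ → M) {a c d : ℤ} (h1 : a ≤ c)
    (h2 : c ≤ d) : ∑ t ∈ Finset.Ioc a d, f t = ∑ t ∈ Finset.Ioc a c, f t + ∑ t ∈ Finset.Ioc c d, f t := by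
  rw [← Finset.Ioc_union_Ioc_eq_Ioc h1 h2, Finset.sum_union]
  rw [Finset.disjoint_left]
  intro x hx hx'
  simp only [Finset.mem_Ioc] at hx hx'
  omega

/-- The fourth moment of a sum of two centred variables whose mixed moments factorise. -/
lemma integral_add_pow_four {X : Type*} [MeasurableSpace X] {m : Measure X} [IsProbabilityMeasure m]
    {f g : X → ℝ} (hf : MemLp f 4 m) (hg : MemLp g 4 m) (hf0 : ∫ x, f x ∂m = 0)
    (hg0 : ∫ x, g x ∂m = 0)
    (hfg : ∀ i j : ℕ, ∫ x, f x ^ i * g x ^ j ∂m = (∫ x, f x ^ i ∂m) * ∫ x, g x ^ j ∂m) :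
    ∫ x, (f x + g x) ^ 4 ∂m =
      ∫ x, f x ^ 4 ∂m + 6 * ((∫ x, f x ^ 2 ∂m) * ∫ x, g x ^ 2 ∂m) + ∫ x, g x ^ 4 ∂m := by
  have key : ∀ {f : X → ℝ}, MemLp f 4 m → Integrable (fun x => f x ^ 4) m := by
    intro f hf
    refine (hf.integrable_norm_pow (p := 4) (by norm_num)).congr (ae_of_all _ fun x => ?_)
    simp [Even.pow_abs (by decide : Even 4)]
  -- Mixed monomials of degree four are at most `max (|f|, |g|)⁴`, hence integrable.
  have dom : ∀ i j : ℕ, i + j = 4 → Integrable (fun x => f x ^ i * g x ^ j) m := by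
    intro i j hij
    refine ((key hf).add (key hg)).mono'
      ((hf.aestronglyMeasurable.pow i).mul (hg.aestronglyMeasurable.pow j))
      (ae_of_all _ fun x => ?_)
    have e : ‖f x ^ i * g x ^ j‖ = |f x| ^ i * |g x| ^ j := by simp
    rw [e, Pi.add_apply]
    have hm : |f x| ^ i * |g x| ^ j ≤ max |f x| |g x| ^ i * max |f x| |g x| ^ j := by
      gcongr
      · exact le_max_left _ _
      · exact le_max_right _ _
    rw [← pow_add, hij] at hm
    refine hm.trans ?_
    rcases max_choice |f x| |g x| with h | h <;> rw [h, Even.pow_abs (by decide : Even 4)]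
    · have : 0 ≤ g x ^ 4 := by positivity
      linarith
    · have : 0 ≤ f x ^ 4 := by positivity
      linarith
  have expand : ∀ x, (f x + g x) ^ 4 = f x ^ 4 * g x ^ 0 + 4 * (f x ^ 3 * g x ^ 1) +
      6 * (f x ^ 2 * g x ^ 2) + 4 * (f x ^ 1 * g x ^ 3) + f x ^ 0 * g x ^ 4 := fun x => by ring
  simp only [expand]
  have j1 := dom 4 0 rfl
  have j2 := (dom 3 1 rfl).const_mul 4
  have j3 := (dom 2 2 rfl).const_mul 6
  have j4 := (dom 1 3 rfl).const_mul 4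
  have j5 := dom 0 4 rfl
  have k5 := integral_add (((j1.add j2).add j3).add j4) j5
  have k4 := integral_add ((j1.add j2).add j3) j4
  have k3 := integral_add (j1.add j2) j3
  have k2 := integral_add j1 j2
  simp only [Pi.add_apply] at k2 k3 k4 k5
  rw [k5, k4, k3, k2]
  simp only [integral_const_mul, hfg]
  simp [hf0, hg0]

/-- The fourth moment of a sum of two variables, the second one decoupled from the first. -/
lemma integral_add_swap_pow_four (hσ : ∀ c, MeasurePreserving (σ c) (Q.prod Q) (Q.prod Q)) {c : ℤ}
    {F G : S → ℝ} (hF : Measurable F) (hG : Measurable G) (hpast : ∀ x, F (σ c x).2 = F x.1)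
    (hF4 : MemLp F 4 Q) (hG4 : MemLp G 4 Q) (hF0 : ∫ x, F x ∂Q = 0) (hG0 : ∫ x, G x ∂Q = 0) :
    ∫ x : S × S, (F x.1 + G (σ c x).1) ^ 4 ∂(Q.prod Q) =
      ∫ x, F x ^ 4 ∂Q + 6 * ((∫ x, F x ^ 2 ∂Q) * ∫ x, G x ^ 2 ∂Q) + ∫ x, G x ^ 4 ∂Q := by
  have hmp := measurePreserving_fst.comp (hσ c)
  have eF : ∀ i : ℕ, ∫ x : S × S, F x.1 ^ i ∂(Q.prod Q) = ∫ x, F x ^ i ∂Q := fun i =>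
    integral_comp_measurePreserving (m := Q.prod Q) (T := Prod.fst) measurePreserving_fst
      (hF.pow_const i)
  have eG : ∀ i : ℕ, ∫ x : S × S, G (σ c x).1 ^ i ∂(Q.prod Q) = ∫ x, G x ^ i ∂Q := fun i =>
    integral_comp_measurePreserving hmp (hG.pow_const i)
  have h := integral_add_pow_four (m := Q.prod Q) (hF4.comp_measurePreserving measurePreserving_fst)
    (hG4.comp_measurePreserving hmp) (by simpa [hF0] using eF 1) (by simpa [hG0] using eG 1) ?_
  · simpa only [Function.comp_apply, eF, eG] using h
  · intro i j
    simp only [Function.comp_apply, eF, eG]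
    exact integral_mul_swap hσ (F := fun x => F x ^ i) (G := fun x => G x ^ j) (hF.pow_const i)
      (hG.pow_const j) (fun x => by simp only [hpast])

lemma integral_add_pow_four_le {X : Type*} [MeasurableSpace X] {m : Measure X} {f g : X → ℝ}
    (hf : MemLp f 4 m) (hg : MemLp g 4 m) :
    ∫ x, (f x + g x) ^ 4 ∂m ≤ 3 / 2 * ∫ x, f x ^ 4 ∂m + 512 * ∫ x, g x ^ 4 ∂m := by
  have key : ∀ {f : X → ℝ}, MemLp f 4 m → Integrable (fun x => f x ^ 4) m := by
    intro f hf
    refine (hf.integrable_norm_pow (p := 4) (by norm_num)).congr (ae_of_all _ fun x => ?_)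
    simp [Even.pow_abs (by decide : Even 4)]
  rw [← integral_const_mul, ← integral_const_mul, ← integral_add ((key hf).const_mul _)
    ((key hg).const_mul _)]
  exact integral_mono (key (hf.add hg)) (((key hf).const_mul _).add ((key hg).const_mul _))
    fun x => add_pow_four_le _ _

/-- The fourth moment of a sum over a dyadic block of length `n` is `O(n²)`. -/
lemma Stable.integral_block_pow_four_le
    (hσ : ∀ c, MeasurePreserving (σ c) (Q.prod Q) (Q.prod Q)) (hb : 1 ≤ b 0)
    (hbs : Summable fun n => (b n : ℝ)) (h : Stable Q σ b 4 K U) (h0 : ∀ t, ∫ x, U t x ∂Q = 0)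
    (r : ℕ) (a : ℤ) :
    ∫ x, (∑ t ∈ Finset.Ioc a (a + 2 ^ r), U t x) ^ 4 ∂Q ≤
      (144 * K ^ 4 * (∑' n, (b n : ℝ)) ^ 2 + 512 * K ^ 4 * (∑' n, (b n : ℝ)) ^ 4 + K ^ 4) *
        (4 : ℝ) ^ r := by
  set B := ∑' n, (b n : ℝ) with hB
  have hB0 : 0 ≤ B := tsum_nonneg fun n => (b n).2
  have hσm : ∀ c, Measurable (σ c) := fun c => (hσ c).measurable
  have h2 : Stable Q σ b 2 K U := h.mono_exponent hσm (by norm_num)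
  have hI : ∀ I : Finset ℤ, Measurable fun x => ∑ t ∈ I, U t x := fun I =>
    Finset.measurable_fun_sum I fun t _ => h.meas t
  have hI4 : ∀ I : Finset ℤ, MemLp (fun x => ∑ t ∈ I, U t x) 4 Q := fun I =>
    memLp_finsetSum I fun t _ => h.memLp t
  have hI0 : ∀ I : Finset ℤ, ∫ x, ∑ t ∈ I, U t x ∂Q = 0 := fun I => by
    rw [integral_finsetSum _ fun t _ => (h2.memLp t).integrable (by norm_num)]
    simp [h0]
  have hI2 : ∀ I : Finset ℤ, ∫ x, (∑ t ∈ I, U t x) ^ 2 ∂Q ≤ I.card * (4 * K ^ 2 * B) := fun I => by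
    have := h2.integral_sum_sq_le hσ hb hbs I
    simpa [h0] using this
  induction r generalizing a with
  | zero =>
    have e : Finset.Ioc a (a + 2 ^ 0) = {a + 1} := by
      ext x; simp only [Finset.mem_Ioc, Finset.mem_singleton]; omega
    have := integral_pow_le_of_eLpNorm_le (n := 4) (by norm_num) (h.meas (a + 1))
      (by exact_mod_cast h.bound (a + 1))
    rw [e]
    simp only [Finset.sum_singleton, pow_zero, mul_one]
    simp only [Even.pow_abs (by decide : Even 4)] at this
    refine this.trans ?_
    have : 0 ≤ 144 * (K : ℝ) ^ 4 * B ^ 2 + 512 * K ^ 4 * B ^ 4 := by positivity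
    linarith
  | succ r ih =>
    set n : ℤ := 2 ^ r with hn
    have hn0 : 0 < n := by positivity
    have hcard : ∀ a : ℤ, (((Finset.Ioc a (a + n)).card : ℕ) : ℝ) = 2 ^ r := by
      intro a
      rw [Int.card_Ioc, add_sub_cancel_left, hn, Int.toNat_pow_of_nonneg (by norm_num)]
      simp
    set F : S → ℝ := fun x => ∑ t ∈ Finset.Ioc a (a + n), U t x with hF
    set G : S → ℝ := fun x => ∑ t ∈ Finset.Ioc (a + n) (a + n + n), U t x with hG
    set c := a + n with hc
    have hFm : Measurable F := hI _
    have hGm : Measurable G := hI _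
    have hpast : ∀ x, F (σ c x).2 = F x.1 := fun x =>
      Finset.sum_congr rfl fun t ht => h.causal c t (Finset.mem_Ioc.1 ht).2 x
    have hF4 : MemLp F 4 Q := hI4 _
    have hG4 : MemLp G 4 Q := hI4 _
    -- The second half block is replaced by its decoupled version, for which the odd cross terms
    -- vanish and only the product of the variances remains.
    have e1 := integral_add_swap_pow_four hσ hFm hGm hpast hF4 hG4 (hI0 _) (hI0 _)
    have hF2 : ∫ x, F x ^ 2 ∂Q ≤ 2 ^ r * (4 * K ^ 2 * B) := by
      have := hI2 (Finset.Ioc a (a + n)); rwa [hcard] at this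
    have hG2 : ∫ x, G x ^ 2 ∂Q ≤ 2 ^ r * (4 * K ^ 2 * B) := by
      have := hI2 (Finset.Ioc c (c + n)); rwa [hcard] at this
    have hprod : (∫ x, F x ^ 2 ∂Q) * ∫ x, G x ^ 2 ∂Q ≤ 16 * K ^ 4 * B ^ 2 * 4 ^ r := by
      calc _ ≤ (2 ^ r * (4 * K ^ 2 * B)) * (2 ^ r * (4 * K ^ 2 * B)) :=
            mul_le_mul hF2 hG2 (integral_nonneg fun x => by positivity) (by positivity)
        _ = 16 * K ^ 4 * B ^ 2 * ((2 : ℝ) ^ r * 2 ^ r) := by ring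
        _ = _ := by rw [← mul_pow]; norm_num
    have hmp := measurePreserving_fst.comp (hσ c)
    have hFx : MemLp (fun x : S × S => F x.1) 4 (Q.prod Q) :=
      hF4.comp_measurePreserving measurePreserving_fst
    have hGx : MemLp (fun x : S × S => G x.1) 4 (Q.prod Q) :=
      hG4.comp_measurePreserving measurePreserving_fst
    have hGs : MemLp (fun x : S × S => G (σ c x).1) 4 (Q.prod Q) := hG4.comp_measurePreserving hmp
    -- The coupling errors are summable in the distance to `c`, so the price of decoupling does not
    -- grow with the block.
    have hRle : eLpNorm (fun x : S × S => G x.1 - G (σ c x).1) 4 (Q.prod Q) ≤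
        (K * ∑' n, b n : ℝ≥0) := by
      have hbs' : Summable b := NNReal.summable_coe.1 hbs
      have : (fun x : S × S => G x.1 - G (σ c x).1) =
          ∑ t ∈ Finset.Ioc c (c + n), fun x : S × S => U t x.1 - U t (σ c x).1 := by
        funext x; simp [hG, Finset.sum_apply]
      rw [this]
      refine (eLpNorm_sum_le (fun t _ => ?_) (by norm_num)).trans ?_
      · have := h.meas t
        have := hσm c
        exact Measurable.aestronglyMeasurable (by fun_prop)
      · calc _ ≤ ∑ t ∈ Finset.Ioc c (c + n), ((K * b (t - c).toNat : ℝ≥0) : ℝ≥0∞) :=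
              Finset.sum_le_sum fun t ht => h.couple c t (Finset.mem_Ioc.1 ht).1
          _ = ((K * ∑ t ∈ Finset.Ioc c (c + n), b (t - c).toNat : ℝ≥0) : ℝ≥0∞) := by
              rw [Finset.mul_sum]; push_cast; rfl
          _ ≤ _ := by
              gcongr
              have hinj : Set.InjOn (fun t : ℤ => (t - c).toNat) (Finset.Ioc c (c + n)) := by
                intro x hx y hy hxy
                simp only [Finset.coe_Ioc, Set.mem_Ioc] at hx hy hxy
                omega
              rw [← Finset.sum_image (f := b) hinj]
              exact hbs'.sum_le_tsum _ fun _ _ => zero_le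
    have hR4 := integral_pow_le_of_eLpNorm_le (n := 4) (by norm_num)
      (f := fun x : S × S => G x.1 - G (σ c x).1)
      (by have := hσm c; fun_prop) (by exact_mod_cast hRle)
    simp only [Even.pow_abs (by decide : Even 4)] at hR4
    -- The constant `C` is chosen so that the recursion closes: `3/2 · 2C` from the halves, `144 =
    -- 3/2 · 6 · 16` from the variances and `512 K⁴B⁴` from decoupling add up to at most `4C`.
    have hfin := integral_add_pow_four_le (hFx.add hGs) (hGx.sub hGs)
    simp only [Pi.add_apply, Pi.sub_apply] at hfin
    have hsplit : ∫ x, (∑ t ∈ Finset.Ioc a (a + 2 ^ (r + 1)), U t x) ^ 4 ∂Q =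
        ∫ x : S × S, (F x.1 + G (σ c x).1 + (G x.1 - G (σ c x).1)) ^ 4 ∂(Q.prod Q) := by
      have : a + 2 ^ (r + 1) = a + n + n := by rw [hn, pow_succ]; ring
      rw [this, ← integral_comp_measurePreserving (m := Q.prod Q) (T := Prod.fst)
        (f := fun x => (∑ t ∈ Finset.Ioc a (a + n + n), U t x) ^ 4)
        measurePreserving_fst ((hI _).pow_const 4)]
      congr 1
      funext x
      rw [sum_Ioc_split (fun t => U t x.1) (c := a + n) (by omega) (by omega)]
      simp only [hF, hG]
      ring
    rw [hsplit]
    refine hfin.trans ?_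
    rw [e1]
    have ihF := ih a
    have ihG := ih c
    have hKB : ((K * ∑' n, b n : ℝ≥0) : ℝ) = K * B := by
      rw [NNReal.coe_mul, NNReal.coe_tsum]
    rw [hKB] at hR4
    have h4r : (1 : ℝ) ≤ 4 ^ r := one_le_pow₀ (by norm_num)
    have hKB4 : 0 ≤ (K : ℝ) ^ 4 * B ^ 4 := by positivity
    have hK4 : 0 ≤ (K : ℝ) ^ 4 * 4 ^ r := by positivity
    have hmul : (K : ℝ) ^ 4 * B ^ 4 ≤ (K : ℝ) ^ 4 * B ^ 4 * 4 ^ r := le_mul_of_one_le_right hKB4 h4r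
    rw [mul_pow] at hR4
    rw [pow_succ (4 : ℝ) r]
    change ∫ x, F x ^ 4 ∂Q ≤ _ at ihF
    change ∫ x, G x ^ 4 ∂Q ≤ _ at ihG
    linarith

end Temporal

/-! ### Products at a fixed lag -/

section Lagged
variable {S : Type*} [MeasurableSpace S]
variable {Q : Measure S} [IsProbabilityMeasure Q] {σ : ℤ → S × S → S × S} {b : ℕ → ℝ≥0}
  {K : ℝ≥0} {U : ℤ → S → ℝ}

lemma Stable.eLpNorm_mul_le_two (h : Stable Q σ b 4 K U) (s t : ℤ) :
    eLpNorm (fun x => U s x * U t x) 2 Q ≤ (K * K : ℝ≥0) :=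
  eLpNorm_mul_le (h.meas s) (h.meas t) (h.bound s) (h.bound t)

/-- The split depends on the order of the inner times `t + s` and `t'`. If the pairs are disjoint,
decoupling between them suffices. If they interlace, the early and the late pair are decoupled
instead; the remaining products of means are themselves small because `U` is centred and the lags
involved are at least `t' - t`. The bound, summed over `t'`, is uniform in `s`. -/
lemma Stable.abs_cov_lagged_le_of_le
    (hσ : ∀ c, MeasurePreserving (σ c) (Q.prod Q) (Q.prod Q)) (hb : 1 ≤ b 0) (hanti : Antitone b)
    (h : Stable Q σ b 4 K U) (h0 : ∀ t, ∫ x, U t x ∂Q = 0) (s : ℕ) {t t' : ℤ} (htt : t ≤ t') :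
    |cov[fun x => U t x * U (t + s) x, fun x => U t' x * U (t' + s) x; Q]| ≤
      8 * K ^ 4 * b 0 * (b (t' - t - s).natAbs + b (t' - t).natAbs) := by
  have h2 : Stable Q σ b 2 K U := h.mono_exponent (fun c => (hσ c).measurable) (by norm_num)
  have hm : ∀ s t, Measurable fun x => U s x * U t x := fun s t => (h.meas s).mul (h.meas t)
  have hL : ∀ s t, MemLp (fun x => U s x * U t x) 2 Q := fun s t =>
    memLp_of_eLpNorm_le (hm s t) (h.eLpNorm_mul_le_two s t)
  have hb1 : (1 : ℝ) ≤ b 0 := by exact_mod_cast hb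
  have hK : (0 : ℝ) ≤ (K : ℝ) ^ 4 := by positivity
  have hprod : ∀ s t, |∫ x, U s x * U t x ∂Q| ≤ 2 * (K * K) * b (t - s).natAbs := by
    intro s t
    have := h2.abs_cov_self_le hσ hb s t
    rwa [covariance_eq_sub (h2.memLp s) (h2.memLp t), h0, zero_mul, sub_zero] at this
  rw [covariance_eq_sub (hL _ _) (hL _ _)]
  have hnn : ∀ n, (0 : ℝ) ≤ b n := fun n => (b n).2
  rcases lt_trichotomy t' (t + s) with hlt | heq | hgt
  · -- the four times interlace: regroup them as two early and two late ones
    have e1 := abs_cov_le_of_couple hσ (c := t') (hm t t') (hm (t + s) (t' + s))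
      (fun x => by rw [h.causal t' t htt, h.causal t' t' le_rfl])
      (h.eLpNorm_mul_le_two t t') (hL _ _)
      (h.couple_mul (r := 2) (by norm_num) hσ h (c := t') hlt (by omega))
    have e2 : ∫ x, (U t x * U t' x) * (U (t + s) x * U (t' + s) x) ∂Q =
        ∫ x, (U t x * U (t + s) x) * (U t' x * U (t' + s) x) ∂Q := by
      congr 1; funext x; ring
    rw [e2] at e1
    push_cast at e1
    have m1 : (b (t' + s - t').toNat : ℝ) ≤ b (t' - t - s).natAbs := by
      exact_mod_cast hanti (by omega)
    have m2 : (b (t + s - t').toNat : ℝ) ≤ b (t' - t - s).natAbs := by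
      exact_mod_cast hanti (by omega)
    have m3 : (b (t' - t).natAbs : ℝ) ≤ b 0 := by exact_mod_cast hanti (Nat.zero_le _)
    have m4 : (b (t + s - t).natAbs : ℝ) ≤ b (t' - t).natAbs := by exact_mod_cast hanti (by omega)
    have m5 : (b (t' + s - t').natAbs : ℝ) ≤ b (t' - t).natAbs := by exact_mod_cast hanti (by omega)
    have m6 : (b (t' + s - (t + s)).natAbs : ℝ) ≤ b (t' - t).natAbs := by
      exact_mod_cast hanti (by omega)
    have sq : ∀ {u w a c : ℝ}, |u| ≤ 2 * (K * K) * a → |w| ≤ 2 * (K * K) * c →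
        a ≤ b (t' - t).natAbs → c ≤ b (t' - t).natAbs → 0 ≤ a → 0 ≤ c →
        |u * w| ≤ 4 * K ^ 4 * (b 0 * b (t' - t).natAbs) := by
      intro u w a c hu hw ha hc ha0 hc0
      rw [abs_mul]
      calc |u| * |w| ≤ (2 * (K * K) * a) * (2 * (K * K) * c) := by gcongr
        _ = 4 * K ^ 4 * (a * c) := by ring
        _ ≤ _ := by gcongr; exact ha.trans m3
    have f1 := sq (hprod t t') (hprod (t + s) (t' + s)) le_rfl m6 (hnn _) (hnn _)
    have f2 := sq (hprod t (t + s)) (hprod t' (t' + s)) m4 m5 (hnn _) (hnn _)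
    have e1' : |(∫ x, (U t x * U (t + s) x) * (U t' x * U (t' + s) x) ∂Q) -
        (∫ x, U t x * U t' x ∂Q) * ∫ x, U (t + s) x * U (t' + s) x ∂Q| ≤
        2 * K ^ 4 * (b 0 * b (t' - t - s).natAbs) := by
      refine e1.trans ?_
      calc _ ≤ (K * K : ℝ) * (K * K * (b (t' - t - s).natAbs + b (t' - t - s).natAbs)) := by gcongr
        _ = 2 * K ^ 4 * (1 * b (t' - t - s).natAbs) := by ring
        _ ≤ _ := by gcongr
    have tri : ∀ x y z : ℝ, |x - z| ≤ |x - y| + |y| + |z| := fun x y z => by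
      have := abs_add_le (x - y + y) (-z)
      have := abs_add_le (x - y) y
      rw [abs_neg] at *
      have e : x - z = x - y + y + -z := by ring
      rw [e]; linarith
    refine (tri _ ((∫ x, U t x * U t' x ∂Q) * ∫ x, U (t + s) x * U (t' + s) x ∂Q) _).trans ?_
    have g1 : 0 ≤ (K : ℝ) ^ 4 * (b 0 * b (t' - t - s).natAbs) := by positivity
    change |(∫ x, (U t x * U (t + s) x) * (U t' x * U (t' + s) x) ∂Q) - _| + _ + _ ≤ _
    linarith
  -- The inner times coincide, so no decay is claimed and moment bounds suffice.
  · have e1 := abs_integral_mul_le (hm t (t + s)) (hm t' (t' + s)) (h.eLpNorm_mul_le_two t (t + s))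
      (h.eLpNorm_mul_le_two t' (t' + s))
    have one : ∀ s t, |∫ x, U s x * U t x ∂Q| ≤ K * K := fun s t =>
      abs_integral_mul_le (h.meas s) (h.meas t) (h2.bound s) (h2.bound t)
    have e2 : |(∫ x, U t x * U (t + s) x ∂Q) * ∫ x, U t' x * U (t' + s) x ∂Q| ≤
        (K * K) * (K * K) := by
      rw [abs_mul]
      exact mul_le_mul (one _ _) (one _ _) (abs_nonneg _) (by positivity)
    have e3 : (t' - t - s).natAbs = 0 := by omega
    rw [e3]
    refine (abs_sub _ _).trans ?_
    push_cast at e1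
    change |∫ x, (U t x * U (t + s) x) * (U t' x * U (t' + s) x) ∂Q| + _ ≤ _
    have g1 : (K : ℝ) ^ 4 * 1 ≤ K ^ 4 * (b 0 * b 0) := by gcongr; nlinarith
    have g2 : 0 ≤ (K : ℝ) ^ 4 * (b 0 * b (t' - t).natAbs) := by positivity
    nlinarith
  · have e1 := abs_cov_le_of_couple hσ (c := t + s) (hm t (t + s)) (hm t' (t' + s))
      (fun x => by rw [h.causal (t + s) t (by omega), h.causal (t + s) (t + s) le_rfl])
      (h.eLpNorm_mul_le_two _ _) (hL _ _)
      (h.couple_mul (r := 2) (by norm_num) hσ h (c := t + s) hgt (by omega))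
    push_cast at e1
    have m1 : (b (t' + s - (t + s)).toNat : ℝ) ≤ b (t' - t - s).natAbs := by
      exact_mod_cast hanti (by omega)
    have m2 : (b (t' - (t + s)).toNat : ℝ) ≤ b (t' - t - s).natAbs := by
      exact_mod_cast hanti (by omega)
    refine e1.trans ?_
    calc _ ≤ (K * K : ℝ) * (K * K * (b (t' - t - s).natAbs + b (t' - t - s).natAbs)) := by gcongr
      _ = 2 * K ^ 4 * (1 * b (t' - t - s).natAbs) := by ring
      _ ≤ 2 * K ^ 4 * (b 0 * b (t' - t - s).natAbs) := by gcongr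
      _ ≤ _ := by
        have g1 : 0 ≤ (K : ℝ) ^ 4 * (b 0 * b (t' - t - s).natAbs) := by positivity
        have g2 : 0 ≤ (K : ℝ) ^ 4 * (b 0 * b (t' - t).natAbs) := by positivity
        nlinarith

/-- The variance of a sum of `n` lagged products is `O(n)`, uniformly in the lag. -/
lemma Stable.integral_lagged_sum_sq_le
    (hσ : ∀ c, MeasurePreserving (σ c) (Q.prod Q) (Q.prod Q)) (hb : 1 ≤ b 0) (hanti : Antitone b)
    (hbs : Summable fun n => (b n : ℝ))
    (h : Stable Q σ b 4 K U) (h0 : ∀ t, ∫ x, U t x ∂Q = 0) (s : ℕ) (I : Finset ℤ) :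
    ∫ x, (∑ t ∈ I, (U t x * U (t + s) x - ∫ y, U t y * U (t + s) y ∂Q)) ^ 2 ∂Q ≤
      I.card * (48 * K ^ 4 * b 0 * ∑' n, (b n : ℝ)) := by
  have hL : ∀ s t, MemLp (fun x => U s x * U t x) 2 Q := fun s t =>
    memLp_of_eLpNorm_le ((h.meas s).mul (h.meas t)) (h.eLpNorm_mul_le_two s t)
  have hnn : ∀ n, (0 : ℝ) ≤ b n := fun n => (b n).2
  refine PanelEigen.integral_sum_sq_le I
    (U := fun t x => U t x * U (t + s) x - ∫ y, U t y * U (t + s) y ∂Q)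
    (fun t => (hL t (t + s)).sub (memLp_const _)) fun t _ => ?_
  -- Symmetrised in `t` and `t'`, the decay is around the three centres `t + s`, `t - s` and `t`.
  -- Each contributes `2 ∑ b`, so `8 · 3 · 2 = 48`.
  have key : ∀ t' : ℤ, |∫ x, (U t x * U (t + s) x - ∫ y, U t y * U (t + s) y ∂Q) *
      (U t' x * U (t' + s) x - ∫ y, U t' y * U (t' + s) y ∂Q) ∂Q| ≤
      8 * K ^ 4 * b 0 * (b (t' - (t + s)).natAbs + b (t' - (t - s)).natAbs + b (t' - t).natAbs) := by
    intro t'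
    have g : (0 : ℝ) ≤ 8 * K ^ 4 * b 0 := by positivity
    rcases le_total t t' with htt | htt
    · refine (h.abs_cov_lagged_le_of_le hσ hb hanti h0 s htt).trans ?_
      have e1 : t' - t - s = t' - (t + s) := by ring
      rw [e1]
      gcongr
      linarith [hnn (t' - (t - s)).natAbs]
    · have := h.abs_cov_lagged_le_of_le hσ hb hanti h0 s htt
      rw [covariance_comm] at this
      refine this.trans ?_
      have e1 : (t - t' - s).natAbs = (t' - (t - s)).natAbs := by omega
      have e2 : (t - t').natAbs = (t' - t).natAbs := by omega
      rw [e1, e2]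
      gcongr
      linarith [hnn (t' - (t + s)).natAbs]
  have sm : ∀ u : ℤ, ∑ t' ∈ I, (b (t' - u).natAbs : ℝ) ≤ 2 * ∑' n, (b n : ℝ) := fun u =>
    sum_natAbs_le (β := fun n => (b n : ℝ)) hnn hbs I u
  refine (Finset.sum_le_sum fun t' _ => key t').trans ?_
  rw [← Finset.mul_sum, Finset.sum_add_distrib, Finset.sum_add_distrib]
  have g : (0 : ℝ) ≤ 8 * K ^ 4 * b 0 := by positivity
  have := mul_le_mul_of_nonneg_left (add_le_add (add_le_add (sm (t + s)) (sm (t - s))) (sm t)) g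
  linarith

end Lagged

/-! ### Nonnegativity of long-run variances -/

section LongRun
variable {X : Type*} [MeasurableSpace X] {m : Measure X} [IsProbabilityMeasure m]

lemma summable_int_of_natAbs {β : ℕ → ℝ} (hβ : Summable β) : Summable fun t : ℤ => β t.natAbs := by
  refine Summable.of_nat_of_neg ?_ ?_ <;> simpa using hβ

/-- The long-run variance of a stationary sequence with summable covariances is nonnegative. -/
lemma longRunVar_nonneg {U : ℤ → X → ℝ} (hU : ∀ t, MemLp (U t) 2 m)
    (hstat : ∀ s t, cov[U s, U t; m] = cov[U 0, U (t - s); m])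
    (hsum : Summable fun t : ℤ => cov[U 0, U t; m]) : 0 ≤ longRunVar m U := by
  set c : ℤ → ℝ := fun t => cov[U 0, U t; m] with hc
  -- normalised variances of partial sums, as triangular sums of the autocovariances
  have hvar : ∀ n : ℕ, 0 < n → 0 ≤ ∑' t : ℤ, (max 0 (1 - |(t : ℝ)| / n)) * c t := by
    intro n hn
    have h1 : 0 ≤ cov[fun x => ∑ t ∈ Finset.Ico (0 : ℤ) n, U t x,
        fun x => ∑ t ∈ Finset.Ico (0 : ℤ) n, U t x; m] := by
      rw [covariance_self]
      · exact variance_nonneg _ _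
      · exact (memLp_finsetSum _ fun t _ => hU t).aestronglyMeasurable.aemeasurable
    rw [covariance_fun_sum_fun_sum' (fun t _ => hU t) (fun t _ => hU t)] at h1
    -- Pairs are grouped by their difference `d`, which occurs `n - |d|` times.
    have h2 : ∑ s ∈ Finset.Ico (0 : ℤ) n, ∑ t ∈ Finset.Ico (0 : ℤ) n, cov[U s, U t; m] =
        ∑ d ∈ Finset.Ioo (-(n : ℤ)) n, ((n : ℝ) - |(d : ℝ)|) * c d := by
      rw [← Finset.sum_product']
      rw [← Finset.sum_fiberwise_of_maps_to (t := Finset.Ioo (-(n : ℤ)) n)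
        (g := fun p : ℤ × ℤ => p.2 - p.1)]
      · refine Finset.sum_congr rfl fun d hd => ?_
        rw [Finset.sum_congr rfl (g := fun _ => c d)]
        · rw [Finset.sum_const, nsmul_eq_mul]
          congr 1
          have : (Finset.filter (fun p : ℤ × ℤ => p.2 - p.1 = d)
              (Finset.Ico (0 : ℤ) n ×ˢ Finset.Ico (0 : ℤ) n)) =
              (Finset.Ico (max 0 (-d)) (min (n : ℤ) (n - d))).map
                ⟨fun s => (s, s + d), fun a b hab => (Prod.mk.inj hab).1⟩ := by
            ext ⟨s, t⟩
            simp only [Finset.mem_filter, Finset.mem_product, Finset.mem_Ico, Finset.mem_map]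
            constructor
            · rintro ⟨⟨⟨h1, h2⟩, h3, h4⟩, h5⟩
              exact ⟨s, ⟨by omega, by omega⟩, Prod.ext rfl (show s + d = t by omega)⟩
            · rintro ⟨a, ⟨h1, h2⟩, h3⟩
              obtain ⟨h4, h5⟩ := Prod.mk.inj (show (a, a + d) = (s, t) from h3)
              omega
          rw [this, Finset.card_map, Int.card_Ico]
          rw [Finset.mem_Ioo] at hd
          have e : ((min (n : ℤ) (n - d) - max 0 (-d)).toNat : ℤ) = n - |d| := by
            rcases abs_cases d with ⟨h, _⟩ | ⟨h, _⟩ <;> rw [h] <;> omega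
          exact_mod_cast congrArg (Int.cast : ℤ → ℝ) e
        · intro p hp
          rw [Finset.mem_filter] at hp
          rw [hstat, hp.2]
      · intro p hp
        simp only [Finset.mem_product, Finset.mem_Ico, Finset.mem_Ioo] at hp ⊢
        omega
    rw [h2] at h1
    rw [tsum_eq_sum (s := Finset.Ioo (-(n : ℤ)) n)]
    · have hn' : (0 : ℝ) < n := by exact_mod_cast hn
      have e : ∑ d ∈ Finset.Ioo (-(n : ℤ)) n, max 0 (1 - |(d : ℝ)| / n) * c d =
          (n : ℝ)⁻¹ * ∑ d ∈ Finset.Ioo (-(n : ℤ)) n, ((n : ℝ) - |(d : ℝ)|) * c d := by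
        rw [Finset.mul_sum]
        refine Finset.sum_congr rfl fun d hd => ?_
        rw [Finset.mem_Ioo] at hd
        have hd' : |(d : ℝ)| ≤ n := by
          rw [abs_le]
          exact ⟨by exact_mod_cast hd.1.le, by exact_mod_cast hd.2.le⟩
        rw [max_eq_right]
        · field_simp
        · rw [sub_nonneg, div_le_one hn']; exact hd'
      rw [e]
      positivity
    · intro d hd
      have hn' : (0 : ℝ) < n := by exact_mod_cast hn
      rw [Finset.mem_Ioo, not_and_or, not_lt, not_lt] at hd
      have hd' : (n : ℝ) ≤ |(d : ℝ)| := by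
        have : (n : ℤ) ≤ |d| := by
          rcases abs_cases d with ⟨h, _⟩ | ⟨h, _⟩ <;> omega
        exact_mod_cast this
      rw [max_eq_left, zero_mul]
      rw [sub_nonpos, one_le_div hn']
      exact hd'
  -- The triangular weights are at most one and tend to one; the summable covariances dominate.
  have hlim : Tendsto (fun n : ℕ => ∑' t : ℤ, (max 0 (1 - |(t : ℝ)| / n)) * c t) atTop
      (𝓝 (∑' t : ℤ, c t)) := by
    refine tendsto_tsum_of_dominated_convergence hsum.abs (fun t => ?_) ?_
    · have : Tendsto (fun n : ℕ => max 0 (1 - |(t : ℝ)| / (n : ℝ))) atTop (𝓝 (max 0 (1 - 0))) :=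
        tendsto_const_nhds.max (tendsto_const_nhds.sub
          (tendsto_const_nhds.div_atTop tendsto_natCast_atTop_atTop))
      simpa using this.mul_const (c t)
    · refine Eventually.of_forall fun n t => ?_
      rw [norm_mul, Real.norm_eq_abs, Real.norm_eq_abs]
      refine mul_le_of_le_one_left (abs_nonneg _) ?_
      rw [abs_of_nonneg (le_max_left _ _)]
      exact max_le zero_le_one (sub_le_self _ (by positivity))
  exact ge_of_tendsto hlim (eventually_atTop.2 ⟨1, fun n hn => hvar n hn⟩)

end LongRun

/-! ### Dyadic maximal inequality for partial sums -/

section Maximal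
variable {X : Type*} [MeasurableSpace X] {m : Measure X}

/-- A random variable dominating the fourth powers of all partial sums in a dyadic block. -/
lemma exists_dominating_block {f : ℤ → X → ℝ} {C : ℝ}
    (hint : ∀ (r : ℕ) (a : ℤ), Integrable (fun x => (∑ t ∈ Finset.Ioc a (a + 2 ^ r), f t x) ^ 4) m)
    (hC : ∀ (r : ℕ) (a : ℤ), ∫ x, (∑ t ∈ Finset.Ioc a (a + 2 ^ r), f t x) ^ 4 ∂m ≤ C * 4 ^ r)
    (r : ℕ) (a : ℤ) : ∃ V : X → ℝ, (∀ x, 0 ≤ V x) ∧ Integrable V m ∧ ∫ x, V x ∂m ≤ 512 * C * 4 ^ r ∧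
      ∀ x, ∀ k : ℕ, k ≤ 2 ^ r → (∑ t ∈ Finset.Ioc a (a + k), f t x) ^ 4 ≤ V x := by
  induction r generalizing a with
  | zero =>
    refine ⟨fun x => 512 * (∑ t ∈ Finset.Ioc a (a + 2 ^ 0), f t x) ^ 4, fun x => by positivity,
      (hint 0 a).const_mul _, ?_, ?_⟩
    · rw [integral_const_mul]
      have := hC 0 a
      linarith
    · intro x k hk
      have h0 : 0 ≤ (∑ t ∈ Finset.Ioc a (a + 2 ^ 0), f t x) ^ 4 := by positivity
      rcases Nat.le_one_iff_eq_zero_or_eq_one.1 (by simpa using hk) with rfl | rfl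
      · simpa using h0
      · have e : ∑ t ∈ Finset.Ioc a (a + (1 : ℕ)), f t x = ∑ t ∈ Finset.Ioc a (a + 2 ^ 0), f t x := by
          simp
        rw [e]
        linarith
  | succ r ih =>
    obtain ⟨V₁, p₁, i₁, b₁, d₁⟩ := ih a
    obtain ⟨V₂, p₂, i₂, b₂, d₂⟩ := ih (a + 2 ^ r)
    have hS := hC r a
    -- A partial sum either ends in the first half or is the full first half plus a partial sum of
    -- the second. In mean, `3/2 · 2 · 512C + 512C = 4 · 512C`: the recursion closes without a
    -- logarithmic factor.
    refine ⟨fun x => 3 / 2 * (V₁ x + V₂ x) + 512 * (∑ t ∈ Finset.Ioc a (a + 2 ^ r), f t x) ^ 4,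
      fun x => ?_, ((i₁.add i₂).const_mul _).add ((hint r a).const_mul _), ?_, ?_⟩
    · have := p₁ x; have := p₂ x; positivity
    · have e := integral_add ((i₁.add i₂).const_mul (3 / 2)) ((hint r a).const_mul 512)
      simp only [Pi.add_apply] at e
      rw [e, integral_const_mul, integral_const_mul, integral_add i₁ i₂, pow_succ (4 : ℝ) r]
      linarith
    · intro x k hk
      have q₁ := p₁ x
      have q₂ := p₂ x
      have q₃ : 0 ≤ (∑ t ∈ Finset.Ioc a (a + 2 ^ r), f t x) ^ 4 := by positivity
      rcases le_total k (2 ^ r) with h | h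
      · have := d₁ x k h
        linarith
      · have hk' : k - 2 ^ r ≤ 2 ^ r := by rw [pow_succ] at hk; omega
        have e : ∑ t ∈ Finset.Ioc a (a + k), f t x =
            ∑ t ∈ Finset.Ioc (a + 2 ^ r) (a + 2 ^ r + (k - 2 ^ r : ℕ)), f t x +
              ∑ t ∈ Finset.Ioc a (a + 2 ^ r), f t x := by
          have h' : (2 : ℤ) ^ r ≤ k := by exact_mod_cast h
          have h'' : (0 : ℤ) ≤ 2 ^ r := by positivity
          rw [sum_Ioc_split (fun t => f t x) (a := a) (c := a + 2 ^ r) (d := a + k)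
            (by omega) (by omega), add_comm]
          congr 3
          push_cast [h]
          ring
        rw [e]
        have := add_pow_four_le
          (∑ t ∈ Finset.Ioc (a + 2 ^ r) (a + 2 ^ r + (k - 2 ^ r : ℕ)), f t x)
          (∑ t ∈ Finset.Ioc a (a + 2 ^ r), f t x)
        have := d₂ x _ hk'
        linarith

/-- Partial sums satisfy `max_{ℓ ≤ T} |S_ℓ|⁴ / ℓ = O(T)` in mean. -/
lemma exists_dominating_sums {f : ℤ → X → ℝ} {C : ℝ}
    (hint : ∀ (r : ℕ) (a : ℤ), Integrable (fun x => (∑ t ∈ Finset.Ioc a (a + 2 ^ r), f t x) ^ 4) m)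
    (hC : ∀ (r : ℕ) (a : ℤ), ∫ x, (∑ t ∈ Finset.Ioc a (a + 2 ^ r), f t x) ^ 4 ∂m ≤ C * 4 ^ r)
    (hC0 : 0 ≤ C) (T : ℕ) (hT : 0 < T) :
    ∃ V : X → ℝ, (∀ x, 0 ≤ V x) ∧ Integrable V m ∧ ∫ x, V x ∂m ≤ 4096 * C ∧
      ∀ x, ∀ k : ℕ, 1 ≤ k → k ≤ T → (∑ t ∈ Finset.Ioc (0 : ℤ) k, f t x) ^ 4 ≤ k * T * V x := by
  choose V p i b d using fun r => exists_dominating_block hint hC r 0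
  -- Rounding `k` up to a power of two at most doubles it.
  have hclog : ∀ k : ℕ, 1 ≤ k → 2 ^ Nat.clog 2 k ≤ 2 * k := by
    intro k hk
    rcases hk.eq_or_lt with rfl | hk
    · simp
    · have h1 := Nat.pow_pred_clog_lt_self (b := 2) (by norm_num) hk
      have h2 : 0 < Nat.clog 2 k := Nat.clog_pos (by norm_num) hk
      obtain ⟨j, hj⟩ := Nat.exists_eq_succ_of_ne_zero h2.ne'
      rw [hj] at h1 ⊢
      simp only [Nat.pred_succ] at h1
      rw [Nat.pow_succ]
      omega
  set R := Nat.clog 2 T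
  have hT' : (0 : ℝ) < T := by exact_mod_cast hT
  -- Scale `r` has mean of order `4^r` and is divided by `2^r`; the resulting geometric sum is of
  -- order `T`, which the prefactor cancels. Summing over the scales makes one variable serve all
  -- `k`.
  refine ⟨fun x => (T : ℝ)⁻¹ * ∑ r ∈ Finset.range (R + 1), 2 * V r x / 2 ^ r, fun x => ?_, ?_, ?_, ?_⟩
  · have := fun r => p r x
    refine mul_nonneg (by positivity) (Finset.sum_nonneg fun r _ => ?_)
    have := p r x
    positivity
  · exact (integrable_finsetSum _ fun r _ => ((i r).const_mul 2).div_const _).const_mul _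
  · rw [integral_const_mul, integral_finsetSum _ fun r _ => ((i r).const_mul 2).div_const _]
    have h1 : ∀ r, ∫ x, 2 * V r x / 2 ^ r ∂m ≤ 1024 * C * 2 ^ r := by
      intro r
      rw [integral_div, integral_const_mul, div_le_iff₀ (by positivity)]
      have e : (4 : ℝ) ^ r = 2 ^ r * 2 ^ r := by rw [← mul_pow]; norm_num
      have := b r
      rw [e] at this
      linarith
    have h2 : ∑ r ∈ Finset.range (R + 1), ∫ x, 2 * V r x / 2 ^ r ∂m ≤ 1024 * C * (4 * T) := by
      refine (Finset.sum_le_sum fun r _ => h1 r).trans ?_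
      rw [← Finset.mul_sum]
      gcongr
      have h3 : ∑ r ∈ Finset.range (R + 1), (2 : ℝ) ^ r ≤ 2 ^ (R + 1) := by
        rw [geom_sum_eq (by norm_num)]
        norm_num
      have h4 : (2 : ℝ) ^ R ≤ 2 * T := by exact_mod_cast hclog T hT
      rw [pow_succ] at h3
      linarith
    rw [inv_mul_le_iff₀ hT']
    linarith
  · intro x k hk hkT
    have h1 := d (Nat.clog 2 k) x k (Nat.le_pow_clog (by norm_num) k)
    rw [zero_add] at h1
    refine h1.trans ?_
    have h2 : (2 : ℝ) ^ Nat.clog 2 k ≤ 2 * k := by exact_mod_cast hclog k hk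
    have h3 : 2 * V (Nat.clog 2 k) x / 2 ^ Nat.clog 2 k ≤
        ∑ r ∈ Finset.range (R + 1), 2 * V r x / 2 ^ r := by
      refine Finset.single_le_sum (f := fun r => 2 * V r x / 2 ^ r) (fun r _ => ?_) ?_
      · have := p r x
        positivity
      · exact Finset.mem_range.2 (Nat.lt_succ_of_le (Nat.clog_mono_right 2 hkT))
    have h4 : V (Nat.clog 2 k) x ≤ k * (2 * V (Nat.clog 2 k) x / 2 ^ Nat.clog 2 k) := by
      have h5 : (0 : ℝ) < 2 ^ Nat.clog 2 k := by positivity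
      have := p (Nat.clog 2 k) x
      rw [mul_div_assoc', le_div_iff₀ h5]
      nlinarith
    calc V (Nat.clog 2 k) x ≤ k * (2 * V (Nat.clog 2 k) x / 2 ^ Nat.clog 2 k) := h4
      _ ≤ k * ∑ r ∈ Finset.range (R + 1), 2 * V r x / 2 ^ r := by gcongr
      _ = _ := by field_simp

lemma sum_Ioc_reflect (f : ℤ → ℝ) (T a b : ℤ) :
    ∑ t ∈ Finset.Ioc a b, f (T + 1 - t) = ∑ t ∈ Finset.Ioc (T - b) (T - a), f t := by
  refine Finset.sum_nbij' (fun t => T + 1 - t) (fun t => T + 1 - t) ?_ ?_ ?_ ?_ ?_ <;>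
    simp only [Finset.mem_Ioc] <;> intros <;> first | omega | trivial

/-- The corresponding bound for the sums over final stretches of the sample. -/
lemma exists_dominating_tail_sums {f : ℤ → X → ℝ} {C : ℝ}
    (hint : ∀ (r : ℕ) (a : ℤ), Integrable (fun x => (∑ t ∈ Finset.Ioc a (a + 2 ^ r), f t x) ^ 4) m)
    (hC : ∀ (r : ℕ) (a : ℤ), ∫ x, (∑ t ∈ Finset.Ioc a (a + 2 ^ r), f t x) ^ 4 ∂m ≤ C * 4 ^ r)
    (hC0 : 0 ≤ C) (T : ℕ) (hT : 0 < T) :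
    ∃ V : X → ℝ, (∀ x, 0 ≤ V x) ∧ Integrable V m ∧ ∫ x, V x ∂m ≤ 4096 * C ∧
      ∀ x, ∀ k : ℕ, 1 ≤ k → k ≤ T → (∑ t ∈ Finset.Ioc (T - k : ℤ) T, f t x) ^ 4 ≤ k * T * V x := by
  -- Time reversal `t ↦ T + 1 - t` sends blocks to blocks and initial stretches to final ones.
  have e : ∀ x (a : ℤ) (k : ℤ), ∑ t ∈ Finset.Ioc a (a + k), f (T + 1 - t) x =
      ∑ t ∈ Finset.Ioc ((T : ℤ) - (a + k)) (T - (a + k) + k), f t x := by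
    intro x a k
    rw [sum_Ioc_reflect (fun t => f t x)]
    congr 2
    ring
  obtain ⟨V, p, i, b, d⟩ := exists_dominating_sums (f := fun t => f (T + 1 - t)) (m := m) (C := C)
    (fun r a => by simp only [e]; exact hint r _) (fun r a => by simp only [e]; exact hC r _) hC0 T hT
  refine ⟨V, p, i, b, fun x k h1 h2 => ?_⟩
  have := d x k h1 h2
  rwa [sum_Ioc_reflect (fun t => f t x), sub_zero] at this

end Maximal

/-! ### Deterministic perturbation of sample autocovariances -/

section Deterministic

lemma sum_shift_le {f : ℤ → ℝ} (hf : ∀ t, 0 ≤ f t) {I J : Finset ℤ} {s : ℤ}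
    (hJ : ∀ t ∈ J, t + s ∈ I) : ∑ t ∈ J, f (t + s) ≤ ∑ t ∈ I, f t := by
  rw [← Finset.sum_image (f := f) (g := fun t => t + s) (fun a _ b _ hab => by simpa using hab)]
  refine Finset.sum_le_sum_of_subset_of_nonneg ?_ fun t _ _ => hf t
  intro t ht
  obtain ⟨a, ha, rfl⟩ := Finset.mem_image.1 ht
  exact hJ a ha

/-- Hölder: `(∑ a)⁴ ≤ l³ ∑ a⁴`. The condition `n⁴ l³ ≤ L T` allows a large segment mean `n` when the
segment is short, and still leaves a contribution of order `√T`. -/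
lemma mul_sum_le_sqrt {I : Finset ℤ} {a : ℤ → ℝ} (ha : ∀ t ∈ I, 0 ≤ a t) {n l L T : ℝ}
    (hL : 1 ≤ L) (hT : 0 ≤ T) (hI : (I.card : ℝ) ≤ l) (hnl : n ^ 4 * l ^ 3 ≤ L * T)
    (hsum : ∑ t ∈ I, a t ^ 4 ≤ 2 * L * T) : n * ∑ t ∈ I, a t ≤ 2 * L * √T := by
  have h0 : 0 ≤ ∑ t ∈ I, a t := Finset.sum_nonneg ha
  refine le_of_pow_le_pow_left₀ (n := 4) (by norm_num) (by positivity) ?_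
  have h1 : (∑ t ∈ I, a t) ^ 4 ≤ l ^ 3 * ∑ t ∈ I, a t ^ 4 := by
    rcases I.eq_empty_or_nonempty with rfl | hne
    · simp
    · have h2 := pow_sum_div_card_le_sum_pow (s := I) (f := a) (n := 3) ha
      have hc : (0 : ℝ) < I.card := by exact_mod_cast hne.card_pos
      rw [div_le_iff₀ (by positivity)] at h2
      refine h2.trans ?_
      rw [mul_comm]
      have : 0 ≤ ∑ t ∈ I, a t ^ 4 := Finset.sum_nonneg fun t _ => by positivity
      gcongr
  have hs : √T ^ 4 = T ^ 2 := by
    rw [show (4 : ℕ) = 2 * 2 by norm_num, pow_mul, Real.sq_sqrt hT]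
  calc (n * ∑ t ∈ I, a t) ^ 4 = n ^ 4 * (∑ t ∈ I, a t) ^ 4 := by ring
    _ ≤ n ^ 4 * (l ^ 3 * ∑ t ∈ I, a t ^ 4) := by gcongr
    _ = (n ^ 4 * l ^ 3) * ∑ t ∈ I, a t ^ 4 := by ring
    _ ≤ (L * T) * (2 * L * T) := by
      gcongr
    _ = 2 * L ^ 2 * T ^ 2 := by ring
    _ ≤ 16 * L ^ 4 * T ^ 2 := by
      have : L ^ 2 ≤ L ^ 4 := pow_le_pow_right₀ hL (by norm_num)
      have : 0 ≤ L ^ 2 := by positivity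
      gcongr ?_ * _
      linarith
    _ = (2 * L * √T) ^ 4 := by rw [mul_pow, hs]; ring

/-- This is where twelfth moments enter: the error at `t` times the weight at `t + s` is cubic in
the data, and Hölder raises it to the fourth power. -/
lemma mul_sq_pow_four_le {x y : ℝ} (hx : 0 ≤ x) (hy : 0 ≤ y) :
    (x * y ^ 2) ^ 4 ≤ x ^ 12 + y ^ 12 := by
  have h : (x * y ^ 2) ^ 4 = x ^ 4 * y ^ 8 := by ring
  rw [h]
  rcases le_total x y with hxy | hxy
  · have : x ^ 4 * y ^ 8 ≤ y ^ 4 * y ^ 8 := by gcongr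
    have : 0 ≤ x ^ 12 := by positivity
    nlinarith
  · have : x ^ 4 * y ^ 8 ≤ x ^ 4 * x ^ 8 := by gcongr
    have : 0 ≤ y ^ 12 := by positivity
    nlinarith

/-- Sums of the errors `D` against lagged weights: `w` dominates the data, `n` is the size of the
two segment means, `d` the error of the estimated direction. -/
lemma sum_abs_mul_lag_le {T k : ℕ} (hkT : k ≤ T) {N L d n₁ n₂ : ℝ} (hN : 1 ≤ N)
    (hL : 1 ≤ L) {w n D : ℤ → ℝ} (hw1 : ∀ t, 1 ≤ w t)
    (hw : ∑ t ∈ Finset.Ioc (0 : ℤ) T, w t ^ 12 ≤ L * T) (hn₁ : 0 ≤ n₁) (hn₂ : 0 ≤ n₂)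
    (hn : ∀ t, n t = if t ≤ (k : ℤ) then n₁ else n₂) (hk₁ : n₁ ^ 4 * (k : ℝ) ^ 3 ≤ L * T)
    (hk₂ : n₂ ^ 4 * ((T : ℝ) - k) ^ 3 ≤ L * T) (hd0 : 0 ≤ d) (hd : d * √T ≤ L * N)
    (hD : ∀ t ∈ Finset.Ioc (0 : ℤ) T, |D t| ≤ 3 * N * (d * w t ^ 2 + n t * w t))
    {J : Finset ℤ} {s : ℤ} (hJ : J ⊆ Finset.Ioc (0 : ℤ) T)
    (hJs : ∀ t ∈ J, t + s ∈ Finset.Ioc (0 : ℤ) T) :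
    ∑ t ∈ J, |D t| * w (t + s) ^ 2 ≤ 15 * L ^ 2 * N ^ 2 * √T := by
  have hw0 : ∀ t, 0 ≤ w t := fun t => zero_le_one.trans (hw1 t)
  have hJw : ∀ I ⊆ J, ∑ t ∈ I, (w t ^ 12 + w (t + s) ^ 12) ≤ 2 * L * T := by
    intro I hI
    rw [Finset.sum_add_distrib]
    have h1 : ∑ t ∈ I, w t ^ 12 ≤ ∑ t ∈ Finset.Ioc (0 : ℤ) T, w t ^ 12 :=
      Finset.sum_le_sum_of_subset_of_nonneg (hI.trans hJ) fun t _ _ => pow_nonneg (hw0 t) _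
    have h2 : ∑ t ∈ I, w (t + s) ^ 12 ≤ ∑ t ∈ Finset.Ioc (0 : ℤ) T, w t ^ 12 :=
      sum_shift_le (f := fun t => w t ^ 12) (fun t => pow_nonneg (hw0 t) _)
        fun t ht => hJs t (hI ht)
    linarith
  have hseg : ∀ I ⊆ J, ∀ n' l : ℝ, 0 ≤ n' → (I.card : ℝ) ≤ l → n' ^ 4 * l ^ 3 ≤ L * T →
      n' * ∑ t ∈ I, w t * w (t + s) ^ 2 ≤ 2 * L * √T := by
    intro I hI n' l hn' hl hnl
    refine mul_sum_le_sqrt (fun t _ => by have := hw0 t; positivity) hL (Nat.cast_nonneg T) hl hnl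
      ?_
    exact (Finset.sum_le_sum fun t _ => mul_sq_pow_four_le (hw0 t) (hw0 (t + s))).trans (hJw I hI)
  have hsplit : ∑ t ∈ J, n t * (w t * w (t + s) ^ 2) ≤ 4 * L * √T := by
    rw [← Finset.sum_filter_add_sum_filter_not J (fun t => t ≤ (k : ℤ))]
    have e1 : ∑ t ∈ J with t ≤ (k : ℤ), n t * (w t * w (t + s) ^ 2) =
        n₁ * ∑ t ∈ J with t ≤ (k : ℤ), w t * w (t + s) ^ 2 := by
      rw [Finset.mul_sum]
      exact Finset.sum_congr rfl fun t ht => by rw [hn, if_pos (Finset.mem_filter.1 ht).2]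
    have e2 : ∑ t ∈ J with ¬ t ≤ (k : ℤ), n t * (w t * w (t + s) ^ 2) =
        n₂ * ∑ t ∈ J with ¬ t ≤ (k : ℤ), w t * w (t + s) ^ 2 := by
      rw [Finset.mul_sum]
      exact Finset.sum_congr rfl fun t ht => by rw [hn, if_neg (Finset.mem_filter.1 ht).2]
    rw [e1, e2]
    have c1 : (((Finset.filter (fun t : ℤ => t ≤ (k : ℤ)) J).card : ℕ) : ℝ) ≤ k := by
      have : Finset.filter (fun t : ℤ => t ≤ (k : ℤ)) J ⊆ Finset.Ioc (0 : ℤ) k := by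
        intro t ht
        have h1 := Finset.mem_filter.1 ht
        have h2 := Finset.mem_Ioc.1 (hJ h1.1)
        exact Finset.mem_Ioc.2 ⟨h2.1, h1.2⟩
      have := Finset.card_le_card this
      rw [Int.card_Ioc] at this
      exact_mod_cast this.trans (by omega)
    have c2 : (((Finset.filter (fun t : ℤ => ¬ t ≤ (k : ℤ)) J).card : ℕ) : ℝ) ≤ (T : ℝ) - k := by
      have : Finset.filter (fun t : ℤ => ¬ t ≤ (k : ℤ)) J ⊆ Finset.Ioc (k : ℤ) T := by
        intro t ht
        have h1 := Finset.mem_filter.1 ht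
        have h2 := Finset.mem_Ioc.1 (hJ h1.1)
        exact Finset.mem_Ioc.2 ⟨not_le.1 h1.2, h2.2⟩
      have := Finset.card_le_card this
      rw [Int.card_Ioc] at this
      rw [← Nat.cast_sub hkT]
      exact_mod_cast this.trans (by omega)
    have s1 := hseg _ (Finset.filter_subset _ _) n₁ k hn₁ c1 hk₁
    have s2 := hseg _ (Finset.filter_subset _ _) n₂ _ hn₂ c2 hk₂
    linarith
  have hsq : ∑ t ∈ J, w t ^ 2 * w (t + s) ^ 2 ≤ L * T := by
    have : ∀ t ∈ J, w t ^ 2 * w (t + s) ^ 2 ≤ (w t ^ 12 + w (t + s) ^ 12) / 2 := by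
      intro t _
      have a1 : w t ^ 4 ≤ w t ^ 12 := pow_le_pow_right₀ (hw1 t) (by norm_num)
      have a2 : w (t + s) ^ 4 ≤ w (t + s) ^ 12 := pow_le_pow_right₀ (hw1 _) (by norm_num)
      nlinarith [sq_nonneg (w t ^ 2 - w (t + s) ^ 2)]
    refine (Finset.sum_le_sum this).trans ?_
    rw [← Finset.sum_div]
    have := hJw J subset_rfl
    linarith
  have hmain : ∑ t ∈ J, |D t| * w (t + s) ^ 2 ≤
      3 * N * (d * ∑ t ∈ J, w t ^ 2 * w (t + s) ^ 2 + ∑ t ∈ J, n t * (w t * w (t + s) ^ 2)) := by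
    rw [Finset.mul_sum, ← Finset.sum_add_distrib, Finset.mul_sum]
    refine Finset.sum_le_sum fun t ht => ?_
    calc |D t| * w (t + s) ^ 2 ≤ 3 * N * (d * w t ^ 2 + n t * w t) * w (t + s) ^ 2 := by
          gcongr
          exact hD t (hJ ht)
      _ = _ := by ring
  -- One factor `√T` is absorbed by the rate of `d`. The result has the constant `3 · (1 + 4) = 15`.
  have hT2 : (T : ℝ) = √T * √T := (Real.mul_self_sqrt (Nat.cast_nonneg T)).symm
  calc _ ≤ _ := hmain
    _ ≤ 3 * N * (d * (L * T) + 4 * L * √T) := by gcongr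
    _ = 3 * N * ((d * √T) * L * √T + 4 * L * √T) := by
        linear_combination 3 * N * d * L * hT2
    _ ≤ 3 * N * ((L * N) * L * √T + 4 * (L * L * N) * √T) := by
        gcongr
        nlinarith
    _ = _ := by ring

lemma autoCov_eq (y : ℤ → ℝ) (T : ℕ) (s : ℤ) :
    autoCov y T s = ((T : ℝ) - |(s : ℝ)|)⁻¹ * ∑ t ∈ Finset.Icc (1 : ℤ) (T - |s|),
      (y t - timeMean y T) * (y (t + |s|) - timeMean y T) := by
  unfold autoCov
  split_ifs with h
  · rw [abs_of_nonneg h, abs_of_nonneg (by exact_mod_cast h)]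
  · have hs : |s| = -s := abs_of_neg (not_le.1 h)
    rw [hs]
    congr 1
    refine Finset.sum_nbij' (fun t => t + s) (fun t => t - s) ?_ ?_ ?_ ?_ ?_
    · intro t ht; rw [Finset.mem_Icc] at *; omega
    · intro t ht; rw [Finset.mem_Icc] at *; omega
    · intro t _; omega
    · intro t _; omega
    · intro t _
      rw [add_neg_cancel_right, mul_comm]

/-- Effect on a sample autocovariance of an error in the series that is small in the sense of
`sum_abs_mul_lag_le`. -/
lemma abs_autoCov_sub_le {T : ℕ} (hT : 0 < T) {N L e : ℝ} (hN : 1 ≤ N) (hL : 1 ≤ L)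
    {w y z : ℤ → ℝ} (hw1 : ∀ t, 1 ≤ w t) (hw : ∑ t ∈ Finset.Ioc (0 : ℤ) T, w t ^ 12 ≤ L * T)
    (hy0 : ∀ t ∈ Finset.Ioc (0 : ℤ) T, 0 ≤ y t) (hy : ∀ t ∈ Finset.Ioc (0 : ℤ) T, y t ≤ N * w t ^ 2)
    (hz0 : ∀ t ∈ Finset.Ioc (0 : ℤ) T, 0 ≤ z t)
    (hz : ∀ t ∈ Finset.Ioc (0 : ℤ) T, z t ≤ 4 * N * w t ^ 2) (he0 : 0 ≤ e) (he : e ≤ L * N)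
    (hmean : |timeMean y T - e| ≤ L * N / √T)
    (hD : ∀ (J : Finset ℤ) (s : ℤ), J ⊆ Finset.Ioc (0 : ℤ) T →
      (∀ t ∈ J, t + s ∈ Finset.Ioc (0 : ℤ) T) →
      ∑ t ∈ J, |z t - y t| * w (t + s) ^ 2 ≤ 15 * L ^ 2 * N ^ 2 * √T)
    {s : ℤ} (hs : 2 * |s| ≤ T) :
    |autoCov z T s - ((T : ℝ) - |(s : ℝ)|)⁻¹ * ∑ t ∈ Finset.Icc (1 : ℤ) (T - |s|),
      (y t - e) * (y (t + |s|) - e)| ≤ 620 * L ^ 4 * (N ^ 3 / √T) := by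
  have hT' : (0 : ℝ) < T := by exact_mod_cast hT
  have hsT : 0 < √(T : ℝ) := Real.sqrt_pos.2 hT'
  have hT2 : √(T : ℝ) * √T = T := Real.mul_self_sqrt hT'.le
  have hIcc : Finset.Icc (1 : ℤ) T = Finset.Ioc (0 : ℤ) T := by
    ext t; simp only [Finset.mem_Icc, Finset.mem_Ioc]; omega
  have hw2 : ∑ t ∈ Finset.Ioc (0 : ℤ) T, w t ^ 2 ≤ L * T :=
    (Finset.sum_le_sum fun t _ => pow_le_pow_right₀ (hw1 t) (by norm_num)).trans hw
  set ζ := timeMean z T with hζ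
  have hζ0 : 0 ≤ ζ := by
    unfold ζ timeMean
    rw [hIcc]
    exact mul_nonneg (by positivity) (Finset.sum_nonneg hz0)
  have hζ1 : ζ ≤ 4 * N * L := by
    unfold ζ timeMean
    rw [hIcc, inv_mul_le_iff₀ hT']
    refine (Finset.sum_le_sum hz).trans ?_
    rw [← Finset.mul_sum]
    calc 4 * N * ∑ t ∈ Finset.Ioc (0 : ℤ) T, w t ^ 2 ≤ 4 * N * (L * T) := by gcongr
      _ = _ := by ring
  -- The mean of the perturbed series: `hD` at lag zero, where the weight is dropped since it is at
  -- least one, plus the sampling error of the mean of `y`.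
  have hκ : |ζ - e| ≤ 16 * L ^ 2 * N ^ 2 / √T := by
    have h1 : |ζ - timeMean y T| ≤ 15 * L ^ 2 * N ^ 2 / √T := by
      unfold ζ timeMean
      rw [← mul_sub, ← Finset.sum_sub_distrib, abs_mul, abs_of_pos (inv_pos.2 hT'),
        inv_mul_le_iff₀ hT', hIcc]
      refine (Finset.abs_sum_le_sum_abs _ _).trans ?_
      have := hD (Finset.Ioc (0 : ℤ) T) 0 subset_rfl (by simp)
      have h2 : ∑ t ∈ Finset.Ioc (0 : ℤ) T, |z t - y t| ≤
          ∑ t ∈ Finset.Ioc (0 : ℤ) T, |z t - y t| * w (t + 0) ^ 2 := by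
        refine Finset.sum_le_sum fun t _ => ?_
        exact le_mul_of_one_le_right (abs_nonneg _) (one_le_pow₀ (hw1 _))
      refine h2.trans (this.trans (le_of_eq ?_))
      rw [mul_div_assoc', eq_div_iff hsT.ne']
      calc 15 * L ^ 2 * N ^ 2 * √T * √T = 15 * L ^ 2 * N ^ 2 * (√T * √T) := by ring
        _ = _ := by rw [hT2]; ring
    have h2 : L * N / √T ≤ L ^ 2 * N ^ 2 / √T := by
      have a1 : L ≤ L ^ 2 := le_self_pow₀ hL (by norm_num)
      have a2 : N ≤ N ^ 2 := le_self_pow₀ hN (by norm_num)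
      gcongr
    calc |ζ - e| ≤ |ζ - timeMean y T| + |timeMean y T - e| := abs_sub_le _ _ _
      _ ≤ 15 * L ^ 2 * N ^ 2 / √T + L ^ 2 * N ^ 2 / √T := add_le_add h1 (hmean.trans h2)
      _ = _ := by ring
  set κ := |ζ - e|
  have hκ0 : 0 ≤ κ := abs_nonneg _
  set J := Finset.Icc (1 : ℤ) (T - |s|)
  have hJ : J ⊆ Finset.Ioc (0 : ℤ) T := by
    intro t ht
    have := Finset.mem_Icc.1 ht
    have := abs_nonneg s
    exact Finset.mem_Ioc.2 ⟨by omega, by omega⟩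
  have hJs : ∀ t ∈ J, t + |s| ∈ Finset.Ioc (0 : ℤ) T := by
    intro t ht
    have := Finset.mem_Icc.1 ht
    have := abs_nonneg s
    exact Finset.mem_Ioc.2 ⟨by omega, by omega⟩
  rw [autoCov_eq, ← mul_sub, ← Finset.sum_sub_distrib]
  have hS : (s : ℝ) = ((s : ℤ) : ℝ) := rfl
  have hsR : 2 * |(s : ℝ)| ≤ T := by exact_mod_cast hs
  -- Lags up to `T / 2` keep the normalisation of order `T`; this doubles 310 to 620.
  have hden : (T : ℝ) / 2 ≤ T - |(s : ℝ)| := by linarith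
  -- bounds for the centred series
  have hzc : ∀ t ∈ Finset.Ioc (0 : ℤ) T, |z t - ζ| ≤ 8 * L * N * w t ^ 2 := by
    intro t ht
    have h1 := hz t ht
    have h2 := hz0 t ht
    have hq : 1 ≤ w t ^ 2 := one_le_pow₀ (hw1 t)
    have h3 : N * w t ^ 2 ≤ L * N * w t ^ 2 := by
      have : 0 ≤ N * w t ^ 2 := by positivity
      nlinarith
    have h4 : N * L ≤ L * N * w t ^ 2 := by
      have : 0 ≤ L * N := by positivity
      nlinarith
    rw [abs_le]
    constructor <;> nlinarith
  have hyc : ∀ t ∈ Finset.Ioc (0 : ℤ) T, |y t - e| ≤ 2 * L * N * w t ^ 2 := by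
    intro t ht
    have h1 := hy t ht
    have h2 := hy0 t ht
    have hq : 1 ≤ w t ^ 2 := one_le_pow₀ (hw1 t)
    have h3 : N * w t ^ 2 ≤ L * N * w t ^ 2 := by
      have : 0 ≤ N * w t ^ 2 := by positivity
      nlinarith
    have h4 : L * N ≤ L * N * w t ^ 2 := by
      have : 0 ≤ L * N := by positivity
      nlinarith
    rw [abs_le]
    constructor <;> nlinarith
  have hdiff : ∀ t, |(z t - ζ) - (y t - e)| ≤ |z t - y t| + κ := by
    intro t
    have : (z t - ζ) - (y t - e) = (z t - y t) - (ζ - e) := by ring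
    rw [this]
    exact abs_sub _ _
  -- The weight at `t + |s| + -|s|` is left unsimplified to match `hD` at lag `-|s|`, after
  -- reindexing by `t + |s|`.
  have hterm : ∀ t ∈ J, |(z t - ζ) * (z (t + |s|) - ζ) - (y t - e) * (y (t + |s|) - e)| ≤
      8 * L * N * (|z t - y t| * w (t + |s|) ^ 2) + 8 * L * N * κ * w (t + |s|) ^ 2 +
        (2 * L * N * (|z (t + |s|) - y (t + |s|)| * w (t + |s| + -|s|) ^ 2) +
          2 * L * N * κ * w t ^ 2) := by
    intro t ht
    have e1 : (z t - ζ) * (z (t + |s|) - ζ) - (y t - e) * (y (t + |s|) - e) =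
        ((z t - ζ) - (y t - e)) * (z (t + |s|) - ζ) +
          (y t - e) * ((z (t + |s|) - ζ) - (y (t + |s|) - e)) := by ring
    rw [e1]
    refine (abs_add_le _ _).trans ?_
    rw [abs_mul, abs_mul, add_neg_cancel_right]
    have a1 := hzc _ (hJs t ht)
    have a2 := hyc _ (hJ ht)
    have a3 := hdiff t
    have a4 := hdiff (t + |s|)
    have b1 : |(z t - ζ) - (y t - e)| * |z (t + |s|) - ζ| ≤
        (|z t - y t| + κ) * (8 * L * N * w (t + |s|) ^ 2) := by gcongr
    have b2 : |y t - e| * |(z (t + |s|) - ζ) - (y (t + |s|) - e)| ≤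
        (2 * L * N * w t ^ 2) * (|z (t + |s|) - y (t + |s|)| + κ) := by gcongr
    linarith
  have s1 := hD J |s| hJ hJs
  have s2 : ∑ t ∈ J, w (t + |s|) ^ 2 ≤ L * T :=
    (sum_shift_le (f := fun t => w t ^ 2) (fun t => by positivity) hJs).trans hw2
  have s3 : ∑ t ∈ J, w t ^ 2 ≤ L * T :=
    (Finset.sum_le_sum_of_subset_of_nonneg hJ fun t _ _ => by positivity).trans hw2
  have s4 : ∑ t ∈ J, |z (t + |s|) - y (t + |s|)| * w (t + |s| + -|s|) ^ 2 ≤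
      15 * L ^ 2 * N ^ 2 * √T := by
    have := hD (J.image fun t => t + |s|) (-|s|) (by
        intro t ht
        obtain ⟨a, ha, rfl⟩ := Finset.mem_image.1 ht
        exact hJs a ha) (by
        intro t ht
        obtain ⟨a, ha, rfl⟩ := Finset.mem_image.1 ht
        rw [add_neg_cancel_right]
        exact hJ ha)
    rwa [Finset.sum_image (fun a _ b _ hab => by simpa using hab)] at this
  have hκT : κ * (L * T) ≤ 16 * L ^ 3 * N ^ 2 * √T := by
    calc κ * (L * T) ≤ 16 * L ^ 2 * N ^ 2 / √T * (L * T) := by gcongr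
      _ = 16 * L ^ 3 * N ^ 2 * ((√T * √T) / √T) := by rw [hT2]; ring
      _ = _ := by rw [mul_div_assoc, div_self hsT.ne', mul_one]
  have htot : |∑ t ∈ J, ((z t - ζ) * (z (t + |s|) - ζ) - (y t - e) * (y (t + |s|) - e))| ≤
      310 * L ^ 4 * N ^ 3 * √T := by
    refine (Finset.abs_sum_le_sum_abs _ _).trans ((Finset.sum_le_sum hterm).trans ?_)
    rw [Finset.sum_add_distrib, Finset.sum_add_distrib, Finset.sum_add_distrib, ← Finset.mul_sum,
      ← Finset.mul_sum, ← Finset.mul_sum, ← Finset.mul_sum]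
    calc _ ≤ 8 * L * N * (15 * L ^ 2 * N ^ 2 * √T) + 8 * L * N * κ * (L * T) +
          (2 * L * N * (15 * L ^ 2 * N ^ 2 * √T) + 2 * L * N * κ * (L * T)) := by gcongr
      _ = 10 * L * N * (15 * L ^ 2 * N ^ 2 * √T) + 10 * L * N * (κ * (L * T)) := by ring
      _ ≤ 10 * L * N * (15 * L ^ 2 * N ^ 2 * √T) + 10 * L * N * (16 * L ^ 3 * N ^ 2 * √T) := by
          gcongr
      _ = 150 * L ^ 3 * (N ^ 3 * √T) + 160 * L ^ 4 * (N ^ 3 * √T) := by ring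
      _ ≤ 150 * L ^ 4 * (N ^ 3 * √T) + 160 * L ^ 4 * (N ^ 3 * √T) := by
          have : L ^ 3 ≤ L ^ 4 := pow_le_pow_right₀ hL (by norm_num)
          gcongr
      _ = _ := by ring
  rw [abs_mul, abs_of_pos (inv_pos.2 (by linarith)), inv_mul_le_iff₀ (by linarith)]
  refine htot.trans ?_
  have hfin : 310 * L ^ 4 * N ^ 3 * √T = (T / 2) * (620 * L ^ 4 * (N ^ 3 / √T)) := by
    have : N ^ 3 * √T = T * (N ^ 3 / √T) := by
      rw [mul_div_assoc', eq_div_iff hsT.ne', mul_assoc, hT2, mul_comm]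
    linear_combination 310 * L ^ 4 * this
  rw [hfin]
  gcongr

end Deterministic

/-! ### Scores built from an estimated direction and segment means -/

section Geometry
variable {n : ℕ}

lemma segMean_sub_const (x : ℤ → EuclideanSpace ℝ (Fin n)) (c : EuclideanSpace ℝ (Fin n)) {a b : ℤ}
    (hab : a < b) : segMean (fun t => x t - c) a b = segMean x a b - c := by
  unfold segMean
  have h : ((b : ℝ) - a) ≠ 0 := by
    have : (a : ℝ) < b := by exact_mod_cast hab
    linarith
  have hc : ((Finset.Ioc a b).card : ℝ) = (b : ℝ) - a := by
    rw [Int.card_Ioc]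
    have : (((b - a).toNat : ℤ) : ℝ) = ((b - a : ℤ) : ℝ) := by rw [Int.toNat_of_nonneg (by omega)]
    push_cast at this ⊢
    exact_mod_cast this
  rw [Finset.sum_sub_distrib, smul_sub, Finset.sum_const, ← Nat.cast_smul_eq_nsmul ℝ, hc, smul_smul,
    inv_mul_cancel₀ h, one_smul]

lemma xiHat_sub_const (x : ℤ → EuclideanSpace ℝ (Fin n)) (c v : EuclideanSpace ℝ (Fin n)) {T k : ℕ}
    (hk : 1 ≤ k) (hkT : k < T) : xiHat (fun t => x t - c) T k v = xiHat x T k v := by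
  funext t
  unfold xiHat breakMean
  rw [segMean_sub_const x c (by exact_mod_cast hk), segMean_sub_const x c (by exact_mod_cast hkT)]
  split_ifs <;> simp

/-- Converts the maximal inequality for sums into the condition on segment means that
`mul_sum_le_sqrt` needs, normalised by `√n`. -/
lemma norm_segMean_pow_four_le (hn : 0 < n) {z : ℤ → EuclideanSpace ℝ (Fin n)} {a b : ℤ} (hab : a < b)
    {M : ℝ} (h : ‖∑ t ∈ Finset.Ioc a b, z t‖ ^ 4 ≤ (n : ℝ) ^ 2 * (((b : ℝ) - a) * M)) :
    (‖segMean z a b‖ / √n) ^ 4 * ((b : ℝ) - a) ^ 3 ≤ M := by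
  have hl : 0 < (b : ℝ) - a := by
    have : (a : ℝ) < b := by exact_mod_cast hab
    linarith
  have hn' : (0 : ℝ) < n := by exact_mod_cast hn
  have hs : √(n : ℝ) ^ 4 = (n : ℝ) ^ 2 := by
    rw [show (4 : ℕ) = 2 * 2 by norm_num, pow_mul, Real.sq_sqrt hn'.le]
  unfold segMean
  rw [norm_smul, norm_inv, Real.norm_of_nonneg hl.le, div_pow, mul_pow, hs, div_mul_eq_mul_div,
    div_le_iff₀ (by positivity)]
  calc (((b : ℝ) - a)⁻¹) ^ 4 * ‖∑ t ∈ Finset.Ioc a b, z t‖ ^ 4 * ((b : ℝ) - a) ^ 3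
      = ‖∑ t ∈ Finset.Ioc a b, z t‖ ^ 4 * ((b : ℝ) - a)⁻¹ := by field_simp
    _ ≤ (n : ℝ) ^ 2 * (((b : ℝ) - a) * M) * ((b : ℝ) - a)⁻¹ := by gcongr
    _ = M * (n : ℝ) ^ 2 := by field_simp

/-- Power mean inequality. It lets the segment means be added to the weight without changing the
order of its twelfth-power sum. -/
lemma norm_segMean_pow_twelve_le (hn : 0 < n) {z : ℤ → EuclideanSpace ℝ (Fin n)} {u : ℤ → ℝ}
    (hu : ∀ t, 0 ≤ u t) (hzu : ∀ t, ‖z t‖ ≤ √n * u t) {a b : ℤ} (hab : a < b) :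
    (‖segMean z a b‖ / √n) ^ 12 * ((b : ℝ) - a) ≤ ∑ t ∈ Finset.Ioc a b, u t ^ 12 := by
  have hl : 0 < (b : ℝ) - a := by
    have : (a : ℝ) < b := by exact_mod_cast hab
    linarith
  have hn' : (0 : ℝ) < √n := Real.sqrt_pos.2 (by exact_mod_cast hn)
  have hc : ((Finset.Ioc a b).card : ℝ) = (b : ℝ) - a := by
    rw [Int.card_Ioc]
    have : (((b - a).toNat : ℤ) : ℝ) = ((b - a : ℤ) : ℝ) := by rw [Int.toNat_of_nonneg (by omega)]
    push_cast at this ⊢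
    exact_mod_cast this
  have h1 : ‖segMean z a b‖ / √n ≤ (∑ t ∈ Finset.Ioc a b, u t) / ((b : ℝ) - a) := by
    unfold segMean
    rw [norm_smul, norm_inv, Real.norm_of_nonneg hl.le, div_le_div_iff₀ hn' hl]
    have : ‖∑ t ∈ Finset.Ioc a b, z t‖ ≤ √n * ∑ t ∈ Finset.Ioc a b, u t := by
      rw [Finset.mul_sum]
      exact (norm_sum_le _ _).trans (Finset.sum_le_sum fun t _ => hzu t)
    calc ((b : ℝ) - a)⁻¹ * ‖∑ t ∈ Finset.Ioc a b, z t‖ * ((b : ℝ) - a)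
        = ‖∑ t ∈ Finset.Ioc a b, z t‖ := by field_simp
      _ ≤ _ := by rw [mul_comm]; exact this
  have h2 := pow_sum_div_card_le_sum_pow (s := Finset.Ioc a b) (f := u) (n := 11) fun t _ => hu t
  rw [hc] at h2
  calc (‖segMean z a b‖ / √n) ^ 12 * ((b : ℝ) - a)
      ≤ ((∑ t ∈ Finset.Ioc a b, u t) / ((b : ℝ) - a)) ^ 12 * ((b : ℝ) - a) := by gcongr
    _ = (∑ t ∈ Finset.Ioc a b, u t) ^ (11 + 1) / ((b : ℝ) - a) ^ 11 := by field_simp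
    _ ≤ _ := h2

lemma add_pow_twelve_le {x y : ℝ} (hx : 0 ≤ x) (hy : 0 ≤ y) :
    (x + y) ^ 12 ≤ 2048 * (x ^ 12 + y ^ 12) := by
  have := add_pow_le hx hy 12
  norm_num at this
  linarith

/-- Sample autocovariances of the estimated scores, compared with those of the true scores. -/
lemma abs_autoCov_xiHat_sub_le (hn : 0 < n) {T k : ℕ} (hk : 1 ≤ k) (hkT : k < T) {K e : ℝ}
    (hK : 1 ≤ K) {z : ℤ → EuclideanSpace ℝ (Fin n)} {u : ℤ → ℝ} (hu1 : ∀ t, 1 ≤ u t)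
    (hzu : ∀ t, ‖z t‖ ≤ √n * u t) (hu : ∑ t ∈ Finset.Ioc (0 : ℤ) T, u t ^ 12 ≤ K * T)
    (hS : ∀ l : ℕ, 1 ≤ l → l ≤ T →
      ‖∑ t ∈ Finset.Ioc (0 : ℤ) l, z t‖ ^ 4 ≤ (n : ℝ) ^ 2 * (l * (K * T)))
    (hS' : ∀ l : ℕ, 1 ≤ l → l ≤ T →
      ‖∑ t ∈ Finset.Ioc (T - l : ℤ) T, z t‖ ^ 4 ≤ (n : ℝ) ^ 2 * (l * (K * T)))
    {v v' : EuclideanSpace ℝ (Fin n)} (hv : ‖v‖ = 1) (hv' : ‖v'‖ = 1)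
    (hd : ‖v' - v‖ * √T ≤ K * n) (he0 : 0 ≤ e) (he : e ≤ K * n)
    (hmean : |timeMean (fun t => inner ℝ v (z t) ^ 2) T - e| ≤ K * n / √T) {s : ℤ}
    (hs : 2 * |s| ≤ T) :
    |autoCov (xiHat z T k v') T s - ((T : ℝ) - |(s : ℝ)|)⁻¹ * ∑ t ∈ Finset.Icc (1 : ℤ) (T - |s|),
      (inner ℝ v (z t) ^ 2 - e) * (inner ℝ v (z (t + |s|)) ^ 2 - e)| ≤
      620 * (4096 * K) ^ 4 * ((n : ℝ) ^ 3 / √T) := by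
  have hN : (1 : ℝ) ≤ n := by exact_mod_cast hn
  have hsn : 0 < √(n : ℝ) := Real.sqrt_pos.2 (by linarith)
  have hsn2 : √(n : ℝ) * √n = n := Real.mul_self_sqrt (by linarith)
  have hu0 : ∀ t, 0 ≤ u t := fun t => zero_le_one.trans (hu1 t)
  set n₁ := ‖segMean z 0 k‖ / √n with hn₁
  set n₂ := ‖segMean z k T‖ / √n with hn₂
  have hn₁0 : 0 ≤ n₁ := by positivity
  have hn₂0 : 0 ≤ n₂ := by positivity
  have hkpos : (0 : ℤ) < k := by exact_mod_cast hk
  have hkT' : (k : ℤ) < T := by exact_mod_cast hkT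
  have f1 : n₁ ^ 4 * (k : ℝ) ^ 3 ≤ K * T := by
    have := norm_segMean_pow_four_le hn (z := z) hkpos (M := K * T)
      (by simpa using hS k hk hkT.le)
    simpa using this
  have f2 : n₂ ^ 4 * ((T : ℝ) - k) ^ 3 ≤ K * T := by
    have h1 := hS' (T - k) (by omega) (by omega)
    have e1 : (T : ℤ) - ((T - k : ℕ) : ℤ) = k := by omega
    have e2 : ((T - k : ℕ) : ℝ) = (T : ℝ) - k := by rw [Nat.cast_sub hkT.le]
    rw [e1, e2] at h1
    have := norm_segMean_pow_four_le hn (z := z) hkT' (M := K * T) (by simpa using h1)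
    simpa using this
  have g1 : n₁ ^ 12 * k ≤ ∑ t ∈ Finset.Ioc (0 : ℤ) k, u t ^ 12 := by
    have := norm_segMean_pow_twelve_le hn hu0 hzu hkpos
    simpa using this
  have g2 : n₂ ^ 12 * ((T : ℝ) - k) ≤ ∑ t ∈ Finset.Ioc (k : ℤ) T, u t ^ 12 := by
    have := norm_segMean_pow_twelve_le hn hu0 hzu hkT'
    simpa using this
  set nn : ℤ → ℝ := fun t => if t ≤ (k : ℤ) then n₁ else n₂ with hnn
  have hnn0 : ∀ t, 0 ≤ nn t := fun t => by simp only [hnn]; split_ifs <;> assumption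
  have hnnsum : ∑ t ∈ Finset.Ioc (0 : ℤ) T, nn t ^ 12 ≤ ∑ t ∈ Finset.Ioc (0 : ℤ) T, u t ^ 12 := by
    rw [sum_Ioc_split _ hkpos.le hkT'.le, sum_Ioc_split (fun t => u t ^ 12) hkpos.le hkT'.le]
    refine add_le_add ?_ ?_
    · rw [Finset.sum_congr rfl (g := fun _ => n₁ ^ 12)]
      · rw [Finset.sum_const, Int.card_Ioc, nsmul_eq_mul, mul_comm]
        simpa using g1
      · intro t ht
        simp only [hnn, if_pos (Finset.mem_Ioc.1 ht).2]
    · rw [Finset.sum_congr rfl (g := fun _ => n₂ ^ 12)]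
      · have e1 : ((T : ℤ) - k).toNat = T - k := by omega
        rw [Finset.sum_const, Int.card_Ioc, nsmul_eq_mul, mul_comm, e1, Nat.cast_sub hkT.le]
        exact g2
      · intro t ht
        simp only [hnn, if_neg (not_le.2 (Finset.mem_Ioc.1 ht).1)]
  -- One weight dominating both the observation and its segment mean. The factor 4096 is `2¹¹` from
  -- the twelfth power of a sum, times the two summands.
  set w : ℤ → ℝ := fun t => u t + nn t with hw
  have hw1 : ∀ t, 1 ≤ w t := fun t => by
    have := hu1 t; have := hnn0 t; simp only [hw]; linarith
  have hw0 : ∀ t, 0 ≤ w t := fun t => zero_le_one.trans (hw1 t)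
  have hwsum : ∑ t ∈ Finset.Ioc (0 : ℤ) T, w t ^ 12 ≤ (4096 * K) * T := by
    refine (Finset.sum_le_sum fun t _ => add_pow_twelve_le (hu0 t) (hnn0 t)).trans ?_
    rw [← Finset.mul_sum, Finset.sum_add_distrib]
    linarith
  have hT0 : (0 : ℝ) ≤ T := Nat.cast_nonneg T
  have hKT : K * T ≤ 4096 * K * T := by nlinarith [mul_nonneg (zero_le_one.trans hK) hT0]
  have hKn : K * n ≤ 4096 * K * n := by
    nlinarith [mul_nonneg (zero_le_one.trans hK) (zero_le_one.trans hN)]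
  have hbm : ∀ t, ‖breakMean z T k t‖ = √n * nn t := by
    intro t
    simp only [breakMean, hnn, hn₁, hn₂]
    split_ifs <;> field_simp
  have hzw : ∀ t, ‖z t‖ ≤ √n * w t := fun t => (hzu t).trans (by
    have := hnn0 t
    gcongr
    simp only [hw]
    linarith)
  have hnw : ∀ t, nn t ≤ w t := fun t => by have := hu0 t; simp only [hw]; linarith
  have hin1 : ∀ t, |inner ℝ v (z t)| ≤ √n * w t := fun t =>
    (abs_real_inner_le_norm _ _).trans (by rw [hv, one_mul]; exact hzw t)
  have hin2 : ∀ t, |inner ℝ v' (z t - breakMean z T k t)| ≤ 2 * (√n * w t) := fun t => by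
    refine (abs_real_inner_le_norm _ _).trans ?_
    rw [hv', one_mul]
    refine (norm_sub_le _ _).trans ?_
    rw [hbm]
    have := hzw t
    have : √n * nn t ≤ √n * w t := by gcongr; exact hnw t
    linarith
  -- Error of the projection: wrong direction on the data, plus the projected segment mean.
  have hdiff : ∀ t, |inner ℝ v' (z t - breakMean z T k t) - inner ℝ v (z t)| ≤
      √n * (‖v' - v‖ * w t + nn t) := by
    intro t
    have e1 : inner ℝ v' (z t - breakMean z T k t) - inner ℝ v (z t) =
        inner ℝ (v' - v) (z t) - inner ℝ v' (breakMean z T k t) := by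
      rw [inner_sub_right, inner_sub_left]; ring
    rw [e1]
    refine (abs_sub _ _).trans ?_
    have h1 := abs_real_inner_le_norm (v' - v) (z t)
    have h2 := abs_real_inner_le_norm v' (breakMean z T k t)
    rw [hv', one_mul, hbm] at h2
    have h3 : ‖v' - v‖ * ‖z t‖ ≤ ‖v' - v‖ * (√n * w t) := by gcongr; exact hzw t
    linarith
  have hD : ∀ t ∈ Finset.Ioc (0 : ℤ) T, |xiHat z T k v' t - inner ℝ v (z t) ^ 2| ≤
      3 * n * (‖v' - v‖ * w t ^ 2 + nn t * w t) := by
    intro t _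
    unfold xiHat
    rw [sq_sub_sq, abs_mul]
    have h1 : |inner ℝ v' (z t - breakMean z T k t) + inner ℝ v (z t)| ≤ 3 * (√n * w t) := by
      refine (abs_add_le _ _).trans ?_
      linarith [hin1 t, hin2 t]
    have h2 : 0 ≤ √n * (‖v' - v‖ * w t + nn t) := (abs_nonneg _).trans (hdiff t)
    calc _ ≤ 3 * (√n * w t) * (√n * (‖v' - v‖ * w t + nn t)) := by
          gcongr
          · have := hw0 t; positivity
          · exact hdiff t
      _ = 3 * (√n * √n) * (‖v' - v‖ * w t ^ 2 + nn t * w t) := by ring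
      _ = _ := by rw [hsn2]
  refine abs_autoCov_sub_le (by omega) hN (L := 4096 * K) (by linarith) hw1 hwsum
    (fun t _ => sq_nonneg _) (fun t _ => ?_) (fun t _ => ?_) (fun t _ => ?_) he0 (he.trans hKn)
    (hmean.trans (by gcongr)) (fun J s' hJ hJs => ?_) hs
  · rw [← sq_abs]
    calc |inner ℝ v (z t)| ^ 2 ≤ (√n * w t) ^ 2 := by gcongr; exact hin1 t
      _ = (√n * √n) * w t ^ 2 := by ring
      _ = _ := by rw [hsn2]
  · unfold xiHat; positivity
  · unfold xiHat
    rw [← sq_abs]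
    calc _ ≤ (2 * (√n * w t)) ^ 2 := by gcongr; exact hin2 t
      _ = 4 * (√n * √n) * w t ^ 2 := by ring
      _ = _ := by rw [hsn2]
  · exact sum_abs_mul_lag_le hkT.le hN (by linarith) hw1 hwsum hn₁0 hn₂0 (fun t => rfl)
      (f1.trans hKT) (f2.trans hKT) (norm_nonneg _) (hd.trans hKn) hD hJ hJs

end Geometry

/-! ### Perturbation of the leading eigenvector -/

section Spectral
variable {n : ℕ}

lemma inner_toEuclideanLin_eq_sum {A : Matrix (Fin n) (Fin n) ℝ} {lam : Fin n → ℝ}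
    {v : OrthonormalBasis (Fin n) ℝ (EuclideanSpace ℝ (Fin n))} (h : IsEigenSystem A lam v)
    (u : EuclideanSpace ℝ (Fin n)) :
    inner ℝ u (Matrix.toEuclideanLin A u) = ∑ i, lam i * inner ℝ (v i) u ^ 2 := by
  have h1 : Matrix.toEuclideanLin A u = ∑ i, inner ℝ (v i) u • lam i • v i := by
    conv_lhs => rw [← v.sum_repr' u]
    rw [map_sum]
    exact Finset.sum_congr rfl fun i _ => by rw [map_smul, h.2]
  rw [h1, inner_sum]
  refine Finset.sum_congr rfl fun i _ => ?_
  rw [inner_smul_right, inner_smul_right, real_inner_comm]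
  ring

lemma sum_inner_sq_eq_one (v : OrthonormalBasis (Fin n) ℝ (EuclideanSpace ℝ (Fin n)))
    {u : EuclideanSpace ℝ (Fin n)} (hu : ‖u‖ = 1) : ∑ i, inner ℝ (v i) u ^ 2 = 1 := by
  have := v.sum_sq_norm_inner_right u
  simpa [hu] using this

/-- Perturbation of a leading eigenvector under a spectral gap. -/
lemma exists_sign_norm_sub_le (hn : 0 < n) {A B : Matrix (Fin n) (Fin n) ℝ} {lam lam' : Fin n → ℝ}
    {v v' : OrthonormalBasis (Fin n) ℝ (EuclideanSpace ℝ (Fin n))} (hA : IsEigenSystem A lam v)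
    (hB : IsEigenSystem B lam' v') {c F : ℝ} (hc : 0 < c)
    (hgap : ∀ i : Fin n, i ≠ ⟨0, hn⟩ → c ≤ lam ⟨0, hn⟩ - lam i)
    (hF : ∀ u w : EuclideanSpace ℝ (Fin n),
      |inner ℝ u (Matrix.toEuclideanLin (B - A) w)| ≤ F * (‖u‖ * ‖w‖)) :
    ∃ w : EuclideanSpace ℝ (Fin n), (w = v ⟨0, hn⟩ ∨ w = -v ⟨0, hn⟩) ∧
      ‖v' ⟨0, hn⟩ - w‖ ≤ 4 * F / c := by
  set o : Fin n := ⟨0, hn⟩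
  obtain ⟨w, hw, hpos⟩ : ∃ w : EuclideanSpace ℝ (Fin n), (w = v o ∨ w = -v o) ∧
      0 ≤ inner ℝ w (v' o) := by
    rcases le_total 0 (inner ℝ (v o) (v' o) : ℝ) with h | h
    · exact ⟨v o, Or.inl rfl, h⟩
    · exact ⟨-v o, Or.inr rfl, by rw [inner_neg_left]; linarith⟩
  refine ⟨w, hw, ?_⟩
  set x := v' o
  have hx : ‖x‖ = 1 := v'.norm_eq_one o
  have hw1 : ‖w‖ = 1 := by
    rcases hw with rfl | rfl
    · exact v.norm_eq_one o
    · rw [norm_neg]; exact v.norm_eq_one o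
  have hsq : inner ℝ w x ^ 2 = inner ℝ (v o) x ^ 2 := by
    rcases hw with rfl | rfl
    · rfl
    · rw [inner_neg_left]; ring
  have hAw : inner ℝ w (Matrix.toEuclideanLin A w) = lam o := by
    have h1 : Matrix.toEuclideanLin A w = lam o • w := by
      rcases hw with rfl | rfl
      · exact hA.2 o
      · rw [map_neg, hA.2 o, smul_neg]
    rw [h1, inner_smul_right, real_inner_self_eq_norm_sq, hw1]
    ring
  have hBx : inner ℝ x (Matrix.toEuclideanLin B x) = lam' o := by
    rw [hB.2 o, inner_smul_right, real_inner_self_eq_norm_sq, hx]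
    ring
  -- Variational principle: `w` is a competitor for the largest eigenvalue of `B`.
  have hBw : inner ℝ w (Matrix.toEuclideanLin B w) ≤ lam' o := by
    rw [inner_toEuclideanLin_eq_sum hB]
    calc ∑ i, lam' i * inner ℝ (v' i) w ^ 2 ≤ ∑ i, lam' o * inner ℝ (v' i) w ^ 2 := by
          gcongr with i
          exact hB.1 (Fin.mk_le_of_le_val (Nat.zero_le _))
      _ = lam' o := by rw [← Finset.mul_sum, sum_inner_sq_eq_one v' hw1, mul_one]
  -- The gap makes the quadratic form of `A` drop in proportion to the mass of `x` outside the
  -- leading direction.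
  have hAx : c * (1 - inner ℝ w x ^ 2) ≤ lam o - inner ℝ x (Matrix.toEuclideanLin A x) := by
    rw [inner_toEuclideanLin_eq_sum hA, hsq]
    have h1 := sum_inner_sq_eq_one v hx
    have h2 : lam o = ∑ i, lam o * inner ℝ (v i) x ^ 2 := by rw [← Finset.mul_sum, h1, mul_one]
    have h3 : 1 - inner ℝ (v o) x ^ 2 = ∑ i ∈ Finset.univ.erase o, inner ℝ (v i) x ^ 2 := by
      rw [← h1, ← Finset.add_sum_erase _ _ (Finset.mem_univ o)]
      ring
    conv_rhs => rw [h2]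
    rw [h3, ← Finset.sum_sub_distrib, Finset.mul_sum,
      ← Finset.add_sum_erase (a := o) Finset.univ _ (Finset.mem_univ o), sub_self, zero_add]
    refine Finset.sum_le_sum fun i hi => ?_
    rw [← sub_mul]
    have := hgap i (Finset.ne_of_mem_erase hi)
    gcongr
  have hB' : ∀ y, Matrix.toEuclideanLin (B - A) y =
      Matrix.toEuclideanLin B y - Matrix.toEuclideanLin A y := fun y => by
    rw [map_sub, LinearMap.sub_apply]
  -- Optimality of `x` for `B` bounds this drop by the difference of the form `B - A` at `x` and
  -- `w`, which is linear in `x - w`. This yields a bound linear in `F` rather than of order `√F`.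
  have key : lam o - inner ℝ x (Matrix.toEuclideanLin A x) ≤ 2 * F * ‖x - w‖ := by
    have e1 : inner ℝ x (Matrix.toEuclideanLin (B - A) x) -
        inner ℝ w (Matrix.toEuclideanLin (B - A) w) =
        inner ℝ (x - w) (Matrix.toEuclideanLin (B - A) x) +
          inner ℝ w (Matrix.toEuclideanLin (B - A) (x - w)) := by
      rw [LinearMap.map_sub (Matrix.toEuclideanLin (B - A)) x w, inner_sub_left, inner_sub_right]
      ring
    have h1 := (le_abs_self _).trans (hF (x - w) x)
    have h2 := (le_abs_self _).trans (hF w (x - w))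
    rw [hx] at h1
    rw [hw1] at h2
    have h3 : lam o - inner ℝ x (Matrix.toEuclideanLin A x) ≤
        inner ℝ x (Matrix.toEuclideanLin (B - A) x) -
        inner ℝ w (Matrix.toEuclideanLin (B - A) w) := by
      rw [hB', hB', inner_sub_right, inner_sub_right, hAw, hBx]
      linarith
    linarith
  have hcs : inner ℝ w x ≤ 1 := by
    have := real_inner_le_norm w x
    rwa [hw1, hx, one_mul] at this
  have hnorm : ‖x - w‖ ^ 2 = 2 * (1 - inner ℝ w x) := by
    rw [norm_sub_sq_real, hx, hw1, real_inner_comm]; ring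
  -- The sign of `w` makes the inner product lie in `[0, 1]`, where it dominates its square.
  have hfin : c * ‖x - w‖ ^ 2 ≤ 4 * F * ‖x - w‖ := by
    rw [hnorm]
    have : 1 - inner ℝ w x ≤ 1 - inner ℝ w x ^ 2 := by nlinarith
    nlinarith
  -- If `x = w` there is nothing to divide by, but `0 ≤ F` is needed; it follows from `hF` at a unit
  -- vector.
  rcases (norm_nonneg (x - w)).eq_or_lt with h0 | h0
  · have := hF w w
    rw [hw1] at this
    have hF0 : 0 ≤ F := by linarith [abs_nonneg (inner ℝ w (Matrix.toEuclideanLin (B - A) w))]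
    rw [← h0]
    positivity
  · rw [le_div_iff₀ hc]
    have : c * ‖x - w‖ * ‖x - w‖ ≤ 4 * F * ‖x - w‖ := by rw [mul_assoc, ← sq]; exact hfin
    linarith [le_of_mul_le_mul_right this h0]

lemma inner_toEuclideanLin_eq (A : Matrix (Fin n) (Fin n) ℝ) (u w : EuclideanSpace ℝ (Fin n)) :
    inner ℝ u (Matrix.toEuclideanLin A w) = ∑ i, ∑ j, u i * w j * A i j := by
  simp only [PiLp.inner_apply, Matrix.toLpLin_apply, Matrix.mulVec, dotProduct]
  refine Finset.sum_congr rfl fun i _ => ?_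
  simp only [RCLike.inner_apply, conj_trivial, Finset.sum_mul]
  exact Finset.sum_congr rfl fun j _ => by ring

/-- The operator norm is at most the Frobenius norm, by Cauchy–Schwarz over pairs of indices. -/
lemma abs_inner_toEuclideanLin_le (A : Matrix (Fin n) (Fin n) ℝ) {F : ℝ} (hF0 : 0 ≤ F)
    (hF : ∑ i, ∑ j, A i j ^ 2 ≤ F ^ 2) (u w : EuclideanSpace ℝ (Fin n)) :
    |inner ℝ u (Matrix.toEuclideanLin A w)| ≤ F * (‖u‖ * ‖w‖) := by
  refine abs_le_of_sq_le_sq ?_ (by positivity)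
  rw [inner_toEuclideanLin_eq, ← Finset.sum_product']
  refine (Finset.sum_mul_sq_le_sq_mul_sq _ _ _).trans ?_
  rw [Finset.sum_product, Finset.sum_product]
  have e : ∑ i, ∑ j, (u i * w j) ^ 2 = ‖u‖ ^ 2 * ‖w‖ ^ 2 := by
    rw [EuclideanSpace.norm_sq_eq, EuclideanSpace.norm_sq_eq, Finset.sum_mul_sum]
    simp only [Real.norm_eq_abs, sq_abs, mul_pow]
  simp only at e ⊢
  rw [e]
  calc ‖u‖ ^ 2 * ‖w‖ ^ 2 * ∑ i, ∑ j, A i j ^ 2 ≤ ‖u‖ ^ 2 * ‖w‖ ^ 2 * F ^ 2 := by gcongr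
    _ = _ := by ring

/-- The sample covariance matrix in terms of centred second moments and the mean. -/
lemma sampleCov_apply (x : ℤ → EuclideanSpace ℝ (Fin n)) (c : EuclideanSpace ℝ (Fin n)) {T : ℕ}
    (hT : 0 < T) (i j : Fin n) :
    sampleCov x T i j = (T : ℝ)⁻¹ * ∑ t ∈ Finset.Ioc (0 : ℤ) T, (x t - c) i * (x t - c) j -
      segMean (fun t => x t - c) 0 T i * segMean (fun t => x t - c) 0 T j := by
  have hT' : (T : ℝ) ≠ 0 := by exact_mod_cast hT.ne'
  set z : ℤ → EuclideanSpace ℝ (Fin n) := fun t => x t - c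
  have h1 : ∀ t, x t - segMean x 0 T = z t - segMean z 0 T := fun t => by
    have := segMean_sub_const x c (a := 0) (b := T) (by exact_mod_cast hT)
    simp only [z]
    rw [this]
    abel
  have h2 : ∀ i, segMean z 0 T i = (T : ℝ)⁻¹ * ∑ t ∈ Finset.Ioc (0 : ℤ) T, z t i := fun i => by
    unfold segMean
    simp
  unfold sampleCov
  rw [Matrix.of_apply]
  have h1' : ∀ t i, (x t - segMean x 0 T) i = z t i - segMean z 0 T i := fun t i => by
    rw [h1]; rfl
  simp only [h1']
  have h3 : ∀ t, (z t i - segMean z 0 T i) * (z t j - segMean z 0 T j) =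
      z t i * z t j - segMean z 0 T j * z t i - segMean z 0 T i * z t j +
        segMean z 0 T i * segMean z 0 T j := fun t => by ring
  simp only [h3, Finset.sum_add_distrib, Finset.sum_sub_distrib, ← Finset.mul_sum,
    Finset.sum_const, Int.card_Ioc, sub_zero, Int.toNat_natCast, nsmul_eq_mul]
  have e1 : ∀ i, ∑ t ∈ Finset.Ioc (0 : ℤ) T, z t i = T * segMean z 0 T i := fun i => by
    rw [h2, mul_inv_cancel_left₀ hT']
  rw [e1, e1]
  field_simp
  ring

/-- The true order is `n / T`; `n / √T` suffices, since it matches the error of the second moments.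
-/
lemma norm_segMean_sq_le {z : ℤ → EuclideanSpace ℝ (Fin n)} {T : ℕ} (hT : 0 < T) {K : ℝ}
    (hK : 1 ≤ K) (hS : ‖∑ t ∈ Finset.Ioc (0 : ℤ) T, z t‖ ^ 4 ≤ (n : ℝ) ^ 2 * (T * (K * T))) :
    ‖segMean z 0 T‖ ^ 2 ≤ K * n / √T := by
  have hT' : (0 : ℝ) < T := by exact_mod_cast hT
  have hT1 : (1 : ℝ) ≤ T := by exact_mod_cast hT
  have h1 : ‖∑ t ∈ Finset.Ioc (0 : ℤ) T, z t‖ ^ 2 ≤ n * (K * T) := by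
    refine le_of_sq_le_sq ?_ (by positivity)
    calc _ = ‖∑ t ∈ Finset.Ioc (0 : ℤ) T, z t‖ ^ 4 := by ring
      _ ≤ _ := hS
      _ = (n : ℝ) ^ 2 * (K * T ^ 2) := by ring
      _ ≤ (n : ℝ) ^ 2 * (K ^ 2 * T ^ 2) := by
        have : K ≤ K ^ 2 := le_self_pow₀ hK (by norm_num)
        gcongr
      _ = _ := by ring
  have h2 : √(T : ℝ) ≤ T := by
    rw [Real.sqrt_le_left (by positivity)]
    nlinarith
  unfold segMean
  simp only [Int.cast_zero, sub_zero, Int.cast_natCast]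
  rw [norm_smul, norm_inv, Real.norm_of_nonneg hT'.le, mul_pow]
  calc ((T : ℝ)⁻¹) ^ 2 * ‖∑ t ∈ Finset.Ioc (0 : ℤ) T, z t‖ ^ 2 ≤ ((T : ℝ)⁻¹) ^ 2 * (n * (K * T)) := by
        gcongr
    _ = K * n / T := by field_simp
    _ ≤ _ := by
      have : 0 < √(T : ℝ) := Real.sqrt_pos.2 hT'
      gcongr

/-- The leading sample eigenvector is close to the leading population eigenvector. -/
lemma exists_sign_norm_sub_le_of_sampleCov (hn : 0 < n) {x : ℤ → EuclideanSpace ℝ (Fin n)}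
    {c : EuclideanSpace ℝ (Fin n)} {T : ℕ} (hT : 0 < T) {A : Matrix (Fin n) (Fin n) ℝ}
    {lam lam' : Fin n → ℝ} {v v' : OrthonormalBasis (Fin n) ℝ (EuclideanSpace ℝ (Fin n))}
    (hA : IsEigenSystem A lam v) (hB : IsEigenSystem (sampleCov x T) lam' v') {c₀ K : ℝ}
    (hc : 0 < c₀) (hK : 1 ≤ K) (hgap : ∀ i : Fin n, i ≠ ⟨0, hn⟩ → c₀ ≤ lam ⟨0, hn⟩ - lam i)
    (hS : ‖∑ t ∈ Finset.Ioc (0 : ℤ) T, (x t - c)‖ ^ 4 ≤ (n : ℝ) ^ 2 * (T * (K * T)))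
    (hG : ∑ i, ∑ j, (∑ t ∈ Finset.Ioc (0 : ℤ) T, ((x t - c) i * (x t - c) j - A i j)) ^ 2 ≤
      K * n ^ 2 * T) :
    ∃ w : EuclideanSpace ℝ (Fin n), (w = v ⟨0, hn⟩ ∨ w = -v ⟨0, hn⟩) ∧
      ‖v' ⟨0, hn⟩ - w‖ * √T ≤ 8 / c₀ * K * n := by
  have hT' : (0 : ℝ) < T := by exact_mod_cast hT
  have hsT : 0 < √(T : ℝ) := Real.sqrt_pos.2 hT'
  set z : ℤ → EuclideanSpace ℝ (Fin n) := fun t => x t - c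
  set G : Matrix (Fin n) (Fin n) ℝ := Matrix.of fun i j =>
    (T : ℝ)⁻¹ * ∑ t ∈ Finset.Ioc (0 : ℤ) T, (z t i * z t j - A i j) with hGdef
  have hmean := norm_segMean_sq_le hT hK hS
  have hGF : ∑ i, ∑ j, G i j ^ 2 ≤ (K * n / √T) ^ 2 := by
    have e1 : ∑ i, ∑ j, G i j ^ 2 = ((T : ℝ)⁻¹) ^ 2 *
        ∑ i, ∑ j, (∑ t ∈ Finset.Ioc (0 : ℤ) T, (z t i * z t j - A i j)) ^ 2 := by
      rw [Finset.mul_sum]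
      refine Finset.sum_congr rfl fun i _ => ?_
      rw [Finset.mul_sum]
      exact Finset.sum_congr rfl fun j _ => mul_pow _ _ _
    rw [e1]
    calc ((T : ℝ)⁻¹) ^ 2 * _ ≤ ((T : ℝ)⁻¹) ^ 2 * (K * n ^ 2 * T) := by gcongr
      _ = K * n ^ 2 / T := by field_simp
      _ ≤ K ^ 2 * n ^ 2 / T := by
        have : K ≤ K ^ 2 := le_self_pow₀ hK (by norm_num)
        gcongr
      _ = _ := by rw [div_pow, Real.sq_sqrt hT'.le]; ring
  have hdec : ∀ i j, (sampleCov x T - A) i j = G i j - segMean z 0 T i * segMean z 0 T j := by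
    intro i j
    rw [Matrix.sub_apply, sampleCov_apply x c hT]
    simp only [hGdef, Matrix.of_apply, Finset.sum_sub_distrib, Finset.sum_const, Int.card_Ioc,
      sub_zero, Int.toNat_natCast, nsmul_eq_mul, mul_sub]
    rw [inv_mul_cancel_left₀ hT'.ne']
    change _ - segMean z 0 T i * segMean z 0 T j - _ = _
    simp only [z]
    ring
  -- The 2 counts the centred second moments and the rank-one correction by the sample mean.
  obtain ⟨w, hw, hle⟩ := exists_sign_norm_sub_le hn hA hB hc hgap (F := 2 * (K * n / √T)) (by
    intro u w
    have e1 : inner ℝ u (Matrix.toEuclideanLin (sampleCov x T - A) w) =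
        inner ℝ u (Matrix.toEuclideanLin G w) - inner ℝ u (segMean z 0 T) * inner ℝ w (segMean z 0 T) := by
      have h1 : ∀ u : EuclideanSpace ℝ (Fin n), inner ℝ u (segMean z 0 T) =
          ∑ i, u i * segMean z 0 T i := fun u => by
        simp only [PiLp.inner_apply, RCLike.inner_apply, conj_trivial]
        exact Finset.sum_congr rfl fun i _ => mul_comm _ _
      rw [inner_toEuclideanLin_eq, inner_toEuclideanLin_eq, h1, h1, Finset.sum_mul_sum,
        ← Finset.sum_sub_distrib]
      refine Finset.sum_congr rfl fun i _ => ?_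
      rw [← Finset.sum_sub_distrib]
      refine Finset.sum_congr rfl fun j _ => ?_
      rw [hdec]
      ring
    rw [e1]
    refine (abs_sub _ _).trans ?_
    have a1 := abs_inner_toEuclideanLin_le G (by positivity) hGF u w
    have a2 : |inner ℝ u (segMean z 0 T) * inner ℝ w (segMean z 0 T)| ≤
        K * n / √T * (‖u‖ * ‖w‖) := by
      rw [abs_mul]
      calc _ ≤ (‖u‖ * ‖segMean z 0 T‖) * (‖w‖ * ‖segMean z 0 T‖) := by
            gcongr <;> exact abs_real_inner_le_norm _ _
        _ = ‖segMean z 0 T‖ ^ 2 * (‖u‖ * ‖w‖) := by ring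
        _ ≤ _ := by gcongr
    linarith)
  refine ⟨w, hw, ?_⟩
  calc _ ≤ 4 * (2 * (K * n / √T)) / c₀ * √T := by gcongr
    _ = _ := by field_simp; norm_num

end Spectral

/-! ### Canonical Bernoulli shifts and their coupling rates -/

/-- The Bernoulli shift of series `o`, on the space of innovations. -/
def shiftProc (g : Option ℕ → (ℕ → ℝ) → ℝ) (o : Option ℕ) (t : ℤ) (x : Innov) : ℝ :=
  g o fun j : ℕ => x o (t - (j : ℤ))

/-- Approximation rate of order `d ^ (-α)`, made antitone and equal to one at zero. -/
noncomputable def polyRate (α : ℝ) (d : ℕ) : ℝ≥0 := ((max 1 (d - 1) : ℕ) : ℝ≥0) ^ (-α)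

lemma polyRate_zero (α : ℝ) : polyRate α 0 = 1 := by simp [polyRate]

lemma polyRate_one (α : ℝ) : polyRate α 1 = 1 := by simp [polyRate]

lemma polyRate_antitone {α : ℝ} (hα : 0 ≤ α) : Antitone (polyRate α) := by
  intro d d' h
  refine NNReal.rpow_le_rpow_of_nonpos ?_ ?_ (by linarith)
  · have : 1 ≤ max 1 (d - 1) := le_max_left _ _
    exact_mod_cast this
  · have : max 1 (d - 1) ≤ max 1 (d' - 1) := by omega
    exact_mod_cast this

lemma summable_polyRate {α : ℝ} (hα : 1 < α) : Summable fun d => (polyRate α d : ℝ) := by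
  -- From index 2 on the rate is the pure power `(d - 1)^(-α)`.
  rw [← summable_nat_add_iff 2]
  have h := (summable_nat_add_iff 1).2 (Real.summable_nat_rpow.2 (show -α < -1 by linarith))
  refine h.congr fun d => ?_
  simp [polyRate]

section Law
variable {Ω : Type*} [MeasurableSpace Ω] {P : Measure Ω} [IsProbabilityMeasure P]

lemma measurable_shiftProc {g : Option ℕ → (ℕ → ℝ) → ℝ} (hg : ∀ o, Measurable (g o)) (o : Option ℕ)
    (t : ℤ) : Measurable (shiftProc g o t) := by
  have := hg o
  unfold shiftProc
  fun_prop

/-- Independent Bernoulli shifts have the joint law of their canonical versions. -/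
lemma map_path_eq {ε : Option ℕ → ℤ → Ω → ℝ} {ρ : Option ℕ → ProbabilityMeasure ℝ}
    {g : Option ℕ → (ℕ → ℝ) → ℝ} {ν : Option ℕ → ℤ → Ω → ℝ} (hg : ∀ o, Measurable (g o))
    (hν : ∀ o s, Measurable (ν o s)) (hi : ∀ o, iIndepFun (ν o) P)
    (hlaw : ∀ o s, P.map (ν o s) = (ρ o : Measure ℝ))
    (hε : ∀ o t ω, ε o t ω = g o (fun j : ℕ => ν o (t - (j : ℤ)) ω))
    (hind : iIndepFun (fun o ω t => ε o t ω) P) :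
    P.map (fun ω o t => ε o t ω) = (innovLaw ρ).map (fun x o t => shiftProc g o t x) := by
  have hεm : ∀ o t, Measurable (ε o t) := fun o t => by
    have : ε o t = fun ω => g o (fun j : ℕ => ν o (t - (j : ℤ)) ω) := funext fun ω => hε o t ω
    rw [this]
    have := hg o
    fun_prop
  have hgm : ∀ o, Measurable fun (x : ℤ → ℝ) (t : ℤ) => g o fun j : ℕ => x (t - j) := fun o => by
    have := hg o
    fun_prop
  -- The innovations of different series need not be jointly independent on `Ω`. Independence of the
  -- processes makes the path law a product, and each factor is determined by the law of its own
  -- innovations.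
  rw [hind.map_fun_eq_infinitePi_map fun o => measurable_pi_lambda _ (hεm o)]
  have h1 : ∀ o, P.map (fun ω t => ε o t ω) =
      (Measure.infinitePi fun _ : ℤ => (ρ o : Measure ℝ)).map
        fun (x : ℤ → ℝ) (t : ℤ) => g o fun j : ℕ => x (t - j) := by
    intro o
    have h2 := (hi o).map_fun_eq_infinitePi_map (hν o)
    simp only [hlaw] at h2
    rw [← h2, Measure.map_map (hgm o) (measurable_pi_lambda _ (hν o))]
    congr 1
    funext ω t
    simp [hε]
  simp only [h1]
  rw [← Measure.infinitePi_map_pi _ hgm]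
  rfl

end Law

/-- The processes `ε o` are independent centred Bernoulli shifts with uniformly bounded twelfth
moments and approximation rate `b`; their canonical versions are given by `g` and `ρ`. -/
structure IsShiftModel {Ω : Type*} [MeasurableSpace Ω] (P : Measure Ω) (ε : Option ℕ → ℤ → Ω → ℝ)
    (b : ℕ → ℝ≥0) (K : ℝ≥0) (ρ : Option ℕ → ProbabilityMeasure ℝ) (g : Option ℕ → (ℕ → ℝ) → ℝ) :
    Prop where
  meas_g : ∀ o, Measurable (g o)
  meas : ∀ o t, Measurable (ε o t)
  law : P.map (fun ω o t => ε o t ω) = (innovLaw ρ).map (fun x o t => shiftProc g o t x)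
  stable : ∀ o, Stable (innovLaw ρ) swapPast b 12 K (shiftProc g o)
  mean : ∀ o t, ∫ x, shiftProc g o t x ∂(innovLaw ρ) = 0

lemma shiftProc_timeShift (g : Option ℕ → (ℕ → ℝ) → ℝ) (o : Option ℕ) (t k : ℤ) (x : Innov) :
    shiftProc g o t (timeShift k x) = shiftProc g o (t + k) x := by
  simp only [shiftProc, timeShift]
  congr 1
  funext j
  congr 1
  ring

/-- Exchanging the innovations up to `c` keeps the `t - c` most recent ones, whereas `splice m`
keeps `m + 1`; hence `m = t - c - 1`. -/
lemma couple_shiftProc {ρ : Option ℕ → ProbabilityMeasure ℝ} {g : Option ℕ → (ℕ → ℝ) → ℝ}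
    (hg : ∀ o, Measurable (g o)) (o : Option ℕ) {p : ℕ} {c t : ℤ} (hct : c < t) :
    eLpNorm (fun x : Innov × Innov => shiftProc g o t x.1 - shiftProc g o t (swapPast c x).1) p
      ((innovLaw ρ).prod (innovLaw ρ)) = couplingError p (g o) (ρ o) ((t - c).toNat - 1) := by
  have hmp := (measurePreserving_reverse ρ o t).prod (measurePreserving_reverse ρ o t)
  have hgo := hg o
  have hsp : Measurable fun z : (ℕ → ℝ) × (ℕ → ℝ) => splice ((t - c).toNat - 1) z.1 z.2 := by
    unfold splice
    refine measurable_pi_lambda _ fun j => ?_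
    split_ifs <;> fun_prop
  have hm : Measurable fun z : (ℕ → ℝ) × (ℕ → ℝ) =>
      g o z.1 - g o (splice ((t - c).toNat - 1) z.1 z.2) :=
    (hgo.comp measurable_fst).sub (hgo.comp hsp)
  unfold couplingError
  rw [← eLpNorm_comp_measurePreserving' hmp hm]
  congr 1
  funext x
  simp only [shiftProc, swapPast, Prod.map]
  congr 2
  funext j
  simp only [splice]
  by_cases h : t - (j : ℤ) ≤ c
  · rw [if_pos h, if_neg (by omega)]
  · rw [if_neg h, if_pos (by omega)]

/-- Coupling rates and moments turn canonical Bernoulli shifts into stable processes. -/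
lemma stable_shiftProc {ρ : Option ℕ → ProbabilityMeasure ℝ} {g : Option ℕ → (ℕ → ℝ) → ℝ}
    (hg : ∀ o, Measurable (g o)) (o : Option ℕ) {p : ℕ} (hp : 1 ≤ p) {α : ℝ} {K : ℝ≥0}
    (h0 : eLpNorm (shiftProc g o 0) p (innovLaw ρ) ≤ K)
    (hc : ∀ m : ℕ, 1 ≤ m → couplingError p (g o) (ρ o) m ≤ (K * (m : ℝ≥0) ^ (-α) : ℝ≥0)) :
    Stable (innovLaw ρ) swapPast (polyRate α) p (2 * K) (shiftProc g o) := by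
  have hm := measurable_shiftProc hg o
  have hb : ∀ t, eLpNorm (shiftProc g o t) p (innovLaw ρ) ≤ K := by
    intro t
    rw [← eLpNorm_comp_measurePreserving' (measurePreserving_timeShift ρ t) (hm 0)] at h0
    simpa [shiftProc_timeShift] using h0
  refine ⟨hm, ?_, fun t => (hb t).trans ?_, ?_⟩
  · intro c t htc x
    simp only [shiftProc, swapPast]
    congr 1
    funext j
    rw [if_pos (by omega)]
  · rw [two_mul]
    exact_mod_cast le_self_add
  · intro c t hct
    -- Distance 1 corresponds to `m = 0`, where no rate is assumed. The triangle inequality gives `2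
    -- K`, which explains the constant.
    by_cases h1 : (t - c).toNat = 1
    · rw [h1, polyRate_one]
      have hs := measurePreserving_swapPast ρ c
      have e1 : eLpNorm (fun x : Innov × Innov => shiftProc g o t x.1) p
          ((innovLaw ρ).prod (innovLaw ρ)) ≤ K :=
        (eLpNorm_comp_measurePreserving' measurePreserving_fst (hm t) _).trans_le (hb t)
      have e2 : eLpNorm (fun x : Innov × Innov => shiftProc g o t (swapPast c x).1) p
          ((innovLaw ρ).prod (innovLaw ρ)) ≤ K :=
        (eLpNorm_comp_measurePreserving' (measurePreserving_fst.comp hs) (hm t) _).trans_le (hb t)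
      have hs' := hs.measurable
      have hmt := hm t
      refine (eLpNorm_sub_le (f := fun x : Innov × Innov => shiftProc g o t x.1)
        (g := fun x : Innov × Innov => shiftProc g o t (swapPast c x).1)
        (hmt.comp measurable_fst).aestronglyMeasurable
        (hmt.comp (measurable_fst.comp hs')).aestronglyMeasurable (by exact_mod_cast hp)).trans ?_
      refine (add_le_add e1 e2).trans (le_of_eq ?_)
      rw [mul_one, two_mul, ENNReal.coe_add]
    · rw [couple_shiftProc hg o hct]
      refine (hc _ (by omega)).trans ?_
      have : max 1 ((t - c).toNat - 1) = (t - c).toNat - 1 := by omega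
      rw [polyRate, this, mul_assoc, two_mul]
      exact_mod_cast le_self_add

/-- A common factor and idiosyncratic errors that are independent approximable Bernoulli shifts with
uniform rates and moments form a shift model. -/
lemma exists_isShiftModel {Ω : Type*} [MeasurableSpace Ω] {P : Measure Ω} [IsProbabilityMeasure P]
    {η : ℤ → Ω → ℝ} {e : ℕ → ℤ → Ω → ℝ} {χη : ℕ → ENNReal} {c₂ αη : ℝ} (hαη : 1 < αη)
    (hη : IsApproximableShift P 12 η χη)
    (hχη : ∀ m : ℕ, 1 ≤ m → χη m ≤ ENNReal.ofReal (c₂ * (m : ℝ) ^ (-αη)))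
    {χe : ℕ → ℕ → ENNReal} {c₃ αe : ℝ} (hαe : 1 < αe)
    (he : ∀ i, IsApproximableShift P 12 (e i) (χe i))
    (hχe : ∀ i m : ℕ, 1 ≤ m → χe i m ≤ ENNReal.ofReal (c₃ * (m : ℝ) ^ (-αe)))
    {c₆ : ℝ} (he_mom : ∀ i, ∫ ω, e i 0 ω ^ 12 ∂P ≤ c₆)
    (hindep : iIndepFun
      (fun (o : Option ℕ) (ω : Ω) (t : ℤ) => o.elim (η t ω) (fun i => e i t ω)) P) :
    ∃ (α : ℝ) (K : ℝ≥0) (ρ : Option ℕ → ProbabilityMeasure ℝ) (g : Option ℕ → (ℕ → ℝ) → ℝ),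
      1 < α ∧ IsShiftModel P (fun o t ω => o.elim (η t ω) fun i => e i t ω) (polyRate α) K ρ g := by
  set ε : Option ℕ → ℤ → Ω → ℝ := fun o t ω => o.elim (η t ω) fun i => e i t ω with hεdef
  set χ : Option ℕ → ℕ → ENNReal := fun o => o.elim χη χe with hχdef
  have hsh : ∀ o, IsApproximableShift P 12 (ε o) (χ o) := by
    rintro (_ | i)
    exacts [hη, he i]
  choose ρ ν g hg hν hi hlaw hε hmean hmem hcoup using hsh
  have hpath := map_path_eq hg hν hi hlaw hε hindep
  have hεm : ∀ o t, Measurable (ε o t) := fun o t => by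
    have : ε o t = fun ω => g o (fun j : ℕ => ν o (t - (j : ℤ)) ω) := funext fun ω => hε o t ω
    rw [this]
    have := hg o
    have := hν o
    fun_prop
  have hsm := measurable_shiftProc hg
  have hΨ : Measurable fun ω o t => ε o t ω := by fun_prop
  have hΨ' : Measurable fun (x : Innov) o t => shiftProc g o t x := by fun_prop
  have hnorm : ∀ o t, eLpNorm (shiftProc g o t) (12 : ℕ) (innovLaw ρ) =
      eLpNorm (ε o t) (12 : ℕ) P := by
    intro o t
    have hm : Measurable fun y : Innov => y o t := by fun_prop
    have h1 := eLpNorm_map_measure (p := ((12 : ℕ) : ℝ≥0∞)) (μ := P) hm.aestronglyMeasurable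
      hΨ.aemeasurable
    have h2 := eLpNorm_map_measure (p := ((12 : ℕ) : ℝ≥0∞)) (μ := innovLaw ρ)
      hm.aestronglyMeasurable hΨ'.aemeasurable
    rw [hpath] at h1
    exact h2.symm.trans h1
  -- The slower rate and one constant `K ≥ 1` serve the factor and all errors. `K ≥ 1` also lets the
  -- moment bound pass from `K` to `K ^ 12`.
  set α := min αη αe with hα
  have hα1 : 1 < α := lt_min hαη hαe
  set c : ℝ := max (∫ ω, η 0 ω ^ 12 ∂P) c₆ with hc
  set K : ℝ≥0 := max 1 (max c.toNNReal (max c₂.toNNReal c₃.toNNReal)) with hK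
  have hcK : c ≤ K := (Real.le_coe_toNNReal c).trans
    (by exact_mod_cast (le_max_left _ _).trans (le_max_right _ _))
  have h2K : c₂ ≤ K := (Real.le_coe_toNNReal c₂).trans (by
    exact_mod_cast (le_max_left _ _).trans ((le_max_right _ _).trans (le_max_right _ _)))
  have h3K : c₃ ≤ K := (Real.le_coe_toNNReal c₃).trans (by
    exact_mod_cast (le_max_right _ _).trans ((le_max_right _ _).trans (le_max_right _ _)))
  have hK1 : (1 : ℝ) ≤ K := by exact_mod_cast le_max_left _ _
  have hrate : ∀ {c' α' : ℝ}, c' ≤ K → α ≤ α' → ∀ m : ℕ, 1 ≤ m →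
      ENNReal.ofReal (c' * (m : ℝ) ^ (-α')) ≤ (K * (m : ℝ≥0) ^ (-α) : ℝ≥0) := by
    intro c' α' h1 h2 m hm
    have hm1 : (1 : ℝ) ≤ m := by exact_mod_cast hm
    rw [← ENNReal.ofReal_coe_nnreal]
    refine ENNReal.ofReal_le_ofReal ?_
    rw [NNReal.coe_mul, NNReal.coe_rpow, NNReal.coe_natCast]
    refine mul_le_mul h1 (Real.rpow_le_rpow_of_exponent_le hm1 (by linarith)) (by positivity)
      K.2
  refine ⟨α, 2 * K, ρ, g, hα1, hg, hεm, hpath, fun o => ?_, fun o t => ?_⟩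
  · have := stable_shiftProc (ρ := ρ) (p := 12) (K := K) (α := α) hg o (by norm_num) ?_ ?_
    · exact_mod_cast this
    · rw [hnorm]
      refine eLpNorm_le_of_integral_pow_le (by norm_num) (hmem o 0) ?_
      simp only [Even.pow_abs (by decide : Even 12)]
      refine le_trans ?_ (le_self_pow₀ hK1 (by norm_num))
      refine le_trans ?_ hcK
      rcases o with _ | i
      · exact le_max_left _ _
      · exact (he_mom i).trans (le_max_right _ _)
    · intro m hm
      rw [hcoup o m hm]
      rcases o with _ | i
      · exact (hχη m hm).trans (hrate h2K (min_le_left _ _) m hm)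
      · exact (hχe i m hm).trans (hrate h3K (min_le_right _ _) m hm)
  · have hm : Measurable fun y : Innov => y o t := by fun_prop
    have h1 := integral_map (μ := P) hΨ.aemeasurable hm.aestronglyMeasurable
    have h2 := integral_map (μ := innovLaw ρ) hΨ'.aemeasurable hm.aestronglyMeasurable
    rw [hpath] at h1
    rw [← h2, h1]
    exact hmean o t

/-! ### The centred panel as a functional of the paths -/

/-- The sample path of a family of processes. -/
def pathOf {Ω : Type*} (ε : Option ℕ → ℤ → Ω → ℝ) (ω : Ω) : Innov := fun o t => ε o t ω

/-- The centred cross-section at time `t` as a function of the path of factor and errors. -/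
noncomputable def panelDev (n : ℕ) (γ : ℕ → ℝ) (t : ℤ) (y : Innov) : EuclideanSpace ℝ (Fin n) :=
  WithLp.toLp 2 fun i : Fin n => γ i * y none t + y (some i) t

section PanelDev
variable {n : ℕ} {γ : ℕ → ℝ}

lemma panelDev_apply (t : ℤ) (y : Innov) (i : Fin n) :
    panelDev n γ t y i = γ i * y none t + y (some i) t := rfl

lemma inner_panelDev (v : EuclideanSpace ℝ (Fin n)) (t : ℤ) (y : Innov) :
    inner ℝ v (panelDev n γ t y) = ∑ i, v i * (γ i * y none t + y (some i) t) := by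
  rw [PiLp.inner_apply]
  exact Finset.sum_congr rfl fun i _ => by simp [panelDev, mul_comm]

lemma measurable_inner_panelDev (v : EuclideanSpace ℝ (Fin n)) (t : ℤ) :
    Measurable fun y => inner ℝ v (panelDev n γ t y) := by
  simp only [inner_panelDev]
  fun_prop

end PanelDev

lemma sum_abs_le_sqrt {n : ℕ} {v : EuclideanSpace ℝ (Fin n)} (hv : ‖v‖ = 1) :
    ∑ i, |v i| ≤ √n := by
  refine Real.le_sqrt_of_sq_le ?_
  have h1 := sq_sum_le_card_mul_sum_sq (s := Finset.univ) (f := fun i => |v i|)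
  have h2 := EuclideanSpace.norm_sq_eq v
  simp only [hv, Real.norm_eq_abs] at h2
  rw [← h2] at h1
  simpa using h1

instance : ENNReal.HolderTriple 12 12 6 :=
  ⟨by
    rw [show (12 : ℝ≥0∞) = 6 * 2 by norm_num, ENNReal.mul_inv (by norm_num) (by norm_num), ← mul_add,
      ENNReal.inv_two_add_inv_two, mul_one]⟩

/-! ### Transfer to the canonical model, and stability of projections -/

namespace IsShiftModel
variable {Ω : Type*} [MeasurableSpace Ω] {P : Measure Ω} [IsProbabilityMeasure P]
  {ε : Option ℕ → ℤ → Ω → ℝ} {b : ℕ → ℝ≥0} {K : ℝ≥0} {ρ : Option ℕ → ProbabilityMeasure ℝ}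
  {g : Option ℕ → (ℕ → ℝ) → ℝ} {n : ℕ} {γ : ℕ → ℝ}

lemma measurable_pathOf (h : IsShiftModel P ε b K ρ g) : Measurable (pathOf ε) := by
  have := h.meas
  unfold pathOf
  fun_prop

lemma measurable_canon (h : IsShiftModel P ε b K ρ g) : Measurable (pathOf (shiftProc g)) := by
  have := fun o => (h.stable o).meas
  unfold pathOf
  fun_prop

lemma map_pathOf (h : IsShiftModel P ε b K ρ g) :
    P.map (pathOf ε) = (innovLaw ρ).map (pathOf (shiftProc g)) := h.law

/-- Expectations of path functionals may be computed with the canonical processes. -/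
lemma integral_eq (h : IsShiftModel P ε b K ρ g) {F : Innov → ℝ} (hF : Measurable F) :
    ∫ ω, F (pathOf ε ω) ∂P = ∫ x, F (pathOf (shiftProc g) x) ∂(innovLaw ρ) := by
  rw [← integral_map h.measurable_pathOf.aemeasurable hF.aestronglyMeasurable,
    ← integral_map h.measurable_canon.aemeasurable hF.aestronglyMeasurable, h.map_pathOf]

lemma memLp (h : IsShiftModel P ε b K ρ g) {F : Innov → ℝ} (hF : Measurable F) {p : ℝ≥0∞}
    (hp : MemLp (fun x => F (pathOf (shiftProc g) x)) p (innovLaw ρ)) :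
    MemLp (fun ω => F (pathOf ε ω)) p P := by
  have h1 := (memLp_map_measure_iff (p := p) (μ := innovLaw ρ) hF.aestronglyMeasurable
    h.measurable_canon.aemeasurable).2 hp
  rw [← h.map_pathOf] at h1
  exact (memLp_map_measure_iff hF.aestronglyMeasurable h.measurable_pathOf.aemeasurable).1 h1

lemma covariance_eq (h : IsShiftModel P ε b K ρ g) {F G : Innov → ℝ} (hF : Measurable F)
    (hG : Measurable G) :
    cov[fun ω => F (pathOf ε ω), fun ω => G (pathOf ε ω); P] =
      cov[fun x => F (pathOf (shiftProc g) x), fun x => G (pathOf (shiftProc g) x);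
        innovLaw ρ] := by
  simp only [covariance, h.integral_eq hF, h.integral_eq hG]
  exact h.integral_eq (F := fun y => (F y - _) * (G y - _)) (by fun_prop)

lemma hσ (ρ : Option ℕ → ProbabilityMeasure ℝ) (c : ℤ) : Measurable (swapPast c) :=
  (measurePreserving_swapPast ρ c).measurable

lemma stable_coord (h : IsShiftModel P ε b K ρ g) {c : ℝ≥0} {i : ℕ} (hγ : |γ i| ≤ c) :
    Stable (innovLaw ρ) swapPast b 12 ((c + 1) * K)
      (fun t x => γ i * shiftProc g none t x + shiftProc g (some i) t x) := by
  have := ((h.stable none).const_mul (γ i)).add (hσ ρ) (by norm_num) (h.stable (some i))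
  refine this.mono_const ?_
  rw [add_mul, one_mul]
  gcongr
  rw [← NNReal.coe_le_coe]
  simpa using hγ

/-- Only the triangle inequality and `∑ |vᵢ| ≤ √n` are used. The constant grows with the dimension,
which the bandwidth condition can afford; `stable_idiosyncratic` gives a sharper bound for the
errors. -/
lemma stable_inner (h : IsShiftModel P ε b K ρ g) {c : ℝ≥0} (hγ : ∀ i < n, |γ i| ≤ c)
    {v : EuclideanSpace ℝ (Fin n)} (hv : ‖v‖ = 1) :
    Stable (innovLaw ρ) swapPast b 12 (NNReal.sqrt n * ((c + 1) * K))
      (fun t x => inner ℝ v (panelDev n γ t (pathOf (shiftProc g) x))) := by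
  simp only [inner_panelDev]
  have := Stable.sum (hσ ρ) (by norm_num) Finset.univ
    (fun (i : Fin n) _ => (h.stable_coord (γ := γ) (hγ i i.2)).const_mul (v i))
  refine this.mono_const ?_
  rw [← Finset.sum_mul]
  gcongr
  rw [← NNReal.coe_le_coe]
  simpa using sum_abs_le_sqrt hv

lemma stable_inner_sq (h : IsShiftModel P ε b K ρ g) {c : ℝ≥0} (hγ : ∀ i < n, |γ i| ≤ c)
    {v : EuclideanSpace ℝ (Fin n)} (hv : ‖v‖ = 1) :
    Stable (innovLaw ρ) swapPast b 6 (2 * n * ((c + 1) * K) ^ 2)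
      (fun t x => inner ℝ v (panelDev n γ t (pathOf (shiftProc g) x)) ^ 2) := by
  have h1 := h.stable_inner hγ hv
  have h2 := h1.mul (r := 6) (by norm_num) (measurePreserving_swapPast ρ) h1
  simp only [← pow_two] at h2
  refine h2.mono_const (le_of_eq ?_)
  rw [mul_pow, NNReal.sq_sqrt]
  ring

lemma stable_centred_sq (h : IsShiftModel P ε b K ρ g) {c : ℝ≥0} (hγ : ∀ i < n, |γ i| ≤ c)
    {v : EuclideanSpace ℝ (Fin n)} (hv : ‖v‖ = 1) :
    Stable (innovLaw ρ) swapPast b 6 (4 * n * ((c + 1) * K) ^ 2)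
      (fun t x => inner ℝ v (panelDev n γ t (pathOf (shiftProc g) x)) ^ 2 -
        ∫ z, inner ℝ v (panelDev n γ t (pathOf (shiftProc g) z)) ^ 2 ∂(innovLaw ρ)) := by
  have h1 := h.stable_inner_sq hγ hv
  have h2 := h1.mono_exponent (hσ ρ) (q := 2) (by norm_num)
  exact (h1.sub_const (by norm_num) fun t => h2.abs_integral_le_two t).mono_const
    (le_of_eq (by ring))

/-- Joint stationarity of path functionals. -/
lemma integral_shift_eq (h : IsShiftModel P ε b K ρ g) {F : Innov → ℝ} (hF : Measurable F) (k : ℤ) :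
    ∫ x, F (fun o t => shiftProc g o (t + k) x) ∂(innovLaw ρ) =
      ∫ x, F (pathOf (shiftProc g) x) ∂(innovLaw ρ) := by
  have hc := h.measurable_canon
  rw [← integral_comp_measurePreserving (measurePreserving_timeShift ρ k)
    (f := fun x => F (pathOf (shiftProc g) x)) (by fun_prop)]
  congr 1
  funext x
  congr 1
  funext o t
  exact (shiftProc_timeShift g o t k x).symm

end IsShiftModel

/-- `f` is dominated by an integrable function with integral at most `C`. -/
def HasMeanBound {Ω : Type*} [MeasurableSpace Ω] (P : Measure Ω) (C : ℝ) (p : ℝ → Ω → Prop) : Prop :=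
  ∃ V : Ω → ℝ, (∀ ω, 0 ≤ V ω) ∧ Integrable V P ∧ ∫ ω, V ω ∂P ≤ C ∧ ∀ ω, p (V ω) ω

/-! ### Random variables of bounded mean controlling the sample quantities -/

namespace IsShiftModel
variable {Ω : Type*} [MeasurableSpace Ω] {P : Measure Ω} [IsProbabilityMeasure P]
  {ε : Option ℕ → ℤ → Ω → ℝ} {b : ℕ → ℝ≥0} {K κ : ℝ≥0} {ρ : Option ℕ → ProbabilityMeasure ℝ}
  {g : Option ℕ → (ℕ → ℝ) → ℝ} {n : ℕ} {γ : ℕ → ℝ}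

lemma integral_sum_sq_le (h : IsShiftModel P ε b K ρ g) (hb : 1 ≤ b 0)
    (hbs : Summable fun d => (b d : ℝ)) {U : ℤ → Innov → ℝ} (hU : ∀ t, Measurable (U t))
    (hS : Stable (innovLaw ρ) swapPast b 2 κ fun t x => U t (pathOf (shiftProc g) x))
    (I : Finset ℤ) :
    ∫ ω, (∑ t ∈ I, (U t (pathOf ε ω) - ∫ ω', U t (pathOf ε ω') ∂P)) ^ 2 ∂P ≤
      I.card * (4 * κ ^ 2 * ∑' d, (b d : ℝ)) := by
  simp only [h.integral_eq (hU _)]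
  rw [h.integral_eq (F := fun y =>
    (∑ t ∈ I, (U t y - ∫ x, U t (pathOf (shiftProc g) x) ∂(innovLaw ρ))) ^ 2) (by fun_prop)]
  exact hS.integral_sum_sq_le (measurePreserving_swapPast ρ) hb hbs I

lemma integrable_sum_sub_sq (h : IsShiftModel P ε b K ρ g) {U : ℤ → Innov → ℝ}
    (hU : ∀ t, Measurable (U t))
    (hS : ∀ t, MemLp (fun x => U t (pathOf (shiftProc g) x)) 2 (innovLaw ρ))
    (I : Finset ℤ) (c : ℤ → ℝ) :
    Integrable (fun ω => (∑ t ∈ I, (U t (pathOf ε ω) - c t)) ^ 2) P :=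
  MemLp.integrable_sq (memLp_finsetSum I fun t _ => (h.memLp (hU t) (hS t)).sub (memLp_const _))

lemma integral_lagged_sum_sq_le (h : IsShiftModel P ε b K ρ g) (hb : 1 ≤ b 0) (hanti : Antitone b)
    (hbs : Summable fun d => (b d : ℝ)) {U : ℤ → Innov → ℝ} (hU : ∀ t, Measurable (U t))
    (hS : Stable (innovLaw ρ) swapPast b 4 κ fun t x => U t (pathOf (shiftProc g) x))
    (h0 : ∀ t, ∫ x, U t (pathOf (shiftProc g) x) ∂(innovLaw ρ) = 0) (s : ℕ) (I : Finset ℤ) :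
    ∫ ω, (∑ t ∈ I, (U t (pathOf ε ω) * U (t + s) (pathOf ε ω) -
        ∫ ω', U t (pathOf ε ω') * U (t + s) (pathOf ε ω') ∂P)) ^ 2 ∂P ≤
      I.card * (48 * κ ^ 4 * b 0 * ∑' d, (b d : ℝ)) := by
  have hUU : ∀ t, Measurable fun y => U t y * U (t + s) y := fun t => (hU t).mul (hU _)
  simp only [h.integral_eq (hUU _)]
  rw [h.integral_eq (F := fun y => (∑ t ∈ I, (U t y * U (t + s) y -
    ∫ x, U t (pathOf (shiftProc g) x) * U (t + s) (pathOf (shiftProc g) x) ∂(innovLaw ρ))) ^ 2)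
    (by fun_prop)]
  exact hS.integral_lagged_sum_sq_le (measurePreserving_swapPast ρ) hb hanti hbs h0 s I

lemma integrable_block_pow_four (h : IsShiftModel P ε b K ρ g) {U : ℤ → Innov → ℝ}
    (hU : ∀ t, Measurable (U t))
    (hS : ∀ t, MemLp (fun x => U t (pathOf (shiftProc g) x)) 4 (innovLaw ρ)) (I : Finset ℤ) :
    Integrable (fun ω => (∑ t ∈ I, U t (pathOf ε ω)) ^ 4) P := by
  have := (memLp_finsetSum I fun t _ => h.memLp (hU t) (hS t)).integrable_norm_pow (p := 4)
    (by norm_num)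
  refine this.congr (ae_of_all _ fun x => ?_)
  simp [Even.pow_abs (by decide : Even 4)]

lemma integral_block_pow_four_le (h : IsShiftModel P ε b K ρ g) (hb : 1 ≤ b 0)
    (hbs : Summable fun d => (b d : ℝ)) {U : ℤ → Innov → ℝ} (hU : ∀ t, Measurable (U t))
    (hS : Stable (innovLaw ρ) swapPast b 4 κ fun t x => U t (pathOf (shiftProc g) x))
    (h0 : ∀ t, ∫ x, U t (pathOf (shiftProc g) x) ∂(innovLaw ρ) = 0) (r : ℕ) (a : ℤ) :
    ∫ ω, (∑ t ∈ Finset.Ioc a (a + 2 ^ r), U t (pathOf ε ω)) ^ 4 ∂P ≤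
      (144 * κ ^ 4 * (∑' d, (b d : ℝ)) ^ 2 + 512 * κ ^ 4 * (∑' d, (b d : ℝ)) ^ 4 + κ ^ 4) *
        (4 : ℝ) ^ r := by
  rw [h.integral_eq (F := fun y => (∑ t ∈ Finset.Ioc a (a + 2 ^ r), U t y) ^ 4) (by fun_prop)]
  exact hS.integral_block_pow_four_le (measurePreserving_swapPast ρ) hb hbs h0 r a

lemma measurable_coord (i : ℕ) (t : ℤ) :
    Measurable fun y : Innov => γ i * y none t + y (some i) t := by fun_prop

lemma integral_coord (h : IsShiftModel P ε b K ρ g) (i : ℕ) (t : ℤ) :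
    ∫ x, (γ i * pathOf (shiftProc g) x none t + pathOf (shiftProc g) x (some i) t) ∂(innovLaw ρ) =
      0 := by
  simp only [pathOf]
  have hi : ∀ o, Integrable (shiftProc g o t) (innovLaw ρ) := fun o =>
    ((h.stable o).memLp t).integrable (by norm_num)
  rw [integral_add ((hi none).const_mul _) (hi (some i)), integral_const_mul, h.mean, h.mean]
  simp

/-- By the power mean inequality `(‖Z‖ / √n)¹²` is at most the average of the `Zᵢ¹²`, so the bound
does not depend on the dimension. -/
lemma hasMeanBound_sum_norm_pow (h : IsShiftModel P ε b K ρ g) (hn : 0 < n) {c : ℝ≥0}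
    (hγ : ∀ i < n, |γ i| ≤ c) {T : ℕ} (hT : 0 < T) :
    HasMeanBound P (2048 * (1 + (((c + 1) * K : ℝ≥0) : ℝ) ^ 12)) fun V ω =>
      ∑ t ∈ Finset.Ioc (0 : ℤ) T, (1 + ‖panelDev n γ t (pathOf ε ω)‖ / √n) ^ 12 ≤ V * T := by
  set κ : ℝ≥0 := (c + 1) * K with hκ
  have hn' : (0 : ℝ) < n := by exact_mod_cast hn
  have hT' : (0 : ℝ) < T := by exact_mod_cast hT
  let Z : Fin n → ℤ → Ω → ℝ := fun i t ω => γ i * pathOf ε ω none t + pathOf ε ω (some i) t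
  have hZ12 : ∀ (i : Fin n) t, MemLp (fun x => γ i * pathOf (shiftProc g) x none t +
      pathOf (shiftProc g) x (some i) t) 12 (innovLaw ρ) := fun i t =>
    (h.stable_coord (hγ i i.2)).memLp t
  have hint : ∀ i t, Integrable (fun ω => Z i t ω ^ 12) P := fun i t => by
    have := (h.memLp (measurable_coord (i : ℕ) t) (hZ12 i t)).integrable_norm_pow (p := 12)
      (by norm_num)
    refine this.congr (ae_of_all _ fun x => ?_)
    simp [Even.pow_abs (by decide : Even 12), Z]
  have hmean : ∀ i t, ∫ ω, Z i t ω ^ 12 ∂P ≤ κ ^ 12 := fun i t => by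
    rw [h.integral_eq (F := fun y => (γ i * y none t + y (some i) t) ^ 12) (by fun_prop)]
    have := integral_pow_le_of_eLpNorm_le (n := 12) (by norm_num)
      ((h.stable_coord (hγ i i.2)).meas t) ((h.stable_coord (hγ i i.2)).bound t)
    simpa only [Even.pow_abs (by decide : Even 12), pathOf] using this
  have hint' : ∀ t, Integrable (fun ω => 2048 * (1 + (n : ℝ)⁻¹ * ∑ i, Z i t ω ^ 12)) P := fun t =>
    ((integrable_const _).add
      ((integrable_finsetSum _ fun i _ => hint i t).const_mul _)).const_mul _
  refine ⟨fun ω => (T : ℝ)⁻¹ * ∑ t ∈ Finset.Ioc (0 : ℤ) T,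
    2048 * (1 + (n : ℝ)⁻¹ * ∑ i, Z i t ω ^ 12), fun ω => ?_, ?_, ?_, fun ω => ?_⟩
  · have : ∀ i t, 0 ≤ Z i t ω ^ 12 := fun i t => Even.pow_nonneg (by decide) _
    have : ∀ t, 0 ≤ ∑ i, Z i t ω ^ 12 := fun t => Finset.sum_nonneg fun i _ => this i t
    refine mul_nonneg (by positivity) (Finset.sum_nonneg fun t _ => ?_)
    have := this t
    positivity
  · exact (integrable_finsetSum _ fun t _ => hint' t).const_mul _
  · rw [integral_const_mul, integral_finsetSum _ fun t _ => hint' t]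
    have : ∀ t ∈ Finset.Ioc (0 : ℤ) T, ∫ ω, 2048 * (1 + (n : ℝ)⁻¹ * ∑ i, Z i t ω ^ 12) ∂P ≤
        2048 * (1 + (κ : ℝ) ^ 12) := by
      intro t _
      rw [integral_const_mul, integral_add (integrable_const _)
        ((integrable_finsetSum _ fun i _ => hint i t).const_mul _), integral_const_mul,
        integral_finsetSum _ fun i _ => hint i t]
      have h1 : ∑ i, ∫ ω, Z i t ω ^ 12 ∂P ≤ n * (κ : ℝ) ^ 12 := by
        refine (Finset.sum_le_sum fun i _ => hmean i t).trans (le_of_eq ?_)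
        simp
      have h2 : (n : ℝ)⁻¹ * ∑ i, ∫ ω, Z i t ω ^ 12 ∂P ≤ (κ : ℝ) ^ 12 := by
        rw [inv_mul_le_iff₀ hn']
        exact h1
      simp only [integral_const, probReal_univ, smul_eq_mul, one_mul]
      linarith
    refine (mul_le_mul_of_nonneg_left (Finset.sum_le_sum this) (by positivity)).trans (le_of_eq ?_)
    simp
    field_simp
  · beta_reduce
    rw [mul_comm _ (T : ℝ), ← mul_assoc, mul_inv_cancel₀ hT'.ne', one_mul]
    refine Finset.sum_le_sum fun t _ => ?_
    have h1 := add_pow_twelve_le (x := 1) (y := ‖panelDev n γ t (pathOf ε ω)‖ / √n) zero_le_one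
      (by positivity)
    refine h1.trans ?_
    rw [one_pow]
    gcongr
    have h3 : ‖panelDev n γ t (pathOf ε ω)‖ ^ 12 ≤ (n : ℝ) ^ 5 * ∑ i, Z i t ω ^ 12 := by
      have e1 : ‖panelDev n γ t (pathOf ε ω)‖ ^ 12 = (∑ i, Z i t ω ^ 2) ^ 6 := by
        rw [show 12 = 2 * 6 from rfl, pow_mul, EuclideanSpace.norm_sq_eq]
        simp [panelDev_apply, Z]
      rw [e1]
      have h6 := pow_sum_div_card_le_sum_pow (s := (Finset.univ : Finset (Fin n)))
        (f := fun i => Z i t ω ^ 2) (fun i _ => by positivity) 5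
      rw [div_le_iff₀ (by simpa using pow_pos hn' 5)] at h6
      refine h6.trans (le_of_eq ?_)
      simp [← pow_mul, mul_comm]
    rw [div_pow, show √(n : ℝ) ^ 12 = (√n ^ 2) ^ 6 by ring, Real.sq_sqrt hn'.le,
      div_le_iff₀ (by positivity)]
    refine h3.trans (le_of_eq ?_)
    field_simp

lemma stable_pathCoord (h : IsShiftModel P ε b K ρ g) {c : ℝ≥0} {i : ℕ} (hγ : |γ i| ≤ c) :
    Stable (innovLaw ρ) swapPast b 12 ((c + 1) * K) fun t x =>
      (fun y : Innov => γ i * y none t + y (some i) t) (pathOf (shiftProc g) x) :=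
  h.stable_coord hγ

lemma norm_sum_panelDev_pow_four_le (I : Finset ℤ) (y : Innov) :
    ‖∑ t ∈ I, panelDev n γ t y‖ ^ 4 ≤
      n * ∑ i : Fin n, (∑ t ∈ I, (γ i * y none t + y (some i) t)) ^ 4 := by
  have e1 : ‖∑ t ∈ I, panelDev n γ t y‖ ^ 4 =
      (∑ i : Fin n, (∑ t ∈ I, (γ i * y none t + y (some i) t)) ^ 2) ^ 2 := by
    rw [show 4 = 2 * 2 from rfl, pow_mul, EuclideanSpace.norm_sq_eq]
    simp [panelDev_apply]
  rw [e1]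
  refine (sq_sum_le_card_mul_sum_sq (s := Finset.univ)).trans (le_of_eq ?_)
  simp [← pow_mul]

/-- Constant in the bound for fourth moments of partial sums. -/
noncomputable def partialSumConst (κ B : ℝ) : ℝ :=
  144 * κ ^ 4 * B ^ 2 + 512 * κ ^ 4 * B ^ 4 + κ ^ 4

/-- Uniformity in `l` is the point: it covers every break date. The lower and upper ends of the
sample are treated separately, since either segment may be short. -/
lemma hasMeanBound_norm_sum (h : IsShiftModel P ε b K ρ g) (hb : 1 ≤ b 0)
    (hbs : Summable fun d => (b d : ℝ)) (hn : 0 < n) {c : ℝ≥0}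
    (hγ : ∀ i < n, |γ i| ≤ c) {T : ℕ} (hT : 0 < T) :
    HasMeanBound P (4096 * partialSumConst ((c + 1) * K : ℝ≥0) (∑' d, (b d : ℝ))) (fun V ω =>
      ∀ l : ℕ, 1 ≤ l → l ≤ T → ‖∑ t ∈ Finset.Ioc (0 : ℤ) l, panelDev n γ t (pathOf ε ω)‖ ^ 4 ≤
        (n : ℝ) ^ 2 * (l * (V * T))) ∧
    HasMeanBound P (4096 * partialSumConst ((c + 1) * K : ℝ≥0) (∑' d, (b d : ℝ))) (fun V ω =>
      ∀ l : ℕ, 1 ≤ l → l ≤ T → ‖∑ t ∈ Finset.Ioc (T - l : ℤ) T, panelDev n γ t (pathOf ε ω)‖ ^ 4 ≤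
        (n : ℝ) ^ 2 * (l * (V * T))) := by
  have hn' : (0 : ℝ) < n := by exact_mod_cast hn
  have hm : ∀ (i : ℕ) (t : ℤ), Measurable fun y : Innov => γ i * y none t + y (some i) t :=
    measurable_coord
  have hst : ∀ i : Fin n, Stable (innovLaw ρ) swapPast b 4 ((c + 1) * K) fun t x =>
      (fun y : Innov => γ i * y none t + y (some i) t) (pathOf (shiftProc g) x) := fun i =>
    (h.stable_pathCoord (hγ i i.2)).mono_exponent (hσ ρ) (by norm_num)
  have hint := fun (i : Fin n) (r : ℕ) (a : ℤ) => h.integrable_block_pow_four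
    (hm i) (fun t => (hst i).memLp t) (Finset.Ioc a (a + 2 ^ r))
  have hC := fun (i : Fin n) => h.integral_block_pow_four_le hb hbs (hm i) (hst i)
    (h.integral_coord i)
  have hB : 0 ≤ ∑' d, (b d : ℝ) := tsum_nonneg fun d => (b d).2
  have hC0 : 0 ≤ partialSumConst ((c + 1) * K : ℝ≥0) (∑' d, (b d : ℝ)) := by
    unfold partialSumConst
    positivity
  -- Averaging the dominating variables of the coordinates; Cauchy–Schwarz supplies the factor `n²`.
  have key : ∀ (I : ℕ → Finset ℤ), (∀ i : Fin n, ∃ V : Ω → ℝ, (∀ x, 0 ≤ V x) ∧ Integrable V P ∧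
      ∫ x, V x ∂P ≤ 4096 * partialSumConst ((c + 1) * K : ℝ≥0) (∑' d, (b d : ℝ)) ∧
      ∀ x, ∀ k : ℕ, 1 ≤ k → k ≤ T → (∑ t ∈ I k, (γ i * pathOf ε x none t +
        pathOf ε x (some i) t)) ^ 4 ≤ k * T * V x) →
      HasMeanBound P (4096 * partialSumConst ((c + 1) * K : ℝ≥0) (∑' d, (b d : ℝ))) (fun V ω =>
      ∀ l : ℕ, 1 ≤ l → l ≤ T → ‖∑ t ∈ I l, panelDev n γ t (pathOf ε ω)‖ ^ 4 ≤
        (n : ℝ) ^ 2 * (l * (V * T))) := by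
    intro I hI
    choose V hV0 hVi hVC hV using hI
    refine ⟨fun ω => (n : ℝ)⁻¹ * ∑ i, V i ω, fun ω => ?_, ?_, ?_, fun ω l h1 h2 => ?_⟩
    · have := Finset.sum_nonneg fun i (_ : i ∈ Finset.univ) => hV0 i ω
      positivity
    · exact (integrable_finsetSum _ fun i _ => hVi i).const_mul _
    · rw [integral_const_mul, integral_finsetSum _ fun i _ => hVi i, inv_mul_le_iff₀ hn']
      refine (Finset.sum_le_sum fun i _ => hVC i).trans (le_of_eq ?_)
      simp
    · refine (norm_sum_panelDev_pow_four_le _ _).trans ?_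
      have : ∑ i : Fin n, (∑ t ∈ I l, (γ i * pathOf ε ω none t + pathOf ε ω (some i) t)) ^ 4 ≤
          ∑ i, l * T * V i ω := Finset.sum_le_sum fun i _ => hV i ω l h1 h2
      refine (mul_le_mul_of_nonneg_left this hn'.le).trans (le_of_eq ?_)
      rw [← Finset.mul_sum]
      field_simp
  exact ⟨key (fun l => Finset.Ioc 0 l) fun i => exists_dominating_sums (hint i) (hC i) hC0 T hT,
    key (fun l => Finset.Ioc (T - l) T) fun i =>
      exists_dominating_tail_sums (hint i) (hC i) hC0 T hT⟩

lemma integral_coord_mul (h : IsShiftModel P ε b K ρ g) (i j : ℕ) (t : ℤ) :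
    ∫ ω, (γ i * pathOf ε ω none t + pathOf ε ω (some i) t) *
        (γ j * pathOf ε ω none t + pathOf ε ω (some j) t) ∂P =
      ∫ ω, (γ i * pathOf ε ω none 0 + pathOf ε ω (some i) 0) *
        (γ j * pathOf ε ω none 0 + pathOf ε ω (some j) 0) ∂P := by
  have hF : ∀ t, Measurable fun y : Innov => (γ i * y none t + y (some i) t) *
      (γ j * y none t + y (some j) t) := fun t => by fun_prop
  rw [h.integral_eq (hF t), h.integral_eq (hF 0), ← h.integral_shift_eq (hF 0) t]
  simp [pathOf]

/-- Products of coordinates are stable, so each entry has variance of order `T`. There are `n²`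
entries, and this is the squared Frobenius norm used for the eigenvector. -/
lemma hasMeanBound_gram (h : IsShiftModel P ε b K ρ g) (hb : 1 ≤ b 0)
    (hbs : Summable fun d => (b d : ℝ)) (hn : 0 < n) {c : ℝ≥0}
    (hγ : ∀ i < n, |γ i| ≤ c) {T : ℕ} (hT : 0 < T) :
    HasMeanBound P (16 * (((c + 1) * K : ℝ≥0) : ℝ) ^ 4 * ∑' d, (b d : ℝ)) fun V ω =>
      ∑ i : Fin n, ∑ j : Fin n, (∑ t ∈ Finset.Ioc (0 : ℤ) T,
        (panelDev n γ t (pathOf ε ω) i * panelDev n γ t (pathOf ε ω) j -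
          ∫ ω', panelDev n γ 0 (pathOf ε ω') i * panelDev n γ 0 (pathOf ε ω') j ∂P)) ^ 2 ≤
        V * n ^ 2 * T := by
  have hn' : (0 : ℝ) < n := by exact_mod_cast hn
  have hT' : (0 : ℝ) < T := by exact_mod_cast hT
  set κ : ℝ≥0 := (c + 1) * K
  have hU : ∀ (i j : Fin n) (t : ℤ), Measurable fun y : Innov =>
      (γ i * y none t + y (some i) t) * (γ j * y none t + y (some j) t) := fun i j t => by fun_prop
  have hst : ∀ i j : Fin n, Stable (innovLaw ρ) swapPast b 2 (2 * (κ * κ)) fun t x =>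
      (fun y : Innov => (γ i * y none t + y (some i) t) * (γ j * y none t + y (some j) t))
        (pathOf (shiftProc g) x) := fun i j =>
    ((h.stable_pathCoord (hγ i i.2)).mul (r := 6) (by norm_num) (measurePreserving_swapPast ρ)
      (h.stable_pathCoord (hγ j j.2))).mono_exponent (hσ ρ) (by norm_num)
  have hle := fun i j => h.integral_sum_sq_le hb hbs (hU i j) (hst i j) (Finset.Ioc (0 : ℤ) T)
  simp only [h.integral_coord_mul] at hle
  have hi := fun (i j : Fin n) => h.integrable_sum_sub_sq (hU i j) (fun t => (hst i j).memLp t)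
    (Finset.Ioc (0 : ℤ) T) fun _ => ∫ ω, (γ i * pathOf ε ω none 0 + pathOf ε ω (some i) 0) *
        (γ j * pathOf ε ω none 0 + pathOf ε ω (some j) 0) ∂P
  simp only [panelDev_apply]
  refine ⟨fun ω => ((n : ℝ) ^ 2 * T)⁻¹ * ∑ i : Fin n, ∑ j : Fin n, (∑ t ∈ Finset.Ioc (0 : ℤ) T,
    ((γ i * pathOf ε ω none t + pathOf ε ω (some i) t) *
        (γ j * pathOf ε ω none t + pathOf ε ω (some j) t) -
      ∫ ω', (γ i * pathOf ε ω' none 0 + pathOf ε ω' (some i) 0) *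
        (γ j * pathOf ε ω' none 0 + pathOf ε ω' (some j) 0) ∂P)) ^ 2, fun ω => by positivity, ?_, ?_,
    fun ω => le_of_eq ?_⟩
  · exact (integrable_finsetSum _ fun i _ => integrable_finsetSum _ fun j _ => hi i j).const_mul _
  · rw [integral_const_mul, integral_finsetSum _ fun i _ =>
      integrable_finsetSum _ fun j _ => hi i j, inv_mul_le_iff₀ (by positivity)]
    simp only [integral_finsetSum _ fun j _ => hi _ j]
    refine (Finset.sum_le_sum fun i _ => Finset.sum_le_sum fun j _ => hle i j).trans (le_of_eq ?_)
    simp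
    ring
  · have e : ∀ S : ℝ, ((n : ℝ) ^ 2 * T)⁻¹ * S * n ^ 2 * T = S := fun S => by field_simp
    exact (e _).symm

lemma integral_inner_sq (h : IsShiftModel P ε b K ρ g) (v : EuclideanSpace ℝ (Fin n)) (t : ℤ) :
    ∫ ω, inner ℝ v (panelDev n γ t (pathOf ε ω)) ^ 2 ∂P =
      ∫ ω, inner ℝ v (panelDev n γ 0 (pathOf ε ω)) ^ 2 ∂P := by
  have hm := measurable_inner_panelDev (γ := γ) v
  rw [h.integral_eq (F := fun y => inner ℝ v (panelDev n γ t y) ^ 2) ((hm t).pow_const _),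
    h.integral_eq (F := fun y => inner ℝ v (panelDev n γ 0 y) ^ 2) ((hm 0).pow_const _),
    ← h.integral_shift_eq ((hm 0).pow_const 2) t]
  simp [pathOf, inner_panelDev]

lemma hasMeanBound_inner_sq (h : IsShiftModel P ε b K ρ g) (hb : 1 ≤ b 0)
    (hbs : Summable fun d => (b d : ℝ)) (hn : 0 < n) {c : ℝ≥0}
    (hγ : ∀ i < n, |γ i| ≤ c) {v : EuclideanSpace ℝ (Fin n)} (hv : ‖v‖ = 1) {T : ℕ} (hT : 0 < T) :
    HasMeanBound P (16 * (((c + 1) * K : ℝ≥0) : ℝ) ^ 4 * ∑' d, (b d : ℝ)) fun V ω =>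
      (∑ t ∈ Finset.Ioc (0 : ℤ) T, (inner ℝ v (panelDev n γ t (pathOf ε ω)) ^ 2 -
          ∫ ω', inner ℝ v (panelDev n γ 0 (pathOf ε ω')) ^ 2 ∂P)) ^ 2 ≤ V * n ^ 2 * T := by
  have hn' : (0 : ℝ) < n := by exact_mod_cast hn
  have hT' : (0 : ℝ) < T := by exact_mod_cast hT
  have hU : ∀ t : ℤ, Measurable fun y => inner ℝ v (panelDev n γ t y) ^ 2 := fun t =>
    (measurable_inner_panelDev v t).pow_const 2
  have hst := (h.stable_inner_sq hγ hv).mono_exponent (hσ ρ) (q := 2) (by norm_num)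
  have hle := h.integral_sum_sq_le hb hbs hU hst (Finset.Ioc (0 : ℤ) T)
  simp only [h.integral_inner_sq] at hle
  have hi := h.integrable_sum_sub_sq hU (fun t => hst.memLp t) (Finset.Ioc (0 : ℤ) T)
    fun _ => ∫ ω', inner ℝ v (panelDev n γ 0 (pathOf ε ω')) ^ 2 ∂P
  refine ⟨fun ω => ((n : ℝ) ^ 2 * T)⁻¹ * (∑ t ∈ Finset.Ioc (0 : ℤ) T,
    (inner ℝ v (panelDev n γ t (pathOf ε ω)) ^ 2 -
      ∫ ω', inner ℝ v (panelDev n γ 0 (pathOf ε ω')) ^ 2 ∂P)) ^ 2, fun ω => by positivity,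
    hi.const_mul _, ?_,
    fun ω => le_of_eq ?_⟩
  · rw [integral_const_mul, inv_mul_le_iff₀ (by positivity)]
    refine hle.trans (le_of_eq ?_)
    simp
    ring
  · have e : ∀ S : ℝ, ((n : ℝ) ^ 2 * T)⁻¹ * S * n ^ 2 * T = S := fun S => by field_simp
    exact (e _).symm

/-- Stationarity identifies the lag `|s|` seen by the sample autocovariance with the lag `s`,
whatever its sign. -/
lemma covariance_inner_sq (h : IsShiftModel P ε b K ρ g) (v : EuclideanSpace ℝ (Fin n)) (s t : ℤ) :
    ∫ ω, (inner ℝ v (panelDev n γ t (pathOf ε ω)) ^ 2 -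
        ∫ ω', inner ℝ v (panelDev n γ 0 (pathOf ε ω')) ^ 2 ∂P) *
      (inner ℝ v (panelDev n γ (t + |s|) (pathOf ε ω)) ^ 2 -
        ∫ ω', inner ℝ v (panelDev n γ 0 (pathOf ε ω')) ^ 2 ∂P) ∂P =
      cov[fun ω => inner ℝ v (panelDev n γ 0 (pathOf ε ω)) ^ 2,
        fun ω => inner ℝ v (panelDev n γ s (pathOf ε ω)) ^ 2; P] := by
  set m := ∫ ω', inner ℝ v (panelDev n γ 0 (pathOf ε ω')) ^ 2 ∂P with hm
  have hU : ∀ t : ℤ, Measurable fun y => inner ℝ v (panelDev n γ t y) := fun t =>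
    measurable_inner_panelDev v t
  let F : ℤ → ℤ → Innov → ℝ := fun s t y => (inner ℝ v (panelDev n γ s y) ^ 2 - m) *
    (inner ℝ v (panelDev n γ t y) ^ 2 - m)
  have hF : ∀ s t, Measurable (F s t) := fun s t => by
    have := hU s
    have := hU t
    fun_prop
  have hshift : ∀ s t k : ℤ, ∫ ω, F (s + k) (t + k) (pathOf ε ω) ∂P =
      ∫ ω, F s t (pathOf ε ω) ∂P := by
    intro s t k
    rw [h.integral_eq (hF _ _), h.integral_eq (hF _ _), ← h.integral_shift_eq (hF s t) k]
    simp [pathOf, inner_panelDev, F]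
  simp only [covariance, h.integral_inner_sq, ← hm]
  change ∫ ω, F t (t + |s|) (pathOf ε ω) ∂P = ∫ ω, F 0 s (pathOf ε ω) ∂P
  rcases le_total 0 s with hs | hs
  · rw [abs_of_nonneg hs, ← hshift 0 s t]
    simp [add_comm]
  · rw [abs_of_nonpos hs, ← hshift 0 s (t - s)]
    simp only [F, zero_add, add_sub_cancel, mul_comm]
    simp [sub_eq_add_neg]

/-- The centred squares are stable with constant of order `n`, whose fourth power gives `n⁴`; the
variance bound for lagged products is uniform over the `2H + 1` lags. -/
lemma hasMeanBound_lagged (h : IsShiftModel P ε b K ρ g) (hb : 1 ≤ b 0) (hanti : Antitone b)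
    (hbs : Summable fun d => (b d : ℝ)) (hn : 0 < n) {c : ℝ≥0}
    (hγ : ∀ i < n, |γ i| ≤ c) {v : EuclideanSpace ℝ (Fin n)} (hv : ‖v‖ = 1) {T H : ℕ} (hT : 0 < T)
    (hH : 2 * H ≤ T) :
    HasMeanBound P (24576 * (((c + 1) * K : ℝ≥0) : ℝ) ^ 8 * b 0 * ∑' d, (b d : ℝ)) fun V ω =>
      ∑ s ∈ Finset.Icc (-H : ℤ) H, (((T : ℝ) - |(s : ℝ)|)⁻¹ * ∑ t ∈ Finset.Icc (1 : ℤ) (T - |s|),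
        (inner ℝ v (panelDev n γ t (pathOf ε ω)) ^ 2 -
          ∫ ω', inner ℝ v (panelDev n γ 0 (pathOf ε ω')) ^ 2 ∂P) *
        (inner ℝ v (panelDev n γ (t + |s|) (pathOf ε ω)) ^ 2 -
          ∫ ω', inner ℝ v (panelDev n γ 0 (pathOf ε ω')) ^ 2 ∂P) -
        cov[fun ω => inner ℝ v (panelDev n γ 0 (pathOf ε ω)) ^ 2,
          fun ω => inner ℝ v (panelDev n γ s (pathOf ε ω)) ^ 2; P]) ^ 2 ≤
      V * (2 * H + 1) * n ^ 4 / T := by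
  have hn' : (0 : ℝ) < n := by exact_mod_cast hn
  have hT' : (0 : ℝ) < T := by exact_mod_cast hT
  set m := ∫ ω', inner ℝ v (panelDev n γ 0 (pathOf ε ω')) ^ 2 ∂P with hm
  set κ : ℝ≥0 := (c + 1) * K
  set cv : ℤ → ℝ := fun s => cov[fun ω => inner ℝ v (panelDev n γ 0 (pathOf ε ω)) ^ 2,
    fun ω => inner ℝ v (panelDev n γ s (pathOf ε ω)) ^ 2; P] with hcv
  let U : ℤ → Innov → ℝ := fun t y => inner ℝ v (panelDev n γ t y) ^ 2 - m
  have hU : ∀ t, Measurable (U t) := fun t =>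
    ((measurable_inner_panelDev v t).pow_const 2).sub_const _
  have hUm : ∀ t, ∫ z, inner ℝ v (panelDev n γ t (pathOf (shiftProc g) z)) ^ 2 ∂(innovLaw ρ) = m :=
    fun t => by
      rw [hm, ← h.integral_inner_sq v t]
      exact (h.integral_eq (F := fun y => inner ℝ v (panelDev n γ t y) ^ 2)
        ((measurable_inner_panelDev v t).pow_const 2)).symm
  have hst : Stable (innovLaw ρ) swapPast b 4 (4 * n * κ ^ 2)
      fun t x => U t (pathOf (shiftProc g) x) := by
    have := (h.stable_centred_sq hγ hv).mono_exponent (hσ ρ) (q := 4) (by norm_num)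
    simpa only [hUm] using this
  have h0 : ∀ t, ∫ x, U t (pathOf (shiftProc g) x) ∂(innovLaw ρ) = 0 := fun t => by
    have hi := ((h.stable_inner_sq hγ hv).memLp t).integrable (by norm_num)
    simp only [U]
    rw [integral_sub hi (integrable_const _), hUm]
    simp
  have hcov : ∀ s t : ℤ, ∫ ω, U t (pathOf ε ω) * U (t + s.natAbs) (pathOf ε ω) ∂P = cv s :=
    fun s t => by
      rw [Int.natCast_natAbs]
      exact h.covariance_inner_sq v s t
  have hle := fun s : ℤ => h.integral_lagged_sum_sq_le hb hanti hbs hU hst h0 s.natAbs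
    (Finset.Icc (1 : ℤ) (T - |s|))
  simp only [hcov] at hle
  have hUU : ∀ (s : ℤ) t, Measurable fun y => U t y * U (t + s.natAbs) y := fun s t =>
    (hU t).mul (hU _)
  have hUL : ∀ (s : ℤ) t, MemLp (fun x => U t (pathOf (shiftProc g) x) *
      U (t + s.natAbs) (pathOf (shiftProc g) x)) 2 (innovLaw ρ) := fun s t =>
    memLp_of_eLpNorm_le ((hst.meas t).mul (hst.meas _)) (hst.eLpNorm_mul_le_two t (t + s.natAbs))
  have hi := fun s : ℤ => h.integrable_sum_sub_sq (hUU s) (hUL s) (Finset.Icc (1 : ℤ) (T - |s|))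
    fun _ => cv s
  have hr : ∀ s ∈ Finset.Icc (-H : ℤ) H, ∀ ω, (((T : ℝ) - |(s : ℝ)|)⁻¹ *
      ∑ t ∈ Finset.Icc (1 : ℤ) (T - |s|), U t (pathOf ε ω) * U (t + |s|) (pathOf ε ω) - cv s) ^ 2 =
      ((T : ℝ) - |(s : ℝ)|)⁻¹ ^ 2 * (∑ t ∈ Finset.Icc (1 : ℤ) (T - |s|),
        (U t (pathOf ε ω) * U (t + s.natAbs) (pathOf ε ω) - cv s)) ^ 2 ∧
      ((Finset.Icc (1 : ℤ) (T - |s|)).card : ℝ) = (T : ℝ) - |(s : ℝ)| ∧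
      (T : ℝ) / 2 ≤ (T : ℝ) - |(s : ℝ)| := by
    intro s hs ω
    rw [Finset.mem_Icc] at hs
    have hsH : |s| ≤ H := abs_le.2 hs
    have h1 : |(s : ℝ)| ≤ H := by exact_mod_cast hsH
    have h2 : (2 : ℝ) * H ≤ T := by exact_mod_cast hH
    have h3 : (T : ℝ) / 2 ≤ (T : ℝ) - |(s : ℝ)| := by linarith
    have hcard : ((Finset.Icc (1 : ℤ) (T - |s|)).card : ℝ) = (T : ℝ) - |(s : ℝ)| := by
      rw [Int.card_Icc]
      have : ((T - |s| + 1 - 1).toNat : ℤ) = T - |s| := by omega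
      exact_mod_cast this
    refine ⟨?_, hcard, h3⟩
    rw [Finset.sum_sub_distrib, Finset.sum_const, nsmul_eq_mul, hcard, ← mul_pow, mul_sub,
      ← mul_assoc, inv_mul_cancel₀ (by linarith), one_mul, Int.natCast_natAbs]
  have hi' : ∀ s ∈ Finset.Icc (-H : ℤ) H, Integrable (fun ω => (((T : ℝ) - |(s : ℝ)|)⁻¹ *
      ∑ t ∈ Finset.Icc (1 : ℤ) (T - |s|), U t (pathOf ε ω) * U (t + |s|) (pathOf ε ω) - cv s) ^ 2)
      P := by
    intro s hs
    simp only [fun ω => (hr s hs ω).1]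
    exact (hi s).const_mul _
  refine ⟨fun ω => T / ((2 * H + 1) * n ^ 4) * ∑ s ∈ Finset.Icc (-H : ℤ) H,
    (((T : ℝ) - |(s : ℝ)|)⁻¹ * ∑ t ∈ Finset.Icc (1 : ℤ) (T - |s|), U t (pathOf ε ω) *
      U (t + |s|) (pathOf ε ω) - cv s) ^ 2, fun ω => by positivity,
    (integrable_finsetSum _ hi').const_mul _, ?_, fun ω => le_of_eq ?_⟩
  · rw [integral_const_mul, integral_finsetSum _ hi']
    -- `24576 = 2 · 48 · 4⁴`, where the 2 comes from `T - |s| ≥ T / 2`.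
    set D := 48 * (((4 * n * κ ^ 2 : ℝ≥0) : ℝ)) ^ 4 * b 0 * ∑' d, (b d : ℝ) with hD
    have hD0 : 0 ≤ D := mul_nonneg (by positivity) (tsum_nonneg fun d => (b d).2)
    have hs : ∀ s ∈ Finset.Icc (-H : ℤ) H, ∫ ω, (((T : ℝ) - |(s : ℝ)|)⁻¹ *
        ∑ t ∈ Finset.Icc (1 : ℤ) (T - |s|), U t (pathOf ε ω) * U (t + |s|) (pathOf ε ω) - cv s) ^ 2
        ∂P ≤ 2 / T * D := by
      intro s hs
      simp only [fun ω => (hr s hs ω).1]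
      rw [integral_const_mul]
      obtain ⟨ω⟩ : Nonempty Ω := nonempty_of_isProbabilityMeasure P
      obtain ⟨-, e1, e2⟩ := hr s hs ω
      have e3 := hle s
      rw [e1] at e3
      have e4 : 0 < (T : ℝ) - |(s : ℝ)| := by linarith
      refine (mul_le_mul_of_nonneg_left e3 (by positivity)).trans ?_
      rw [inv_pow, pow_two, ← mul_assoc, mul_inv, mul_assoc (_⁻¹), inv_mul_cancel₀ e4.ne', mul_one]
      refine mul_le_mul_of_nonneg_right ?_ hD0
      rw [inv_eq_one_div, div_le_div_iff₀ e4 hT']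
      linarith
    refine (mul_le_mul_of_nonneg_left (Finset.sum_le_sum hs) (by positivity)).trans (le_of_eq ?_)
    have hcard : ((Finset.Icc (-H : ℤ) H).card : ℝ) = 2 * H + 1 := by
      rw [Int.card_Icc]
      have : (((H : ℤ) + 1 - -H).toNat : ℤ) = 2 * H + 1 := by omega
      exact_mod_cast this
    rw [Finset.sum_const, nsmul_eq_mul, hcard, hD]
    push_cast
    field_simp
    ring
  · have e : ∀ S : ℝ, T / ((2 * H + 1) * n ^ 4) * S * (2 * H + 1) * n ^ 4 / T = S := fun S => by
      field_simp
    exact (e _).symm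

end IsShiftModel

/-! ### Dimension-free bounds for sums of independent errors -/

section Independent
variable {X : Type*} [MeasurableSpace X] {m : Measure X} [IsProbabilityMeasure m]

/-- Second and fourth moments of a linear combination of independent centred variables. -/
lemma integral_sum_pow_of_iIndepFun {f : ℕ → X → ℝ} (hf : ∀ i, Measurable (f i))
    (hi : iIndepFun f m) (h0 : ∀ i, ∫ x, f i x ∂m = 0) {A : ℝ≥0} (hA : ∀ i, eLpNorm (f i) 4 m ≤ A)
    (a : ℕ → ℝ) (n : ℕ) :
    ∫ x, (∑ i ∈ Finset.range n, a i * f i x) ^ 2 ∂m ≤ A ^ 2 * ∑ i ∈ Finset.range n, a i ^ 2 ∧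
    ∫ x, (∑ i ∈ Finset.range n, a i * f i x) ^ 4 ∂m ≤
      3 * A ^ 4 * (∑ i ∈ Finset.range n, a i ^ 2) ^ 2 := by
  have hL : ∀ i, MemLp (f i) 4 m := fun i => memLp_of_eLpNorm_le (hf i) (hA i)
  have h2 : ∀ i, ∫ x, f i x ^ 2 ∂m ≤ A ^ 2 := fun i => by
    have := integral_pow_le_of_eLpNorm_le (n := 2) two_ne_zero (hf i)
      ((eLpNorm_le_eLpNorm_of_exponent_le (by norm_num) (hf i).aestronglyMeasurable).trans (hA i))
    simpa using this
  have h4 : ∀ i, ∫ x, f i x ^ 4 ∂m ≤ A ^ 4 := fun i => by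
    have := integral_pow_le_of_eLpNorm_le (n := 4) four_ne_zero (hf i) (by exact_mod_cast hA i)
    simpa [Even.pow_abs (by decide : Even 4)] using this
  induction n with
  | zero => simp
  | succ n ih =>
    obtain ⟨ih2, ih4⟩ := ih
    simp only [Finset.sum_range_succ]
    set S : X → ℝ := fun x => ∑ i ∈ Finset.range n, a i * f i x with hS
    set V := ∑ i ∈ Finset.range n, a i ^ 2 with hV
    have hV0 : 0 ≤ V := Finset.sum_nonneg fun i _ => sq_nonneg _
    have hSm : Measurable S := by fun_prop
    have hind : IndepFun S (fun x => a n * f n x) m := by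
      have h1 := (hi.comp (g := fun i y => a i * y) fun i => by fun_prop).indepFun_finsetSum_of_notMem
        (fun i => by have := hf i; fun_prop) (s := Finset.range n) (i := n) (by simp)
      have e : S = ∑ j ∈ Finset.range n, (fun y => a j * y) ∘ f j := by
        funext x
        simp [hS]
      rw [e]
      exact h1
    have hprod : ∀ i j : ℕ, ∫ x, S x ^ i * (a n * f n x) ^ j ∂m =
        (∫ x, S x ^ i ∂m) * ∫ x, (a n * f n x) ^ j ∂m := fun i j =>
      hind.integral_fun_comp_mul_comp (f := fun y => y ^ i) (g := fun y => y ^ j)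
        hSm.aemeasurable (by have := hf n; fun_prop)
        (Measurable.aestronglyMeasurable (by fun_prop))
        (Measurable.aestronglyMeasurable (by fun_prop))
    have hSL : MemLp S 4 m := memLp_finsetSum _ fun i _ => (hL i).const_mul _
    have hgL : MemLp (fun x => a n * f n x) 4 m := (hL n).const_mul _
    have hS0 : ∫ x, S x ∂m = 0 := by
      rw [hS, integral_finsetSum _ fun i _ => ((hL i).integrable (by norm_num)).const_mul _]
      simp [integral_const_mul, h0]
    have hg0 : ∫ x, a n * f n x ∂m = 0 := by rw [integral_const_mul, h0, mul_zero]
    have e2 : ∫ x, (a n * f n x) ^ 2 ∂m ≤ A ^ 2 * a n ^ 2 := by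
      simp only [mul_pow, integral_const_mul]
      nlinarith [h2 n, sq_nonneg (a n)]
    have e4 : ∫ x, (a n * f n x) ^ 4 ∂m ≤ A ^ 4 * a n ^ 4 := by
      simp only [mul_pow, integral_const_mul]
      nlinarith [h4 n, pow_nonneg (sq_nonneg (a n)) 2]
    constructor
    · have hS2 : MemLp S 2 m := hSL.mono_exponent (by norm_num)
      have hg2 : MemLp (fun x => a n * f n x) 2 m := hgL.mono_exponent (by norm_num)
      have : ∫ x, (S x + a n * f n x) ^ 2 ∂m = ∫ x, S x ^ 2 ∂m + ∫ x, (a n * f n x) ^ 2 ∂m := by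
        have h11 := hprod 1 1
        simp only [pow_one, hS0, zero_mul] at h11
        have k1 := integral_add hS2.integrable_sq ((hS2.integrable_mul hg2).const_mul 2)
        have k2 := integral_add (hS2.integrable_sq.add ((hS2.integrable_mul hg2).const_mul 2))
          hg2.integrable_sq
        simp only [Pi.add_apply, Pi.mul_apply, integral_const_mul, h11] at k1 k2
        calc ∫ x, (S x + a n * f n x) ^ 2 ∂m
            = ∫ x, (S x ^ 2 + 2 * (S x * (a n * f n x)) + (a n * f n x) ^ 2) ∂m := by
              congr 1; funext x; ring
          _ = _ := by rw [k2, k1]; ring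
      rw [this]
      linarith
    -- The recursion `3V² + 6Va² + a⁴ ≤ 3(V + a²)²`, up to the factor `A⁴`.
    · rw [integral_add_pow_four hSL hgL hS0 hg0 hprod]
      have p1 : (∫ x, S x ^ 2 ∂m) * ∫ x, (a n * f n x) ^ 2 ∂m ≤ (A ^ 2 * V) * (A ^ 2 * a n ^ 2) :=
        mul_le_mul ih2 e2 (integral_nonneg fun x => sq_nonneg _) (by positivity)
      have p2 : 0 ≤ (A : ℝ) ^ 4 * a n ^ 4 := by positivity
      nlinarith

lemma eLpNorm_sum_le_of_iIndepFun {f : ℕ → X → ℝ} (hf : ∀ i, Measurable (f i))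
    (hi : iIndepFun f m) (h0 : ∀ i, ∫ x, f i x ∂m = 0) {A : ℝ≥0} (hA : ∀ i, eLpNorm (f i) 4 m ≤ A)
    {n : ℕ} {v : EuclideanSpace ℝ (Fin n)} (hv : ‖v‖ = 1) :
    eLpNorm (fun x => ∑ i : Fin n, v i * f i x) 4 m ≤ (2 * A : ℝ≥0) := by
  let a : ℕ → ℝ := fun i => if h : i < n then v ⟨i, h⟩ else 0
  have hsum : ∀ x, ∑ i : Fin n, v i * f i x = ∑ i ∈ Finset.range n, a i * f i x := fun x => by
    rw [Finset.sum_range]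
    exact Finset.sum_congr rfl fun i _ => by simp [a]
  have hsq : ∑ i ∈ Finset.range n, a i ^ 2 = 1 := by
    have h2 := EuclideanSpace.norm_sq_eq v
    rw [Finset.sum_range]
    simp only [hv, Real.norm_eq_abs, sq_abs] at h2
    rw [one_pow] at h2
    rw [h2]
    exact Finset.sum_congr rfl fun i _ => by simp [a]
  have := (integral_sum_pow_of_iIndepFun hf hi h0 hA a n).2
  simp only [hsum]
  have hL : MemLp (fun x => ∑ i ∈ Finset.range n, a i * f i x) (4 : ℕ) m :=
    memLp_finsetSum _ fun i _ => (memLp_of_eLpNorm_le (hf i) (by exact_mod_cast hA i)).const_mul _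
  -- The constant 2 serves because `3 ≤ 2⁴`.
  have h4 := eLpNorm_le_of_integral_pow_le (n := 4) four_ne_zero hL (A := 2 * A) (by
    simp only [Even.pow_abs (by decide : Even 4)]
    rw [hsq] at this
    refine this.trans ?_
    push_cast
    rw [mul_pow]
    have : (0 : ℝ) ≤ (A : ℝ) ^ 4 := by positivity
    nlinarith)
  exact_mod_cast h4

end Independent

/-! ### Long-run variance of the squared projection -/

/-- Adding an uncorrelated stationary process does not decrease the long-run variance. -/
lemma longRunVar_le_add {X : Type*} [MeasurableSpace X] {m : Measure X} [IsProbabilityMeasure m]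
    {F R : ℤ → X → ℝ} (hF : ∀ t, MemLp (F t) 2 m) (hR : ∀ t, MemLp (R t) 2 m)
    (hFs : Summable fun t : ℤ => cov[F 0, F t; m]) (hRs : Summable fun t : ℤ => cov[R 0, R t; m])
    (hstat : ∀ s t, cov[R s, R t; m] = cov[R 0, R (t - s); m])
    (hFR : ∀ s t, cov[F s, R t; m] = 0) :
    longRunVar m F ≤ longRunVar m fun t x => F t x + R t x := by
  have hcov : ∀ t, cov[fun x => F 0 x + R 0 x, fun x => F t x + R t x; m] =
      cov[F 0, F t; m] + cov[R 0, R t; m] := fun t => by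
    have e := covariance_add_left (hF 0) (hR 0) ((hF t).add (hR t))
    rw [covariance_add_right (hF 0) (hF t) (hR t), covariance_add_right (hR 0) (hF t) (hR t), hFR,
      covariance_comm (R 0) (F t), hFR, add_zero, zero_add] at e
    exact e
  have hpos := longRunVar_nonneg hR hstat hRs
  unfold longRunVar at hpos ⊢
  simp only [hcov]
  rw [hFs.tsum_add hRs]
  linarith

lemma Stable.summable_covariance {S : Type*} [MeasurableSpace S] {Q : Measure S}
    [IsProbabilityMeasure Q] {σ : ℤ → S × S → S × S} {b : ℕ → ℝ≥0} {κ : ℝ≥0} {U : ℤ → S → ℝ}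
    (hU : Stable Q σ b 2 κ U) (hσ : ∀ c, MeasurePreserving (σ c) (Q.prod Q) (Q.prod Q))
    (hb : 1 ≤ b 0) (hbs : Summable fun d => (b d : ℝ)) :
    Summable fun t : ℤ => cov[U 0, U t; Q] := by
  have hs : Summable fun t : ℤ => 2 * ((κ : ℝ) * κ) * (b t.natAbs : ℝ) :=
    (summable_int_of_natAbs hbs).mul_left _
  refine hs.of_norm_bounded fun t => ?_
  have := hU.abs_cov_self_le hσ hb 0 t
  rwa [sub_zero] at this

namespace IsShiftModel
variable {Ω : Type*} [MeasurableSpace Ω] {P : Measure Ω} [IsProbabilityMeasure P]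
  {ε : Option ℕ → ℤ → Ω → ℝ} {b : ℕ → ℝ≥0} {K κ : ℝ≥0} {ρ : Option ℕ → ProbabilityMeasure ℝ}
  {g : Option ℕ → (ℕ → ℝ) → ℝ} {n : ℕ} {γ : ℕ → ℝ}

/-- Weighted sums of the idiosyncratic errors are stable uniformly in the dimension. -/
lemma stable_idiosyncratic (h : IsShiftModel P ε b K ρ g) {v : EuclideanSpace ℝ (Fin n)}
    (hv : ‖v‖ = 1) :
    Stable (innovLaw ρ) swapPast b 4 (2 * K)
      (fun t x => ∑ i : Fin n, v i * shiftProc g (some i) t x) := by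
  have hst : ∀ o, Stable (innovLaw ρ) swapPast b 4 K (shiftProc g o) := fun o =>
    (h.stable o).mono_exponent (hσ ρ) (by norm_num)
  -- The coupling error of a series is a function of its own pair of innovation sequences, so these
  -- errors are again independent and centred, and the dimension-free bound applies to them too.
  have hpair : iIndepFun (fun (i : ℕ) (p : Innov × Innov) => (p.1 (some i), p.2 (some i)))
      ((innovLaw ρ).prod (innovLaw ρ)) := (iIndepFun_pair ρ).precomp (Option.some_injective ℕ)
  refine ⟨fun t => ?_, fun c t htc x => ?_, fun t => ?_, fun c t hct => ?_⟩
  · have := fun o => (hst o).meas t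
    fun_prop
  · simp only [(hst _).causal c t htc x]
  · rw [← eLpNorm_comp_measurePreserving' (m := (innovLaw ρ).prod (innovLaw ρ))
      measurePreserving_fst (by have := fun o => (hst o).meas t; fun_prop)]
    refine eLpNorm_sum_le_of_iIndepFun (f := fun i (p : Innov × Innov) => shiftProc g (some i) t p.1)
      (fun i => ((hst _).meas t).comp measurable_fst) ?_ (fun i => ?_) (fun i => ?_) hv
    · exact hpair.comp (g := fun i (z : (ℤ → ℝ) × (ℤ → ℝ)) => g (some i) fun j : ℕ => z.1 (t - j))
        fun i => by have := h.meas_g (some i); fun_prop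
    · exact (integral_comp_measurePreserving (m := (innovLaw ρ).prod (innovLaw ρ))
        (T := Prod.fst) measurePreserving_fst ((hst _).meas t)).trans (h.mean _ t)
    · rw [eLpNorm_comp_measurePreserving' measurePreserving_fst ((hst _).meas t)]
      exact (hst _).bound t
  · simp only [← Finset.sum_sub_distrib, ← mul_sub]
    have hm := fun o => (hst o).meas t
    have hs := hσ ρ c
    rw [mul_assoc]
    refine eLpNorm_sum_le_of_iIndepFun (f := fun i (p : Innov × Innov) =>
      shiftProc g (some i) t p.1 - shiftProc g (some i) t (swapPast c p).1)
      (fun i => ((hm _).comp measurable_fst).sub ((hm _).comp (measurable_fst.comp hs)))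
      ?_ (fun i => ?_) (fun i => ?_) hv
    · refine hpair.comp (g := fun i (z : (ℤ → ℝ) × (ℤ → ℝ)) => g (some i) (fun j : ℕ => z.1 (t - j)) -
        g (some i) fun j : ℕ => if t - (j : ℤ) ≤ c then z.2 (t - j) else z.1 (t - j)) fun i => ?_
      have hg := h.meas_g (some i)
      refine Measurable.sub (by fun_prop) (hg.comp (measurable_pi_lambda _ fun j => ?_))
      split_ifs <;> fun_prop
    · have hi := ((hst (some i)).memLp t).integrable (by norm_num)
      have hmp := measurePreserving_swapPast ρ c
      have i2 : Integrable (fun x : Innov × Innov => shiftProc g (some i) t (swapPast c x).1)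
          ((innovLaw ρ).prod (innovLaw ρ)) :=
        (measurePreserving_fst.comp hmp).integrable_comp_of_integrable hi
      rw [integral_sub (hi.comp_fst _) i2]
      have e1 := integral_comp_measurePreserving (m := (innovLaw ρ).prod (innovLaw ρ))
        (T := Prod.fst) measurePreserving_fst (hm (some i))
      have e2 := integral_comp_measurePreserving (m := (innovLaw ρ).prod (innovLaw ρ))
        (T := Prod.fst ∘ swapPast c) (measurePreserving_fst.comp hmp) (hm (some i))
      simp only [Function.comp_apply] at e2
      rw [e1, sub_eq_zero]
      exact e2.symm
    · exact (hst _).couple c t hct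

lemma inner_panelDev_eq (v : EuclideanSpace ℝ (Fin n)) (t : ℤ) (y : Innov) :
    inner ℝ v (panelDev n γ t y) = (∑ i : Fin n, v i * γ i) * y none t +
      ∑ i : Fin n, v i * y (some i) t := by
  rw [inner_panelDev, Finset.sum_mul, ← Finset.sum_add_distrib]
  exact Finset.sum_congr rfl fun i _ => by ring

/-- Autocovariances of the squared projection, with the sharp dependence on the factor loading. -/
lemma abs_covariance_inner_sq_le (h : IsShiftModel P ε b K ρ g) (hb : 1 ≤ b 0)
    {v : EuclideanSpace ℝ (Fin n)} (hv : ‖v‖ = 1) (s : ℤ) :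
    |cov[fun ω => inner ℝ v (panelDev n γ 0 (pathOf ε ω)) ^ 2,
      fun ω => inner ℝ v (panelDev n γ s (pathOf ε ω)) ^ 2; P]| ≤
      200 * K ^ 4 * (1 + (∑ i : Fin n, v i * γ i) ^ 2) ^ 2 * b s.natAbs := by
  have hm : ∀ t, Measurable fun y => inner ℝ v (panelDev n γ t y) ^ 2 := fun t =>
    (measurable_inner_panelDev v t).pow_const 2
  rw [h.covariance_eq (hm 0) (hm s)]
  set a := ∑ i : Fin n, v i * γ i with ha
  -- The constant `(|a| + 2) K` depends on the dimension only through the loading `a`.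
  have hw : Stable (innovLaw ρ) swapPast b 4 (‖a‖₊ * K + 2 * K)
      (fun t x => inner ℝ v (panelDev n γ t (pathOf (shiftProc g) x))) := by
    simp only [inner_panelDev_eq, ← ha]
    exact (((h.stable none).mono_exponent (hσ ρ) (by norm_num)).const_mul a).add (hσ ρ)
      (by norm_num) (h.stable_idiosyncratic hv)
  have h2 := hw.mul (r := 2) (by norm_num) (measurePreserving_swapPast ρ) hw
  simp only [← pow_two] at h2
  have h3 := h2.abs_cov_self_le (measurePreserving_swapPast ρ) hb 0 s
  rw [sub_zero] at h3
  refine h3.trans (mul_le_mul_of_nonneg_right ?_ (b _).2)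
  push_cast
  rw [Real.norm_eq_abs]
  have hK0 : (0 : ℝ) ≤ K := K.2
  -- Hence the constant `8 · 5² = 200`.
  have e1 : (|a| + 2) ^ 2 ≤ 5 * (1 + a ^ 2) := by
    rw [← sq_abs a]
    nlinarith [sq_nonneg (2 * |a| - 1)]
  calc 2 * (2 * (|a| * (K : ℝ) + 2 * K) ^ 2 * (2 * (|a| * K + 2 * K) ^ 2))
      = 8 * K ^ 4 * ((|a| + 2) ^ 2) ^ 2 := by ring
    _ ≤ 8 * K ^ 4 * (5 * (1 + a ^ 2)) ^ 2 := by gcongr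
    _ = _ := by ring

lemma indepFun_factor_errors (ρ : Option ℕ → ProbabilityMeasure ℝ) (n : ℕ) :
    IndepFun (fun (x : Innov) => x none) (fun (x : Innov) (i : Fin n) => x (some i))
      (innovLaw ρ) := by
  have h : iIndepFun (fun (o : Option ℕ) (x : Innov) => x o) (innovLaw ρ) :=
    iIndepFun_infinitePi (X := fun _ y => y) fun _ => measurable_id
  have hd : Disjoint ({none} : Finset (Option ℕ)) ((Finset.range n).image some) := by simp
  have h1 := h.indepFun_finset _ _ hd fun o => by fun_prop
  have m1 : Measurable fun z : ({none} : Finset (Option ℕ)) → ℤ → ℝ => z ⟨none, by simp⟩ :=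
    measurable_pi_apply _
  have m2 : Measurable fun (z : (Finset.range n).image (some : ℕ → Option ℕ) → ℤ → ℝ) (i : Fin n) =>
      z ⟨some i, by simp⟩ := measurable_pi_lambda _ fun _ => measurable_pi_apply _
  exact h1.comp m1 m2

/-- Covariances of the squared factor with the rest of the squared projection vanish. -/
lemma covariance_factor_remainder (h : IsShiftModel P ε b K ρ g) {v : EuclideanSpace ℝ (Fin n)}
    (hv : ‖v‖ = 1) (a : ℝ) (s t : ℤ) :
    cov[fun x => shiftProc g none s x ^ 2, fun x =>
      2 * a * (shiftProc g none t x * ∑ i : Fin n, v i * shiftProc g (some i) t x) +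
        (∑ i : Fin n, v i * shiftProc g (some i) t x) ^ 2; innovLaw ρ] = 0 := by
  set Q := innovLaw ρ with hQ
  have hmp := measurePreserving_swapPast ρ
  have hf4 : Stable Q swapPast b 4 K (shiftProc g none) :=
    (h.stable none).mono_exponent (hσ ρ) (by norm_num)
  have hu4 := h.stable_idiosyncratic hv
  have hgn := h.meas_g none
  have hgs := fun i : ℕ => h.meas_g (some i)
  let Ff : ℤ → (ℤ → ℝ) → ℝ := fun t z => g none fun j : ℕ => z (t - j)
  let Fu : ℤ → (Fin n → ℤ → ℝ) → ℝ := fun t z =>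
    ∑ i : Fin n, v i * g (some i) fun j : ℕ => z i (t - j)
  have hFf : ∀ t, Measurable (Ff t) := fun t => by fun_prop
  have hFu : ∀ t, Measurable (Fu t) := fun t => by fun_prop
  have hind : ∀ {G : (ℤ → ℝ) → ℝ} {G' : (Fin n → ℤ → ℝ) → ℝ}, Measurable G → Measurable G' →
      ∫ x, G (x none) * G' (fun i => x (some i)) ∂Q =
        (∫ x, G (x none) ∂Q) * ∫ x, G' (fun i => x (some i)) ∂Q := fun hG hG' =>
    (indepFun_factor_errors ρ n).integral_fun_comp_mul_comp
      (Measurable.aemeasurable (by fun_prop)) (Measurable.aemeasurable (by fun_prop))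
      hG.aestronglyMeasurable hG'.aestronglyMeasurable
  have L1 : MemLp (fun x => shiftProc g none s x ^ 2) 2 Q := by
    simpa only [pow_two] using (hf4.mul (r := 2) (by norm_num) hmp hf4).memLp s
  have L2 := (hf4.mul (r := 2) (by norm_num) hmp hu4).memLp t
  have L3 := (hu4.mul (r := 2) (by norm_num) hmp hu4).memLp t
  simp only [← pow_two] at L3
  set f : Innov → ℝ := shiftProc g none t with hf
  set u : Innov → ℝ := fun x => ∑ i : Fin n, v i * shiftProc g (some i) t x with hu
  replace L2 : MemLp (fun x => f x * u x) 2 Q := L2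
  replace L3 : MemLp (fun x => u x ^ 2) 2 Q := L3
  -- The cross term is linear in `u`, which is centred and independent of the factor. The term `u²`
  -- is independent of the factor, hence uncorrelated with its square.
  have hu0 : ∫ x, u x ∂Q = 0 := by
    have hi : ∀ i : Fin n, Integrable (fun x => v i * shiftProc g (some i) t x) Q := fun i =>
      (((h.stable (some i)).memLp t).integrable (by norm_num)).const_mul _
    rw [hu, integral_finsetSum _ fun i _ => hi i]
    simp [integral_const_mul, hQ, h.mean]
  have e1 : ∫ x, shiftProc g none s x ^ 2 * u x ^ 2 ∂Q =
      (∫ x, shiftProc g none s x ^ 2 ∂Q) * ∫ x, u x ^ 2 ∂Q :=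
    hind ((hFf s).pow_const 2) ((hFu t).pow_const 2)
  have e2 : ∫ x, shiftProc g none s x ^ 2 * (f x * u x) ∂Q = 0 := by
    simp only [← mul_assoc]
    exact (hind (((hFf s).pow_const 2).mul (hFf t)) (hFu t)).trans (mul_eq_zero_of_right _ hu0)
  have e3 : ∫ x, f x * u x ∂Q = 0 := (hind (hFf t) (hFu t)).trans (mul_eq_zero_of_right _ hu0)
  refine (covariance_eq_sub L1 ((L2.const_mul (2 * a)).add L3)).trans ?_
  have i1 : ∫ x, 2 * a * (f x * u x) + u x ^ 2 ∂Q = ∫ x, u x ^ 2 ∂Q := by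
    rw [integral_add ((L2.integrable (by norm_num)).const_mul _) (L3.integrable (by norm_num)),
      integral_const_mul, e3]
    ring
  have i2 : ∫ x, shiftProc g none s x ^ 2 * (2 * a * (f x * u x) + u x ^ 2) ∂Q =
      ∫ x, shiftProc g none s x ^ 2 * u x ^ 2 ∂Q := by
    have k3 := integral_add ((L1.integrable_mul L2).const_mul (2 * a)) (L1.integrable_mul L3)
    simp only [Pi.mul_apply, integral_const_mul, e2, mul_zero, zero_add] at k3
    rw [← k3]
    congr 1
    funext x
    ring
  simp only [Pi.mul_apply, Pi.add_apply]
  rw [i1, i2, e1, sub_self]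

/-- The factor contributes its own long-run variance to that of the squared projection. -/
lemma factor_longRunVar_le (h : IsShiftModel P ε b K ρ g) (hb : 1 ≤ b 0)
    (hbs : Summable fun d => (b d : ℝ)) {v : EuclideanSpace ℝ (Fin n)} (hv : ‖v‖ = 1) :
    (∑ i : Fin n, v i * γ i) ^ 4 * longRunVar P (fun t ω => pathOf ε ω none t ^ 2) ≤
      longRunVar P fun t ω => inner ℝ v (panelDev n γ t (pathOf ε ω)) ^ 2 := by
  set a := ∑ i : Fin n, v i * γ i with ha
  have hmp := measurePreserving_swapPast ρ
  have hf4 : Stable (innovLaw ρ) swapPast b 4 K (shiftProc g none) :=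
    (h.stable none).mono_exponent (hσ ρ) (by norm_num)
  have hu4 := h.stable_idiosyncratic hv
  -- With `u` the weighted errors, `(a η + u)²` is split into `a² η²` and `2 a η u + u²`.
  have hF := (hf4.mul (r := 2) (by norm_num) hmp hf4).const_mul (a ^ 2)
  have hR := ((hf4.mul (r := 2) (by norm_num) hmp hu4).const_mul (2 * a)).add (hσ ρ) (by norm_num)
    (hu4.mul (r := 2) (by norm_num) hmp hu4)
  simp only [← pow_two] at hF hR
  have hle := longRunVar_le_add (fun t => hF.memLp t) (fun t => hR.memLp t) (hF.summable_covariance hmp hb hbs)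
    (hR.summable_covariance hmp hb hbs)
    (fun s t => ?_) (fun s t => ?_)
  · have hmf : ∀ t, Measurable fun y : Innov => y none t ^ 2 := fun t => by fun_prop
    have hmw : ∀ t, Measurable fun y => inner ℝ v (panelDev n γ t y) ^ 2 := fun t =>
      (measurable_inner_panelDev v t).pow_const 2
    unfold longRunVar at hle ⊢
    simp only [covariance_const_mul_left, covariance_const_mul_right, tsum_mul_left] at hle
    refine le_trans (le_of_eq ?_) (hle.trans (le_of_eq ?_))
    · simp only [fun t => h.covariance_eq (hmf 0) (hmf t)]
      simp only [pathOf]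
      ring
    · simp only [fun t => h.covariance_eq (hmw 0) (hmw t)]
      have e : ∀ t x, inner ℝ v (panelDev n γ t (pathOf (shiftProc g) x)) ^ 2 =
          a ^ 2 * shiftProc g none t x ^ 2 +
          (2 * a * (shiftProc g none t x * ∑ i : Fin n, v i * shiftProc g (some i) t x) +
            (∑ i : Fin n, v i * shiftProc g (some i) t x) ^ 2) := fun t x => by
        rw [inner_panelDev_eq, ← ha]
        simp only [pathOf]
        ring
      simp only [e]
  · have := covariance_map_fun (μ := innovLaw ρ) (Z := timeShift s)
      (hR.meas 0).aestronglyMeasurable (hR.meas (t - s)).aestronglyMeasurable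
      (measurePreserving_timeShift ρ s).measurable.aemeasurable
    rw [(measurePreserving_timeShift ρ s).map_eq] at this
    rw [this]
    simp only [shiftProc_timeShift, zero_add, sub_add_cancel]
  · rw [covariance_const_mul_left, h.covariance_factor_remainder hv a s t, mul_zero]

end IsShiftModel

/-! ### From autocovariances to the kernel estimator -/

/-- Deterministic error of the kernel estimator, given errors of the sample autocovariances. -/
lemma abs_kernelLRV_sub_le {J : ℝ → ℝ} {B h : ℝ} (hJB : ∀ x, |J x| ≤ B) {H : ℕ}
    (hJH : ∀ s : ℤ, (H : ℤ) < |s| → J (s / h) = 0) (M : ℕ) {y : ℤ → ℝ} {T : ℕ} {r c : ℤ → ℝ}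
    {D E : ℝ} (hE0 : 0 ≤ E) (hD : ∀ s ∈ Finset.Icc (-H : ℤ) H, |autoCov y T s - r s| ≤ D)
    (hE : ∑ s ∈ Finset.Icc (-H : ℤ) H, (r s - c s) ^ 2 ≤ (2 * H + 1) * E ^ 2) :
    |kernelLRV J h M y T - ∑ s ∈ Finset.Ioo (-(M : ℤ)) M, J (s / h) * c s| ≤
      B * ((2 * H + 1) * (D + E)) := by
  have hB0 : 0 ≤ B := (abs_nonneg _).trans (hJB 0)
  have hcard : ((Finset.Icc (-H : ℤ) H).card : ℝ) = 2 * H + 1 := by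
    rw [Int.card_Icc]
    have : (((H : ℤ) + 1 - -H).toNat : ℤ) = 2 * H + 1 := by omega
    exact_mod_cast this
  -- Cauchy–Schwarz over the lags.
  have h1 : ∑ s ∈ Finset.Icc (-H : ℤ) H, |r s - c s| ≤ (2 * H + 1) * E := by
    refine abs_le_of_sq_le_sq' ?_ (by positivity) |>.2
    have := sq_sum_le_card_mul_sum_sq (s := Finset.Icc (-H : ℤ) H) (f := fun s => |r s - c s|)
    simp only [sq_abs, hcard] at this
    refine this.trans ((mul_le_mul_of_nonneg_left hE (by positivity)).trans (le_of_eq (by ring)))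
  unfold kernelLRV
  rw [← Finset.sum_sub_distrib]
  simp only [← mul_sub]
  calc |∑ s ∈ Finset.Ioo (-(M : ℤ)) M, J (s / h) * (autoCov y T s - c s)|
      ≤ ∑ s ∈ Finset.Ioo (-(M : ℤ)) M, |J (s / h) * (autoCov y T s - c s)| :=
        Finset.abs_sum_le_sum_abs _ _
    -- Lags beyond `H` lie outside the support of the kernel, so the bound does not involve `M`.
    _ = ∑ s ∈ (Finset.Ioo (-(M : ℤ)) M).filter (· ∈ Finset.Icc (-H : ℤ) H),
          |J (s / h) * (autoCov y T s - c s)| := by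
        symm
        refine Finset.sum_subset (Finset.filter_subset _ _) fun s hs hs' => ?_
        rw [hJH s, zero_mul, abs_zero]
        by_contra hlt
        exact hs' (Finset.mem_filter.2 ⟨hs, Finset.mem_Icc.2 (abs_le.1 (not_lt.1 hlt))⟩)
    _ ≤ ∑ s ∈ Finset.Icc (-H : ℤ) H, |J (s / h) * (autoCov y T s - c s)| :=
        Finset.sum_le_sum_of_subset_of_nonneg (fun s hs => (Finset.mem_filter.1 hs).2)
          fun _ _ _ => abs_nonneg _
    _ ≤ ∑ s ∈ Finset.Icc (-H : ℤ) H, B * (D + |r s - c s|) := by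
        refine Finset.sum_le_sum fun s hs => ?_
        rw [abs_mul]
        refine mul_le_mul (hJB _) ?_ (abs_nonneg _) hB0
        calc |autoCov y T s - c s| = |(autoCov y T s - r s) + (r s - c s)| := by ring_nf
          _ ≤ |autoCov y T s - r s| + |r s - c s| := abs_add_le _ _
          _ ≤ _ := by gcongr; exact hD s hs
    _ = B * ((2 * H + 1) * D + ∑ s ∈ Finset.Icc (-H : ℤ) H, |r s - c s|) := by
        rw [← Finset.mul_sum, Finset.sum_add_distrib, Finset.sum_const, nsmul_eq_mul, hcard]
    _ ≤ B * ((2 * H + 1) * D + (2 * H + 1) * E) := by gcongr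
    _ = _ := by ring

/-- A relatively dominated, truncated and kernel weighted series is asymptotic to its full sum. -/
lemma tendsto_kernel_sum_div {β : ℤ → ℝ} (hβ : Summable β) {c : ℕ → ℤ → ℝ} {σ : ℕ → ℝ}
    (hc : ∀ᶠ T in atTop, 0 < σ T ∧ HasSum (c T) (σ T) ∧ ∀ s, |c T s| ≤ σ T * β s)
    {J : ℝ → ℝ} (hJ : Continuous J) {B : ℝ} (hJB : ∀ x, |J x| ≤ B) (hJ0 : J 0 = 1) {h : ℕ → ℝ}
    (hh : Tendsto h atTop atTop) {M : ℕ → ℕ} (hM : Tendsto M atTop atTop) :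
    Tendsto (fun T => (∑ s ∈ Finset.Ioo (-(M T : ℤ)) (M T), J (s / h T) * c T s) / σ T) atTop
      (𝓝 1) := by
  -- Truncation at `M` and the kernel become one bounded weight tending to one at each lag.
  let w : ℕ → ℤ → ℝ := fun T s => if s ∈ Finset.Ioo (-(M T : ℤ)) (M T) then J (s / h T) else 0
  have hw : ∀ T s, |w T s - 1| ≤ B + 1 := fun T s => by
    have hB0 : 0 ≤ B := (abs_nonneg _).trans (hJB 0)
    simp only [w]
    split_ifs
    · exact (abs_sub _ _).trans (by rw [abs_one]; gcongr; exact hJB _)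
    · simpa using hB0
  have hw1 : ∀ s, Tendsto (fun T => w T s - 1) atTop (𝓝 0) := fun s => by
    have h1 : Tendsto (fun T => J (s / h T) - 1) atTop (𝓝 0) := by
      have := (hJ.tendsto 0).comp (hh.const_div_atTop (s : ℝ))
      rw [hJ0] at this
      simpa [Function.comp_def] using this.sub_const 1
    refine h1.congr' ?_
    filter_upwards [hM.eventually_gt_atTop s.natAbs] with T hT
    simp only [w]
    rw [if_pos (Finset.mem_Ioo.2 (by omega))]
  -- Domination is applied to `c / σ`, so `σ` itself may diverge.
  have key : Tendsto (fun T => ∑' s, (w T s - 1) * (c T s / σ T)) atTop (𝓝 (∑' _ : ℤ, 0)) := by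
    refine tendsto_tsum_of_dominated_convergence (bound := fun s => (B + 1) * β s)
      (hβ.mul_left _) (fun s => ?_) ?_
    · refine squeeze_zero_norm' (a := fun T => |w T s - 1| * β s) ?_ ?_
      · filter_upwards [hc] with T hT
        obtain ⟨h1, -, h3⟩ := hT
        rw [norm_mul, Real.norm_eq_abs, Real.norm_eq_abs, abs_div, abs_of_pos h1]
        gcongr
        rw [div_le_iff₀ h1, mul_comm]
        exact h3 s
      · simpa using (hw1 s).abs.mul_const (β s)
    · filter_upwards [hc] with T hT s
      obtain ⟨h1, -, h3⟩ := hT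
      rw [norm_mul, Real.norm_eq_abs, Real.norm_eq_abs, abs_div, abs_of_pos h1]
      refine mul_le_mul (hw T s) ?_ (by positivity) ((abs_nonneg _).trans (hw T s))
      rw [div_le_iff₀ h1, mul_comm]
      exact h3 s
  rw [tsum_zero] at key
  have := key.add_const 1
  rw [zero_add] at this
  refine this.congr' ?_
  filter_upwards [hc] with T hT
  obtain ⟨h1, h2, h3⟩ := hT
  have e1 : HasSum (fun s => w T s * (c T s / σ T))
      ((∑ s ∈ Finset.Ioo (-(M T : ℤ)) (M T), J (s / h T) * c T s) / σ T) := by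
    rw [Finset.sum_div]
    have : HasSum (fun s => w T s * (c T s / σ T))
        (∑ s ∈ Finset.Ioo (-(M T : ℤ)) (M T), w T s * (c T s / σ T)) :=
      hasSum_sum_of_ne_finset_zero fun s hs => by simp only [w, if_neg hs, zero_mul]
    convert this using 1
    refine Finset.sum_congr rfl fun s hs => ?_
    simp only [w, if_pos hs]
    ring
  have e2 : HasSum (fun s => c T s / σ T) 1 := by
    have := h2.div_const (σ T)
    rwa [div_self h1.ne'] at this
  have e3 := (e1.sub e2).tsum_eq
  simp only [← sub_one_mul] at e3
  rw [e3]
  ring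

/-! ### Calculus of bounds in mean -/

namespace HasMeanBound
variable {Ω : Type*} [MeasurableSpace Ω] {P : Measure Ω} {C C' : ℝ} {p q : ℝ → Ω → Prop}

lemma and (hp : HasMeanBound P C p) (hq : HasMeanBound P C' q)
    (hpm : ∀ ω V V', V ≤ V' → p V ω → p V' ω) (hqm : ∀ ω V V', V ≤ V' → q V ω → q V' ω) :
    HasMeanBound P (C + C') fun V ω => p V ω ∧ q V ω := by
  obtain ⟨V, h0, hi, hC, hV⟩ := hp
  obtain ⟨W, k0, ki, kC, kW⟩ := hq
  refine ⟨fun ω => V ω + W ω, fun ω => add_nonneg (h0 ω) (k0 ω), hi.add ki, ?_, fun ω =>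
    ⟨hpm ω _ _ (by linarith [k0 ω]) (hV ω), hqm ω _ _ (by linarith [h0 ω]) (kW ω)⟩⟩
  rw [integral_add hi ki]
  exact add_le_add hC kC

/-- Markov's inequality for `V`. The set `S` need not be measurable, since it is enclosed in a
superlevel set of `V`. -/
lemma measure_le [IsFiniteMeasure P] (hp : HasMeanBound P C p) {S : Set Ω} {x : ℝ} (hx : 0 < x)
    (hS : ∀ ω V, 0 ≤ V → V < x → p V ω → ω ∉ S) : P S ≤ ENNReal.ofReal (C / x) := by
  obtain ⟨V, h0, hi, hC, hV⟩ := hp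
  have hsub : S ⊆ {ω | x ≤ V ω} := fun ω hω => not_lt.1 fun hlt => hS ω _ (h0 ω) hlt (hV ω) hω
  have h1 := mul_meas_ge_le_integral_of_nonneg (ae_of_all _ h0) hi x
  refine (measure_mono hsub).trans ?_
  rw [← ofReal_measureReal (measure_ne_top _ _)]
  refine ENNReal.ofReal_le_ofReal ?_
  rw [le_div_iff₀ hx, mul_comm]
  exact h1.trans hC

end HasMeanBound

/-! ### Assembly of the error bound for the panel -/

namespace IsShiftModel
variable {Ω : Type*} [MeasurableSpace Ω] {P : Measure Ω} [IsProbabilityMeasure P]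
  {ε : Option ℕ → ℤ → Ω → ℝ} {b : ℕ → ℝ≥0} {K : ℝ≥0} {ρ : Option ℕ → ProbabilityMeasure ℝ}
  {g : Option ℕ → (ℕ → ℝ) → ℝ} {n : ℕ} {μ γ : ℕ → ℝ} {η : ℤ → Ω → ℝ} {e : ℕ → ℤ → Ω → ℝ}

lemma panel_eq (n : ℕ) (μ γ : ℕ → ℝ) (η : ℤ → Ω → ℝ) (e : ℕ → ℤ → Ω → ℝ) (t : ℤ) (ω : Ω) :
    panel n μ γ η e t ω = WithLp.toLp 2 (fun i : Fin n => μ i) +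
      panelDev n γ t (pathOf (fun o t ω => o.elim (η t ω) fun i => e i t ω) ω) := by
  ext i
  simp [panel, panelDev, pathOf, add_assoc]

lemma memLp_coord (h : IsShiftModel P ε b K ρ g) (i : ℕ) (t : ℤ) :
    MemLp (fun ω => γ i * pathOf ε ω none t + pathOf ε ω (some i) t) 2 P :=
  h.memLp (measurable_coord i t) (((h.stable_pathCoord (c := ‖γ i‖₊) (by simp)).memLp t).mono_exponent
    (by norm_num))

lemma integral_pathCoord (h : IsShiftModel P ε b K ρ g) (i : ℕ) (t : ℤ) :
    ∫ ω, (γ i * pathOf ε ω none t + pathOf ε ω (some i) t) ∂P = 0 :=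
  (h.integral_eq (measurable_coord i t)).trans (h.integral_coord i t)

lemma integral_panel (h : IsShiftModel P (fun o t ω => o.elim (η t ω) fun i => e i t ω) b K ρ g)
    (t : ℤ) : ∫ ω, panel n μ γ η e t ω ∂P = WithLp.toLp 2 (fun i : Fin n => μ i) := by
  have hi : ∀ i : Fin n, Integrable (fun ω => panelDev n γ t
      (pathOf (fun o t ω => o.elim (η t ω) fun i => e i t ω) ω) i) P := fun i =>
    (h.memLp_coord i t).integrable (by norm_num)
  simp only [panel_eq]
  rw [integral_add (integrable_const _) (Integrable.of_eval_piLp hi)]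
  simp only [integral_const, probReal_univ, one_smul]
  rw [add_eq_left]
  ext i
  rw [eval_integral_piLp hi]
  exact h.integral_pathCoord i t

lemma popCov_panel (h : IsShiftModel P (fun o t ω => o.elim (η t ω) fun i => e i t ω) b K ρ g)
    (i j : Fin n) : popCov P (panel n μ γ η e) i j =
      ∫ ω, panelDev n γ 0 (pathOf (fun o t ω => o.elim (η t ω) fun i => e i t ω) ω) i *
        panelDev n γ 0 (pathOf (fun o t ω => o.elim (η t ω) fun i => e i t ω) ω) j ∂P := by
  have hL := fun i : Fin n => h.memLp_coord (γ := γ) i 0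
  have h0 := fun i : Fin n => h.integral_pathCoord (γ := γ) i 0
  have hi := fun i : Fin n => (hL i).integrable (by norm_num)
  simp only [popCov, Matrix.of_apply, panel_eq, PiLp.add_apply, panelDev_apply]
  rw [covariance_const_add_left (hi i), covariance_const_add_right (hi j),
    covariance_eq_sub (hL i) (hL j), h0 i, zero_mul, sub_zero]
  rfl

lemma xi_panel (h : IsShiftModel P (fun o t ω => o.elim (η t ω) fun i => e i t ω) b K ρ g)
    (v : EuclideanSpace ℝ (Fin n)) : xi P (panel n μ γ η e) v = fun t ω =>
      inner ℝ v (panelDev n γ t (pathOf (fun o t ω => o.elim (η t ω) fun i => e i t ω) ω)) ^ 2 := by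
  funext t ω
  rw [xi, h.integral_panel, panel_eq, add_sub_cancel_left]

lemma integral_inner_sq_le (h : IsShiftModel P ε b K ρ g) {c : ℝ≥0} (hγ : ∀ i < n, |γ i| ≤ c)
    {v : EuclideanSpace ℝ (Fin n)} (hv : ‖v‖ = 1) :
    ∫ ω, inner ℝ v (panelDev n γ 0 (pathOf ε ω)) ^ 2 ∂P ≤
      2 * (((c + 1) * K : ℝ≥0) : ℝ) ^ 2 * n := by
  rw [h.integral_eq (F := fun y => inner ℝ v (panelDev n γ 0 y) ^ 2)
    ((measurable_inner_panelDev v 0).pow_const 2)]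
  refine (le_abs_self _).trans ((((h.stable_inner_sq hγ hv).mono_exponent (hσ ρ) (q := 2)
    (by norm_num)).abs_integral_le_two 0).trans (le_of_eq ?_))
  push_cast
  ring

lemma hasSum_covariance (h : IsShiftModel P ε b K ρ g) (hb : 1 ≤ b 0)
    (hbs : Summable fun d => (b d : ℝ)) {v : EuclideanSpace ℝ (Fin n)} (hv : ‖v‖ = 1) :
    HasSum (fun s => cov[fun ω => inner ℝ v (panelDev n γ 0 (pathOf ε ω)) ^ 2,
        fun ω => inner ℝ v (panelDev n γ s (pathOf ε ω)) ^ 2; P])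
      (longRunVar P fun t ω => inner ℝ v (panelDev n γ t (pathOf ε ω)) ^ 2) := by
  refine Summable.hasSum (Summable.of_norm_bounded (g := fun s : ℤ => 200 * (K : ℝ) ^ 4 *
    (1 + (∑ i : Fin n, v i * γ i) ^ 2) ^ 2 * b s.natAbs)
    ((summable_int_of_natAbs hbs).mul_left _) fun s => ?_)
  exact h.abs_covariance_inner_sq_le hb hv s

set_option maxHeartbeats 800000 in
/-- Stochastic error of the kernel estimator in terms of a variable with bounded mean. -/
lemma exists_hasMeanBound_kernelLRV
    (h : IsShiftModel P (fun o t ω => o.elim (η t ω) fun i => e i t ω) b K ρ g) (hb : 1 ≤ b 0)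
    (hanti : Antitone b) (hbs : Summable fun d => (b d : ℝ)) (c : ℝ≥0) {c₀ : ℝ} (hc₀ : 0 < c₀) :
    ∃ A C : ℝ, 1 ≤ A ∧ 0 ≤ C ∧ ∀ (n : ℕ) (hn : 0 < n) (μ γ : ℕ → ℝ), (∀ i < n, |γ i| ≤ c) →
      ∀ (lam : Fin n → ℝ) (v : OrthonormalBasis (Fin n) ℝ (EuclideanSpace ℝ (Fin n))),
      IsEigenSystem (popCov P (panel n μ γ η e)) lam v →
      (∀ i, i ≠ ⟨0, hn⟩ → c₀ ≤ lam ⟨0, hn⟩ - lam i) →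
      ∀ T H : ℕ, 0 < T → 2 * H ≤ T →
      HasMeanBound P C fun V ω =>
        ∀ (lam' : Fin n → ℝ) (v' : OrthonormalBasis (Fin n) ℝ (EuclideanSpace ℝ (Fin n))) (k : ℕ),
        1 ≤ k → k < T → IsEigenSystem (sampleCov (fun t => panel n μ γ η e t ω) T) lam' v' →
        ∀ (J : ℝ → ℝ) (B h : ℝ), (∀ x, |J x| ≤ B) → (∀ s : ℤ, (H : ℤ) < |s| → J (s / h) = 0) →
        ∀ M : ℕ, |kernelLRV J h M (xiHat (fun t => panel n μ γ η e t ω) T k (v' ⟨0, hn⟩)) T -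
          ∑ s ∈ Finset.Ioo (-(M : ℤ)) M, J (s / h) *
            cov[xi P (panel n μ γ η e) (v ⟨0, hn⟩) 0, xi P (panel n μ γ η e) (v ⟨0, hn⟩) s; P]| ≤
          B * ((2 * H + 1) * (621 * (4096 * (A * (1 + V))) ^ 4 * (n ^ 3 / √T))) := by
  set ε : Option ℕ → ℤ → Ω → ℝ := fun o t ω => o.elim (η t ω) fun i => e i t ω with hε
  set κ : ℝ := (((c + 1) * K : ℝ≥0) : ℝ) with hκ
  have hκ0 : 0 ≤ κ := NNReal.coe_nonneg _
  set S := ∑' d, (b d : ℝ) with hS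
  have hS0 : 0 ≤ S := tsum_nonneg fun d => (b d).2
  have hA1 : 1 ≤ 1 + 8 / c₀ + 2 * κ ^ 2 := by
    have : 0 ≤ 8 / c₀ := by positivity
    nlinarith
  have hA8 : 8 / c₀ ≤ 1 + 8 / c₀ + 2 * κ ^ 2 := by nlinarith
  have hAκ : 2 * κ ^ 2 ≤ 1 + 8 / c₀ + 2 * κ ^ 2 := by
    have : 0 ≤ 8 / c₀ := by positivity
    linarith
  set A := 1 + 8 / c₀ + 2 * κ ^ 2 with hA
  refine ⟨A, 2048 * (1 + κ ^ 12) + (4096 * partialSumConst κ S + (4096 * partialSumConst κ S +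
    (16 * κ ^ 4 * S + (16 * κ ^ 4 * S + 24576 * κ ^ 8 * b 0 * S)))), hA1, ?_, ?_⟩
  · have : 0 ≤ partialSumConst κ S := by unfold partialSumConst; positivity
    positivity
  intro n hn μ γ hγ lam v hv hgap T H hT hH
  have hn' : (1 : ℝ) ≤ n := by exact_mod_cast hn
  have hT' : (0 : ℝ) < T := by exact_mod_cast hT
  have hv1 : ‖v ⟨0, hn⟩‖ = 1 := v.orthonormal.1 _
  obtain ⟨B2, B3⟩ := h.hasMeanBound_norm_sum hb hbs hn hγ hT
  have B1 := h.hasMeanBound_sum_norm_pow hn hγ hT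
  have B4 := h.hasMeanBound_gram hb hbs hn hγ hT
  have B5 := h.hasMeanBound_inner_sq hb hbs hn hγ hv1 hT
  have B6 := h.hasMeanBound_lagged hb hanti hbs hn hγ hv1 hT hH
  have m1 : ∀ x V V' : ℝ, V ≤ V' → x ≤ V * T → x ≤ V' * T := fun x V V' hV hx =>
    hx.trans (by gcongr)
  have m2 : ∀ V V' : ℝ, V ≤ V' → ∀ l : ℕ, (n : ℝ) ^ 2 * (l * (V * T)) ≤
      (n : ℝ) ^ 2 * (l * (V' * T)) := fun V V' hV l => by gcongr
  have m4 : ∀ x V V' : ℝ, V ≤ V' → x ≤ V * n ^ 2 * T → x ≤ V' * n ^ 2 * T := fun x V V' hV hx =>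
    hx.trans (by gcongr)
  have m6 : ∀ x V V' : ℝ, V ≤ V' → x ≤ V * (2 * H + 1) * n ^ 4 / T →
      x ≤ V' * (2 * H + 1) * n ^ 4 / T := fun x V V' hV hx => hx.trans (by gcongr)
  have B56 := B5.and B6 (fun ω V V' hV => m4 _ V V' hV) (fun ω V V' hV => m6 _ V V' hV)
  have B46 := B4.and B56 (fun ω V V' hV => m4 _ V V' hV)
    (fun ω V V' hV hx => ⟨m4 _ V V' hV hx.1, m6 _ V V' hV hx.2⟩)
  have B36 := B3.and B46 (fun ω V V' hV hx l h1 h2 => (hx l h1 h2).trans (m2 V V' hV l))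
    (fun ω V V' hV hx => ⟨m4 _ V V' hV hx.1, m4 _ V V' hV hx.2.1, m6 _ V V' hV hx.2.2⟩)
  have B26 := B2.and B36 (fun ω V V' hV hx l h1 h2 => (hx l h1 h2).trans (m2 V V' hV l))
    (fun ω V V' hV hx => ⟨fun l h1 h2 => (hx.1 l h1 h2).trans (m2 V V' hV l), m4 _ V V' hV hx.2.1,
      m4 _ V V' hV hx.2.2.1, m6 _ V V' hV hx.2.2.2⟩)
  have B16 := B1.and B26 (fun ω V V' hV => m1 _ V V' hV)
    (fun ω V V' hV hx => ⟨fun l h1 h2 => (hx.1 l h1 h2).trans (m2 V V' hV l),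
      fun l h1 h2 => (hx.2.1 l h1 h2).trans (m2 V V' hV l), m4 _ V V' hV hx.2.2.1,
      m4 _ V V' hV hx.2.2.2.1, m6 _ V V' hV hx.2.2.2.2⟩)
  clear B1 B2 B3 B4 B5 B6 B56 B46 B36 B26
  -- From here on the argument is pathwise: a single `V`, chosen before the eigenvectors, the break
  -- date, the kernel and `M`.
  obtain ⟨V, hV0, hVi, hVC, hV⟩ := B16
  refine ⟨V, hV0, hVi, hVC, fun ω lam' v' k hk hkT hv' J B hw hJB hJH M => ?_⟩
  obtain ⟨b1, b2, b3, b4, b5, b6⟩ := hV ω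
  have hVω := hV0 ω
  clear hV hVC hVi
  set z : ℤ → EuclideanSpace ℝ (Fin n) := fun t => panelDev n γ t (pathOf ε ω) with hz
  set m : EuclideanSpace ℝ (Fin n) := WithLp.toLp 2 fun i : Fin n => μ i with hm
  have hx : ∀ t, panel n μ γ η e t ω - m = z t := fun t => by
    rw [panel_eq, add_sub_cancel_left]
  have hxi : xiHat (fun t => panel n μ γ η e t ω) T k (v' ⟨0, hn⟩) =
      xiHat z T k (v' ⟨0, hn⟩) := by
    rw [← xiHat_sub_const _ m _ hk hkT]
    simp only [hx]
  -- The deterministic lemmas need a constant at least 1, hence `1 + V`; the factor `A` absorbs `8 /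
  -- c₀` and the bound on the mean of the scores.
  set L := A * (1 + V ω) with hL
  have hVL : 1 + V ω ≤ L := le_mul_of_one_le_left (by linarith) hA1
  have hL1 : 1 ≤ L := by linarith
  have hVL' : V ω ≤ L := by linarith
  have hVL2 : V ω ≤ L ^ 2 := hVL'.trans (le_self_pow₀ hL1 two_ne_zero)
  obtain ⟨w, hwv, hwd⟩ := exists_sign_norm_sub_le_of_sampleCov (K := 1 + V ω) (c := m) hn hT hv hv'
    hc₀ (by linarith) hgap (by
      simp only [hx]
      exact (b2 T hT le_rfl).trans (m2 _ _ (by linarith) T)) (by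
      simp only [hx, h.popCov_panel]
      exact b4.trans (by gcongr; linarith))
  have hw1 : ‖w‖ = 1 := by rcases hwv with rfl | rfl <;> simp
  -- The unknown sign of the eigenvector is removed by the square.
  have hwz : ∀ t, inner ℝ w (z t) ^ 2 = inner ℝ (v ⟨0, hn⟩) (z t) ^ 2 := fun t => by
    rcases hwv with rfl | rfl <;> simp
  have hwL : ‖v' ⟨0, hn⟩ - w‖ * √T ≤ L * n := by
    refine hwd.trans ?_
    gcongr
    exact mul_le_mul_of_nonneg_right hA8 (by linarith)
  set m₂ := ∫ ω', inner ℝ (v ⟨0, hn⟩) (panelDev n γ 0 (pathOf ε ω')) ^ 2 ∂P with hm₂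
  have hm₂L : m₂ ≤ L * n := by
    refine (h.integral_inner_sq_le hγ hv1).trans ?_
    rw [← hκ]
    gcongr
    exact hAκ.trans (le_mul_of_one_le_right (by linarith) (by linarith))
  have hsq : √(T : ℝ) ^ 2 = T := Real.sq_sqrt hT'.le
  have hsT : 0 < √(T : ℝ) := Real.sqrt_pos.2 hT'
  have hmean : |timeMean (fun t => inner ℝ w (z t) ^ 2) T - m₂| ≤ L * n / √T := by
    have e1 : timeMean (fun t => inner ℝ w (z t) ^ 2) T - m₂ = (T : ℝ)⁻¹ *
        ∑ t ∈ Finset.Ioc (0 : ℤ) T, (inner ℝ (v ⟨0, hn⟩) (z t) ^ 2 - m₂) := by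
      rw [Finset.sum_sub_distrib, timeMean, mul_sub]
      simp only [hwz]
      have e2 : Finset.Icc (1 : ℤ) T = Finset.Ioc (0 : ℤ) T := by ext; simp; omega
      rw [e2]
      simp [hT'.ne']
    rw [e1, abs_mul, abs_of_pos (inv_pos.2 hT'), inv_mul_le_iff₀ hT']
    refine abs_le_of_sq_le_sq (b5.trans ?_) (by positivity)
    have e3 : (T : ℝ) * (L * n / √T) = L * n * √T := by
      rw [mul_div_assoc', div_eq_iff hsT.ne', mul_assoc (L * n), ← pow_two, hsq]
      ring
    rw [e3, mul_pow, mul_pow, hsq]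
    gcongr
  have hu : ∀ t, 1 ≤ 1 + ‖z t‖ / √n := fun t => by
    have : 0 ≤ ‖z t‖ / √n := by positivity
    linarith
  have hzu : ∀ t, ‖z t‖ ≤ √n * (1 + ‖z t‖ / √n) := fun t => by
    have h1 : 0 < √(n : ℝ) := Real.sqrt_pos.2 (by linarith)
    have : √(n : ℝ) * (1 + ‖z t‖ / √n) = √n + ‖z t‖ := by field_simp
    linarith
  have hac := fun (s : ℤ) (hs : 2 * |s| ≤ T) => abs_autoCov_xiHat_sub_le hn hk hkT hL1 hu hzu
    (b1.trans (by gcongr)) (fun l h1 h2 => (b2 l h1 h2).trans (m2 _ _ hVL' l))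
    (fun l h1 h2 => (b3 l h1 h2).trans (m2 _ _ hVL' l)) hw1 (v'.orthonormal.1 ⟨0, hn⟩) hwL
    (integral_nonneg fun _ => sq_nonneg _) hm₂L hmean hs
  simp only [hwz] at hac
  rw [hxi, h.xi_panel]
  have hE : 0 ≤ L * (n : ℝ) ^ 2 / √T := by positivity
  refine (abs_kernelLRV_sub_le hJB hJH M hE (fun s hs => hac s ?_) (b6.trans ?_)).trans ?_
  · have : |s| ≤ H := abs_le.2 (Finset.mem_Icc.1 hs)
    omega
  · have e4 : (2 * (H : ℝ) + 1) * (L * n ^ 2 / √T) ^ 2 = L ^ 2 * (2 * H + 1) * n ^ 4 / T := by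
      rw [div_pow, hsq]
      ring
    rw [e4]
    gcongr
  · have hB0 : 0 ≤ B := (abs_nonneg _).trans (hJB 0)
    gcongr
    -- The sampling error is of smaller order in `n` and adds only 1 to the constant 620.
    have e5 : L * (n : ℝ) ^ 2 / √T ≤ (4096 * L) ^ 4 * (n ^ 3 / √T) := by
      rw [← mul_div_assoc]
      gcongr
      · calc L ≤ 4096 * L := by linarith
          _ ≤ (4096 * L) ^ 4 := le_self_pow₀ (by linarith) four_ne_zero
      · norm_num
    linarith

end IsShiftModel

/-- A gap below the largest eigenvalue separates it from all the others. -/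
lemma IsEigenSystem.gap {n : ℕ} (hn : 0 < n) {A : Matrix (Fin n) (Fin n) ℝ} {lam : Fin n → ℝ}
    {v : OrthonormalBasis (Fin n) ℝ (EuclideanSpace ℝ (Fin n))} (h : IsEigenSystem A lam v) {c : ℝ}
    (hgap : ∀ h1 : 1 < n, c ≤ lam ⟨0, hn⟩ - lam ⟨1, h1⟩) (i : Fin n) (hi : i ≠ ⟨0, hn⟩) :
    c ≤ lam ⟨0, hn⟩ - lam i := by
  have h0 : (i : ℕ) ≠ 0 := fun h0 => hi (Fin.ext h0)
  have h1 : 1 < n := by omega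
  have := h.1 (show (⟨1, h1⟩ : Fin n) ≤ i from Fin.le_def.2 (by simp; omega))
  linarith [hgap h1]

/-- The squared loading of the first principal component on the factor is dominated by the long-run
variance. -/
lemma exists_loading_sq_le {N : ℕ → ℕ} {γ : ℕ → ℕ → ℝ}
    {v : ∀ T, EuclideanSpace ℝ (Fin (N T))} (hv : ∀ T, ‖v T‖ = 1) {σ : ℕ → ℝ} {V : ℝ}
    (hσ : ∃ c : ℝ, 0 < c ∧ ∀ᶠ T in atTop, c ≤ σ T)
    (hV : BddAbove (Set.range fun T => ∑ i ∈ Finset.range (N T), γ T i ^ 2) ∨ 0 < V)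
    (hle : ∀ T, (∑ i : Fin (N T), v T i * γ T i) ^ 4 * V ≤ σ T) :
    ∃ D : ℝ, ∀ᶠ T in atTop, (1 + (∑ i : Fin (N T), v T i * γ T i) ^ 2) ^ 2 ≤ D * σ T := by
  obtain ⟨c, hc, hcσ⟩ := hσ
  -- With bounded loadings `a² ≤ ‖γ‖²` and the lower bound on `σ` suffice. Otherwise `a⁴ V ≤ σ`
  -- absorbs the growth of `a`.
  rcases hV with ⟨G, hG⟩ | hV
  · refine ⟨(1 + G) ^ 2 / c, ?_⟩
    filter_upwards [hcσ] with T hT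
    have h1 : (∑ i : Fin (N T), v T i * γ T i) ^ 2 ≤ G := by
      have e1 := Finset.sum_mul_sq_le_sq_mul_sq Finset.univ (fun i => v T i)
        (fun i : Fin (N T) => γ T i)
      have e2 := EuclideanSpace.norm_sq_eq (v T)
      simp only [hv, Real.norm_eq_abs, sq_abs, one_pow] at e2
      rw [← e2, one_mul] at e1
      have e3 := hG ⟨T, rfl⟩
      simp only [Finset.sum_range] at e3
      exact e1.trans e3
    calc (1 + (∑ i : Fin (N T), v T i * γ T i) ^ 2) ^ 2 ≤ (1 + G) ^ 2 := by gcongr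
      _ = (1 + G) ^ 2 / c * c := by field_simp
      _ ≤ (1 + G) ^ 2 / c * σ T := by gcongr
  · refine ⟨2 / c + 2 / V, ?_⟩
    filter_upwards [hcσ] with T hT
    set a := ∑ i : Fin (N T), v T i * γ T i
    have h1 : a ^ 4 ≤ σ T / V := by rw [le_div_iff₀ hV]; exact hle T
    have h2 : 1 ≤ σ T / c := by rw [le_div_iff₀ hc]; linarith
    calc (1 + a ^ 2) ^ 2 ≤ 2 * (1 + a ^ 4) := by nlinarith [sq_nonneg (a ^ 2 - 1)]
      _ ≤ 2 * (σ T / c + σ T / V) := by gcongr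
      _ = _ := by ring

/-- A ratio converges in probability to one if its numerator is close to a deterministic sequence
equivalent to the denominator, with an error controlled by variables of bounded mean. -/
lemma tendstoInMeasure_div_one {Ω : Type*} [MeasurableSpace Ω] {P : Measure Ω}
    [IsProbabilityMeasure P] {Y : ℕ → Ω → ℝ} {S σ q : ℕ → ℝ} {C : ℝ} {f : ℝ → ℝ} (hf : Monotone f)
    (hσ : ∃ c : ℝ, 0 < c ∧ ∀ᶠ T in atTop, c ≤ σ T)
    (hS : Tendsto (fun T => S T / σ T) atTop (𝓝 1)) (hq : Tendsto q atTop (𝓝 0))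
    (hq0 : ∀ᶠ T in atTop, 0 ≤ q T)
    (hY : ∀ᶠ T in atTop, HasMeanBound P C fun V ω => |Y T ω - S T| ≤ f V * q T) :
    TendstoInMeasure P (fun T ω => Y T ω / σ T) atTop (fun _ => 1) := by
  obtain ⟨c, hc, hcσ⟩ := hσ
  rw [tendstoInMeasure_iff_dist]
  intro δ hδ
  rw [ENNReal.tendsto_nhds_zero]
  intro ε hε
  have h1 : Tendsto (fun x : ℝ => ENNReal.ofReal (C / x)) atTop (𝓝 0) := by
    simpa using ENNReal.tendsto_ofReal ((tendsto_id (α := ℝ)).const_div_atTop C)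
  -- A level that `V` exceeds with probability at most `ε`, uniformly in `T`.
  obtain ⟨x, hx, hx0⟩ := ((ENNReal.tendsto_nhds_zero.1 h1 ε hε).and (eventually_gt_atTop 0)).exists
  have h2 : Tendsto (fun T => f x * q T) atTop (𝓝 0) := by simpa using hq.const_mul (f x)
  filter_upwards [hcσ, hq0, hY, h2.eventually_lt_const (show 0 < c * (δ / 2) by positivity),
    (Metric.tendsto_nhds.1 hS (δ / 2) (by positivity))] with T t1 t2 t3 t4 t5
  refine (t3.measure_le hx0 fun ω V _ hVx hp hmem => ?_).trans hx
  have hσ0 : 0 < σ T := hc.trans_le t1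
  have e1 : |Y T ω - S T| < σ T * (δ / 2) :=
    calc |Y T ω - S T| ≤ f V * q T := hp
      _ ≤ f x * q T := by gcongr; exact hf hVx.le
      _ < c * (δ / 2) := t4
      _ ≤ σ T * (δ / 2) := by gcongr
  have e2 : dist (Y T ω / σ T) (S T / σ T) < δ / 2 := by
    rw [Real.dist_eq, ← sub_div, abs_div, abs_of_pos hσ0, div_lt_iff₀ hσ0, mul_comm]
    exact e1
  have e3 := dist_triangle (Y T ω / σ T) (S T / σ T) 1
  exact absurd hmem (not_le.2 (by linarith : dist (Y T ω / σ T) 1 < δ))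

end PanelEigen

/-! ### The theorem -/

open PanelEigen in
theorem theorem3p1
    {Ω : Type*} [MeasurableSpace Ω] (P : Measure Ω) [IsProbabilityMeasure P]
    -- the panel: dimension, means and loadings may change with `T`
    (N : ℕ → ℕ) (hN : ∀ T, 0 < N T)
    (μ γ : ℕ → ℕ → ℝ) (η : ℤ → Ω → ℝ) (e : ℕ → ℤ → Ω → ℝ)
    (X : ∀ T : ℕ, ℤ → Ω → EuclideanSpace ℝ (Fin (N T)))
    (hX : ∀ T, X T = panel (N T) (μ T) (γ T) η e)
    -- eigenvalues and eigenvectors of the population covariance matrix; spectral gap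
    (lam : ∀ T : ℕ, Fin (N T) → ℝ)
    (v : ∀ T : ℕ, OrthonormalBasis (Fin (N T)) ℝ (EuclideanSpace ℝ (Fin (N T))))
    (hv : ∀ T, IsEigenSystem (popCov P (X T)) (lam T) (v T))
    (K : ℕ) (hK : 1 ≤ K) (c₀ : ℝ) (hc₀ : 0 < c₀)
    (hgap : ∀ (T i : ℕ) (hi : i + 1 < N T), i < K →
      c₀ ≤ lam T ⟨i, Nat.lt_of_succ_lt hi⟩ - lam T ⟨i + 1, hi⟩)
    -- bounded loadings
    (c₁ : ℝ) (hγ : ∀ T i, i < N T → |γ T i| ≤ c₁)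
    -- common factor
    (χη : ℕ → ENNReal) (c₂ αη : ℝ) (hαη : 1 < αη)
    (hη : IsApproximableShift P 12 η χη)
    (hχη : ∀ m : ℕ, 1 ≤ m → χη m ≤ ENNReal.ofReal (c₂ * (m : ℝ) ^ (-αη)))
    (hη_var : ∫ ω, η 0 ω ^ 2 ∂P = 1)
    -- idiosyncratic errors
    (χe : ℕ → ℕ → ENNReal) (c₃ αe : ℝ) (hαe : 1 < αe)
    (he : ∀ i, IsApproximableShift P 12 (e i) (χe i))
    (hχe : ∀ i m : ℕ, 1 ≤ m → χe i m ≤ ENNReal.ofReal (c₃ * (m : ℝ) ^ (-αe)))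
    (c₄ c₅ : ℝ) (hc₄ : 0 < c₄)
    (he_var : ∀ i, c₄ ≤ ∫ ω, e i 0 ω ^ 2 ∂P ∧ ∫ ω, e i 0 ω ^ 2 ∂P ≤ c₅)
    (c₆ : ℝ) (he_mom : ∀ i, ∫ ω, e i 0 ω ^ 12 ∂P ≤ c₆)
    -- the sequences `η, e 0, e 1, …` are independent
    (hindep : iIndepFun
      (fun (o : Option ℕ) (ω : Ω) (t : ℤ) => o.elim (η t ω) (fun i => e i t ω)) P)
    -- the norming constant and its non-degeneracy
    (σsq : ℕ → ℝ)
    (hσsq : ∀ T, σsq T = longRunVar P (xi P (X T) (v T ⟨0, hN T⟩)))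
    (hσ_pos : ∃ c : ℝ, 0 < c ∧ ∀ᶠ T in atTop, c ≤ σsq T)
    (hV : BddAbove (Set.range fun T => ∑ i ∈ Finset.range (N T), γ T i ^ 2) ∨
      0 < longRunVar P (fun t ω => η t ω ^ 2))
    -- kernel, bandwidth and growth conditions
    (J : ℝ → ℝ) (hJ_cont : Continuous J) (hJ_even : ∀ x, J (-x) = J x)
    (hJ_supp : Bornology.IsBounded (Function.support J)) (hJ_zero : J 0 = 1)
    (hNT : Tendsto (fun T : ℕ => (N T : ℝ) * Real.log T ^ (1 / 3 : ℝ) / (T : ℝ) ^ (1 / 2 : ℝ))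
      atTop (𝓝 0))
    (h : ℕ → ℝ) (hh : Tendsto h atTop atTop)
    (hhN : Tendsto (fun T : ℕ => h T * (N T : ℝ) ^ 3 / (T : ℝ) ^ (1 / 2 : ℝ)) atTop (𝓝 0))
    -- empirical eigenvalues and eigenvectors, and the least squares break estimator
    (lamHat : ∀ T : ℕ, Ω → Fin (N T) → ℝ)
    (vHat : ∀ T : ℕ, Ω → OrthonormalBasis (Fin (N T)) ℝ (EuclideanSpace ℝ (Fin (N T))))
    (hvHat : ∀ T ω, IsEigenSystem (sampleCov (fun t => X T t ω) T) (lamHat T ω) (vHat T ω))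
    (tHat : ℕ → Ω → ℕ)
    (htHat : ∀ T, 2 ≤ T → ∀ ω, IsLeastSquaresBreak (fun t => X T t ω) T (tHat T ω)) :
    -- all available lags `|s| ≤ T - 1`
    TendstoInMeasure P
      (fun T ω => kernelLRV J (h T) T
        (xiHat (fun t => X T t ω) T (tHat T ω) (vHat T ω ⟨0, hN T⟩)) T / σsq T)
      atTop (fun _ => 1) ∧
    -- lags `|s| ≤ N - 1`, when `N → ∞`
    (Tendsto N atTop atTop →
      TendstoInMeasure P
        (fun T ω => kernelLRV J (h T) (N T)
          (xiHat (fun t => X T t ω) T (tHat T ω) (vHat T ω ⟨0, hN T⟩)) T / σsq T)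
        atTop (fun _ => 1)) := by
  classical
  set ε : Option ℕ → ℤ → Ω → ℝ := fun o t ω => o.elim (η t ω) fun i => e i t ω with hε
  obtain ⟨α, K₀, ρ, g, hα, hmod⟩ := exists_isShiftModel hαη hη hχη hαe he hχe he_mom hindep
  have hb : 1 ≤ polyRate α 0 := (polyRate_zero α).ge
  have hanti := polyRate_antitone (show 0 ≤ α by linarith)
  have hbs := summable_polyRate hα
  obtain rfl : X = fun T => panel (N T) (μ T) (γ T) η e := funext hX
  obtain ⟨A, C, hA, -, hbound⟩ :=
    hmod.exists_hasMeanBound_kernelLRV hb hanti hbs c₁.toNNReal hc₀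
  have hγ' : ∀ T, ∀ i < N T, |γ T i| ≤ c₁.toNNReal := fun T i hi =>
    (hγ T i hi).trans (Real.le_coe_toNNReal c₁)
  have hv1 : ∀ T, ‖v T ⟨0, hN T⟩‖ = 1 := fun T => (v T).orthonormal.1 _
  have hgap' : ∀ T i, i ≠ ⟨0, hN T⟩ → c₀ ≤ lam T ⟨0, hN T⟩ - lam T i := fun T =>
    (hv T).gap (hN T) fun h1 => hgap T 0 h1 hK
  -- the population long-run variance
  set cv : ℕ → ℤ → ℝ := fun T s => cov[xi P (panel (N T) (μ T) (γ T) η e) (v T ⟨0, hN T⟩) 0,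
    xi P (panel (N T) (μ T) (γ T) η e) (v T ⟨0, hN T⟩) s; P] with hcv
  have hsum : ∀ T, HasSum (cv T) (σsq T) := fun T => by
    rw [hσsq]
    simp only [hcv, hmod.xi_panel]
    exact hmod.hasSum_covariance hb hbs (hv1 T)
  have hcvle : ∀ T s, |cv T s| ≤ 200 * K₀ ^ 4 *
      (1 + (∑ i : Fin (N T), v T ⟨0, hN T⟩ i * γ T i) ^ 2) ^ 2 * polyRate α s.natAbs := fun T s => by
    simp only [hcv, hmod.xi_panel]
    exact hmod.abs_covariance_inner_sq_le hb (hv1 T) s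
  obtain ⟨D, hD⟩ := exists_loading_sq_le hv1 hσ_pos hV fun T => by
    rw [hσsq]
    simp only [hmod.xi_panel]
    exact hmod.factor_longRunVar_le hb hbs (hv1 T)
  -- the kernel
  obtain ⟨R, hR⟩ := hJ_supp.subset_closedBall 0
  have hJR : ∀ x, R < |x| → J x = 0 := fun x hx => by
    by_contra h0
    have := hR h0
    rw [Metric.mem_closedBall, dist_zero_right, Real.norm_eq_abs] at this
    linarith
  -- Since `J 0 = 1`, the origin lies in the support.
  have hR0 : 0 ≤ R := by
    by_contra hneg
    have := hJR 0 (by rw [abs_zero]; linarith)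
    linarith
  obtain ⟨B, hJB⟩ := hJ_cont.bounded_above_of_compact_support
    (HasCompactSupport.of_support_subset_isCompact (isCompact_closedBall 0 R) hR)
  have hB0 : 0 ≤ B := (norm_nonneg _).trans (hJB 0)
  -- growth conditions
  set q : ℕ → ℝ := fun T => h T * (N T : ℝ) ^ 3 / √T with hq
  have hq0 : Tendsto q atTop (𝓝 0) := by simpa only [hq, Real.sqrt_eq_rpow] using hhN
  -- `⌊R h⌋` is the largest lag in the support of the kernel. The bandwidth condition puts it below
  -- `T / 2` and makes the number of lags times `N³ / √T` of order `q`.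
  have hH : ∀ᶠ T : ℕ in atTop, 0 ≤ q T ∧ 2 ≤ T ∧ 1 ≤ h T ∧ 2 * ⌊R * h T⌋₊ ≤ T ∧
      (2 * (⌊R * h T⌋₊ : ℝ) + 1) * ((N T : ℝ) ^ 3 / √T) ≤ (2 * R + 1) * q T := by
    have h2 : Tendsto (fun T => 2 * R * q T) atTop (𝓝 0) := by simpa using hq0.const_mul (2 * R)
    filter_upwards [hh.eventually_ge_atTop 1, eventually_ge_atTop 2,
      h2.eventually_lt_const one_pos] with T t1 t2 t3
    have hN1 : (1 : ℝ) ≤ N T := by exact_mod_cast hN T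
    have hN3 : (1 : ℝ) ≤ (N T : ℝ) ^ 3 := one_le_pow₀ hN1
    have hT1 : (1 : ℝ) ≤ T := by exact_mod_cast (by omega : 1 ≤ T)
    have hsT : 1 ≤ √(T : ℝ) := Real.one_le_sqrt.2 hT1
    have hfl : (⌊R * h T⌋₊ : ℝ) ≤ R * h T := Nat.floor_le (by positivity)
    refine ⟨by positivity, t2, t1, ?_, ?_⟩
    · have e1 : h T ≤ q T * √T := by
        simp only [hq]
        rw [div_mul_cancel₀ _ (by positivity)]
        exact le_mul_of_one_le_right (by linarith) hN3
      have e2 : √(T : ℝ) ≤ T := by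
        nlinarith [Real.sq_sqrt (show (0 : ℝ) ≤ T by linarith)]
      have e3 : 2 * (⌊R * h T⌋₊ : ℝ) ≤ T :=
        calc 2 * (⌊R * h T⌋₊ : ℝ) ≤ 2 * (R * (q T * √T)) := by
              refine mul_le_mul_of_nonneg_left (hfl.trans ?_) two_pos.le
              gcongr
          _ = 2 * R * q T * √T := by ring
          _ ≤ 1 * √T := by gcongr
          _ ≤ T := by rw [one_mul]; exact e2
      exact_mod_cast e3
    · calc (2 * (⌊R * h T⌋₊ : ℝ) + 1) * ((N T : ℝ) ^ 3 / √T)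
          ≤ (2 * (R * h T) + h T) * ((N T : ℝ) ^ 3 / √T) := by gcongr
        _ = (2 * R + 1) * q T := by simp only [hq]; ring
  -- The truncation point only has to diverge, so one argument gives both claims.
  have key : ∀ M : ℕ → ℕ, Tendsto M atTop atTop → TendstoInMeasure P
      (fun T ω => kernelLRV J (h T) (M T)
        (xiHat (fun t => panel (N T) (μ T) (γ T) η e t ω) T (tHat T ω) (vHat T ω ⟨0, hN T⟩)) T /
          σsq T) atTop (fun _ => 1) := by
    intro M hM
    refine tendstoInMeasure_div_one
      (S := fun T => ∑ s ∈ Finset.Ioo (-(M T : ℤ)) (M T), J (s / h T) * cv T s)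
      -- The next line uses `max V 0` because an even power is monotone only on nonnegative
      -- arguments.
      (q := fun T => B * ((2 * R + 1) * q T)) (C := C)
      (f := fun V => 621 * (4096 * (A * (1 + max V 0))) ^ 4) (fun V V' hVV => by
        dsimp only
        gcongr) hσ_pos ?_ ?_ ?_ ?_
    · obtain ⟨c, hc, hcσ⟩ := hσ_pos
      refine tendsto_kernel_sum_div (β := fun s => D * (200 * K₀ ^ 4) * polyRate α s.natAbs)
        ((summable_int_of_natAbs hbs).mul_left _) ?_ hJ_cont hJB hJ_zero hh hM
      filter_upwards [hcσ, hD] with T t1 t2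
      refine ⟨hc.trans_le t1, hsum T, fun s => (hcvle T s).trans ?_⟩
      calc 200 * (K₀ : ℝ) ^ 4 * (1 + (∑ i : Fin (N T), v T ⟨0, hN T⟩ i * γ T i) ^ 2) ^ 2 *
            polyRate α s.natAbs
          ≤ 200 * (K₀ : ℝ) ^ 4 * (D * σsq T) * polyRate α s.natAbs := by gcongr
        _ = _ := by ring
    · simpa using (hq0.const_mul (2 * R + 1)).const_mul B
    · filter_upwards [hH] with T hT
      have := hT.1
      positivity
    · filter_upwards [hH] with T hT
      obtain ⟨t0, t2, t1, t3, t4⟩ := hT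
      obtain ⟨V, hV0, hVi, hVC, hV'⟩ := hbound (N T) (hN T) (μ T) (γ T) (hγ' T) (lam T) (v T) (hv T)
        (hgap' T) T ⌊R * h T⌋₊ (by omega) t3
      refine ⟨V, hV0, hVi, hVC, fun ω => ?_⟩
      have hts := (htHat T t2 ω).1
      refine (hV' ω (lamHat T ω) (vHat T ω) (tHat T ω) hts.1 hts.2 (hvHat T ω) J B (h T) hJB
        (fun s hs => hJR _ ?_) (M T)).trans ?_
      · have hh0 : 0 < h T := by linarith
        rw [← Int.natCast_natAbs] at hs
        have e1 : R * h T < (s.natAbs : ℝ) := Nat.lt_of_floor_lt (by exact_mod_cast hs)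
        rw [abs_div, abs_of_pos hh0, lt_div_iff₀ hh0]
        rwa [Nat.cast_natAbs, Int.cast_abs] at e1
      · rw [max_eq_left (hV0 ω)]
        have hVω := hV0 ω
        calc B * ((2 * (⌊R * h T⌋₊ : ℝ) + 1) * (621 * (4096 * (A * (1 + V ω))) ^ 4 *
              ((N T : ℝ) ^ 3 / √T)))
            = 621 * (4096 * (A * (1 + V ω))) ^ 4 * (B * ((2 * (⌊R * h T⌋₊ : ℝ) + 1) *
              ((N T : ℝ) ^ 3 / √T))) := by ring
          _ ≤ 621 * (4096 * (A * (1 + V ω))) ^ 4 * (B * ((2 * R + 1) * q T)) := by gcongr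
  exact ⟨key id tendsto_id, key N⟩
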